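/- **Setting.** Let $d,m\ge 1$ be integers, $\mathbb T=\mathbb R/\mathbb Z$ with normalized Lebesgue measure, and $L_2$-spaces complex valued with $\langle f,g\rangle=\int f\overline g$. For $g\in L_2(\mathbb R)$ put $g_{j,k}(x)=2^{j/2}g(2^jx-k)$ ($j\in\mathbb N_0$, $k\in\mathbb Z$). Let $\varphi,\psi:\mathbb R\to\mathbb R$ be square integrable and let $V_j$, $W_j$ ($j\in\mathbb N_0$) be the closed linear spans in $L_2(\mathbb R)$ of $\{\varphi_{j,k}\}_{k\in\mathbb Z}$ and $\{\psi_{j,k}\}_{k\in\mathbb Z}$. Assume that $V_{j+1}=V_j\oplus W_j$ orthogonally for every $j\ge0$ and that $\bigcup_j V_j$ is dense, i.e. $L_2(\mathbb R)=V_0\oplus W_0\oplus W_1\oplus\cdots$ with mutually orthogonal summands. Let $\psi^{\rm per}_{j,k}(x)=\sum_{\ell\in\mathbb Z}\psi_{j,k}(x+\ell)$ for $j\ge0$, $0\le k<2^j$, and $\psi^{\rm per}_{-1,0}=1$. Assume, for constants $S,\delta\in\mathbb R$ and $\gamma>0$: * (compact support) $\psi=0$ outside $[0,S]$; * (vanishing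 moments of order $m$) $\int_{\mathbb R}\psi(x)x^\beta\,dx=0$ for $\beta=0,\dots,m-1$; * (Riesz bases) for all $j\ge0$ and all complex $(c_k)_{k<2^j}$, $\ \gamma\sum_k|c_k|^2\le\big\|\sum_{k}c_k\psi^{\rm per}_{j,k}\big\|_{L_2(\mathbb T)}^2\le\delta\sum_k|c_k|^2$. For each $j\ge-1$ let $\{\psi^{{\rm per}*}_{j,k}\}_k$ be the basis of $\operatorname{span}\{\psi^{\rm per}_{j,k}\}_k$ that is biorthogonal to $\{\psi^{\rm per}_{j,k}\}_k$. For $\mathbf j\in\{-1,0,1,\dots\}^d$ let $\mathcal I_{\mathbf j}=\prod_i\mathcal I_{j_i}$ with $\mathcal I_j=\{0,\dots,2^j-1\}$ for $j\ge0$ and $\mathcal I_{-1}=\{0\}$, let $|\mathbf j|_1=\sum_{i:\,j_i\ge0}j_i$, and let $\psi^{\rm per}_{\mathbf j,\mathbf k}(\mathbf x)=\prod_i\psi^{\rm per}_{j_i,k_i}(x_i)$, $\psi^{{\rm per}*}_{\mathbf j,\mathbf k}(\mathbf x)=\prod_i\psi^{{\rm per}*}_{j_i,k_i}(x_i)$.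 For $n\in\mathbb N$ and $f\in L_2(\mathbb T^d)$ define $$P_nf=\sum_{\mathbf j\ge-\mathbf 1,\ |\mathbf j|_1\le n}\ \sum_{\mathbf k\in\mathcal I_{\mathbf j}}\langle f,\psi^{{\rm per}*}_{\mathbf j,\mathbf k}\rangle\,\psi^{\rm per}_{\mathbf j,\mathbf k},\qquad N=N(n)=\operatorname{rank}P_n .$$ Finally, with the Fourier coefficients $c_{\mathbf k}(f)=\int_{\mathbb T^d}f(\mathbf x)e^{-2\pi i\langle\mathbf k,\mathbf x\rangle}\,d\mathbf x$, let $\|f\|_{H^m_{\rm mix}}^2=\sum_{\mathbf k\in\mathbb Z^d}|c_{\mathbf k}(f)|^2\prod_{i=1}^d(1+|k_i|^2)^m$, and let $H^m_{\rm mix}(\mathbb T^d)$ be the set of $f\in L_2(\mathbb T^d)$ for which this is finite. **Statement.** There are constants $C_1,C_2$, depending only on $d,m,S,\gamma,\delta$, such that for all such $\varphi,\psi$, all $f\in H^m_{\rm mix}(\mathbb T^d)$ and all integers $n\ge1$, $$\|f-P_nf\|_{L_2(\mathbb T^d)}\le C_1\,2^{-mn}\,n^{(d-1)/2}\,\|f\|_{H^m_{\rm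 mix}}$$ and $$2^{-mn}\,n^{(d-1)/2}\,\|f\|_{H^m_{\rm mix}}\le C_2\,N^{-m}(\log N)^{(m+\frac12)(d-1)}\,\|f\|_{H^m_{\rm mix}} .$$ -/

import Mathlib

open MeasureTheory

noncomputable section

namespace HyperbolicWavelet

/-- The class in `L₂(μ)` of a square integrable function (and `0` for any other function). -/
def toL2 {α : Type*} [MeasurableSpace α] (μ : Measure α) (g : α → ℂ) : Lp ℂ 2 μ :=
  open Classical in if h : MemLp g 2 μ then h.toLp g else 0

/-! ### Functions on the real line -/

/-- The dilated and translated function `g_{j,k}(x) = 2^{j/2} g(2^j x - k)`. -/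
def dilate (g : ℝ → ℂ) (j : ℕ) (k : ℤ) (x : ℝ) : ℂ :=
  (((2 : ℝ) ^ ((j : ℝ) / 2) : ℝ) : ℂ) * g ((2 : ℝ) ^ j * x - k)

/-- The closed linear span in `L₂(ℝ)` of the functions `g_{j,k}`, `k ∈ ℤ`. For a scaling function
`φ` this is `V_j`, for a wavelet `ψ` it is `W_j`. -/
def shiftSpace (g : ℝ → ℂ) (j : ℕ) : Submodule ℂ (Lp ℂ 2 (volume : Measure ℝ)) :=
  (Submodule.span ℂ (Set.range fun k : ℤ => toL2 volume (dilate g j k))).topologicalClosure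

/-- A real valued function, regarded as complex valued. -/
def complexify (ψ : ℝ → ℝ) (x : ℝ) : ℂ := (ψ x : ℂ)

/-- `φ` is a scaling function and `ψ` an associated (semi-orthogonal) wavelet: with
`V_j = shiftSpace φ j` and `W_j = shiftSpace ψ j`, the space `V_{j+1}` is the orthogonal sum of
`V_j` and `W_j`, and the union of the `V_j` is dense in `L₂(ℝ)`. In other words,
`L₂(ℝ) = V_0 ⊕ W_0 ⊕ W_1 ⊕ ⋯` with mutually orthogonal summands. -/
structure IsScalingPair (φ ψ : ℝ → ℝ) : Prop where
  memLp_scaling : MemLp (complexify φ) 2 (volume : Measure ℝ)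
  memLp_wavelet : MemLp (complexify ψ) 2 (volume : Measure ℝ)
  orthogonal : ∀ j : ℕ, shiftSpace (complexify φ) j ⟂ shiftSpace (complexify ψ) j
  sup_eq : ∀ j : ℕ, shiftSpace (complexify φ) j ⊔ shiftSpace (complexify ψ) j =
    shiftSpace (complexify φ) (j + 1)
  dense : (⨆ j : ℕ, shiftSpace (complexify φ) j).topologicalClosure = ⊤

/-! ### Functions on the torus -/

theorem periodization_periodic (g : ℝ → ℂ) :
    Function.Periodic (fun x : ℝ => ∑' l : ℤ, g (x + l)) 1 := by
  intro x
  change ∑' l : ℤ, g (x + 1 + l) = ∑' l : ℤ, g (x + l)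
  rw [← (Equiv.addRight (1 : ℤ)).tsum_eq (fun l : ℤ => g (x + l))]
  refine tsum_congr fun l => ?_
  simp only [Equiv.coe_addRight, Int.cast_add, Int.cast_one]
  congr 1
  ring

/-- The `1`-periodization `∑_{l ∈ ℤ} g(x + l)` as a function on `𝕋 = ℝ/ℤ`. -/
def periodize (g : ℝ → ℂ) : UnitAddCircle → ℂ :=
  (periodization_periodic g).lift

/-- The periodized wavelets `ψ^per_{j,k}` on `𝕋`, `j ≥ -1`. On the level `j = -1` there is only the
constant function `1`. -/
def perWavelet (ψ : ℝ → ℝ) (j : ℤ) (k : ℤ) : UnitAddCircle → ℂ :=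
  if j < 0 then fun _ => 1 else periodize (dilate (complexify ψ) j.toNat k)

/-- The properties (compact support, `m` vanishing moments, periodic Riesz bases on every level). -/
structure IsWavelet (m : ℕ) (S γ δ : ℝ) (ψ : ℝ → ℝ) : Prop where
  support_subset : Function.support ψ ⊆ Set.Icc 0 S
  moments : ∀ β : ℕ, β < m → ∫ x : ℝ, ψ x * x ^ β = 0
  riesz_lower : ∀ (j : ℕ) (c : Fin (2 ^ j) → ℂ),
    γ * ∑ k, ‖c k‖ ^ 2 ≤
      ‖∑ k, c k • toL2 AddCircle.haarAddCircle (perWavelet ψ j (k : ℕ))‖ ^ 2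
  riesz_upper : ∀ (j : ℕ) (c : Fin (2 ^ j) → ℂ),
    ‖∑ k, c k • toL2 AddCircle.haarAddCircle (perWavelet ψ j (k : ℕ))‖ ^ 2 ≤
      δ * ∑ k, ‖c k‖ ^ 2

/-- The index set `I_j = {0, …, 2^j - 1}` for `j ≥ 0`, and `{0}` for `j = -1`. -/
abbrev Idx (j : ℤ) : Type := Fin (2 ^ j.toNat)

/-- The Gram matrix of the periodized wavelets of level `j`. -/
def gramMatrix (ψ : ℝ → ℝ) (j : ℤ) : Matrix (Idx j) (Idx j) ℂ :=
  Matrix.gram ℂ fun k : Idx j => toL2 AddCircle.haarAddCircle (perWavelet ψ j (k : ℕ))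

/-- The dual wavelets `ψ^{per*}_{j,k}`: the basis of the span of the periodized wavelets of level
`j` that is biorthogonal to them, `⟨ψ^per_{j,l}, ψ^{per*}_{j,k}⟩ = δ_{l,k}`, written out by means of
the inverse of the Gram matrix. -/
def dualWavelet (ψ : ℝ → ℝ) (j : ℤ) (k : Idx j) (t : UnitAddCircle) : ℂ :=
  ∑ l : Idx j, (gramMatrix ψ j)⁻¹ l k * perWavelet ψ j (l : ℕ) t

/-- The normalized Haar (Lebesgue) measure on `𝕋^d`. -/
abbrev torusMeasure (d : ℕ) : Measure (UnitAddTorus (Fin d)) :=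
  Measure.pi fun _ => AddCircle.haarAddCircle

/-- The space `L₂(𝕋^d)`. -/
abbrev L2Torus (d : ℕ) : Type := Lp ℂ 2 (torusMeasure d)

/-- The index set `I_{𝐣} = I_{j_1} × ⋯ × I_{j_d}`. -/
abbrev MultiIdx {d : ℕ} (j : Fin d → ℤ) : Type := ∀ i, Idx (j i)

/-- The tensor product wavelet `ψ^per_{𝐣,𝐤}`. -/
def tensorWavelet {d : ℕ} (ψ : ℝ → ℝ) (j : Fin d → ℤ) (k : MultiIdx j) : L2Torus d :=
  toL2 (torusMeasure d) fun x => ∏ i, perWavelet ψ (j i) (k i : ℕ) (x i)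

/-- The tensor product dual wavelet `ψ^{per*}_{𝐣,𝐤}`. -/
def tensorDual {d : ℕ} (ψ : ℝ → ℝ) (j : Fin d → ℤ) (k : MultiIdx j) : L2Torus d :=
  toL2 (torusMeasure d) fun x => ∏ i, dualWavelet ψ (j i) (k i) (x i)

/-- The index set `𝒥_n` of all `𝐣 ∈ ℤ^d` with `𝐣 ≥ -1` and `|𝐣|₁ = ∑_{j_i ≥ 0} j_i ≤ n`
(every component of such a `𝐣` is at most `n`). -/
def levels (d n : ℕ) : Finset (Fin d → ℤ) :=
  (Fintype.piFinset fun _ => Finset.Icc (-1 : ℤ) n).filter fun j => ∑ i, max (j i) 0 ≤ n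

/-- The operator `P_n f = ∑_{𝐣 ∈ 𝒥_n} ∑_{𝐤 ∈ I_𝐣} ⟨f, ψ^{per*}_{𝐣,𝐤}⟩ ψ^per_{𝐣,𝐤}` on `L₂(𝕋^d)`. -/
def waveletProj (d : ℕ) (ψ : ℝ → ℝ) (n : ℕ) : L2Torus d →L[ℂ] L2Torus d :=
  ∑ j ∈ levels d n, ∑ k : MultiIdx j,
    (innerSL ℂ (tensorDual ψ j k)).smulRight (tensorWavelet ψ j k)

/-- The rank of the operator `P_n`. -/
def projRank (d : ℕ) (ψ : ℝ → ℝ) (n : ℕ) : ℕ :=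
  Module.finrank ℂ (LinearMap.range (waveletProj d ψ n).toLinearMap)

/-- The summand `|c_𝐤(f)|² ∏_i (1 + |k_i|²)^m` of the squared mixed Sobolev norm. -/
def mixTerm {d : ℕ} (m : ℕ) (f : L2Torus d) (k : Fin d → ℤ) : ℝ :=
  ‖UnitAddTorus.mFourierCoeff f k‖ ^ 2 * ∏ i, (1 + (k i : ℝ) ^ 2) ^ m

/-- Membership in the Sobolev space `H^m_mix(𝕋^d)` of dominating mixed smoothness. -/
def MemHMix {d : ℕ} (m : ℕ) (f : L2Torus d) : Prop :=
  Summable (mixTerm m f)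

/-- The norm of `H^m_mix(𝕋^d)`. -/
def hMixNorm {d : ℕ} (m : ℕ) (f : L2Torus d) : ℝ :=
  Real.sqrt (∑' k, mixTerm m f k)

end HyperbolicWavelet

end

noncomputable section
namespace HyperbolicWavelet
open scoped ENNReal InnerProductSpace

/-! ### Tensor products of Bessel families -/

/-! The tensor levels are mutually orthogonal and together complete in L₂(𝕋^d). Hence `P_n` is the
orthogonal projection onto the levels with |𝐣|₁ ≤ n, and ‖f − P_n f‖² is the limit of sums of ‖Q_𝐣
f‖² over levels with |𝐣|₁ > n, where Q_𝐣 is `levelOp ψ 𝐣`. What remains is a bound of order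
2^{-m|𝐣|₁}‖f‖ in the mixed norm for Q_𝐣 f (`norm_levelOp_sq_le`) and the count of levels with |𝐣|₁ =
s, at most 2(s+2)^{d-1} (`card_level_le`).

The level bound is a duality argument. For v = Q_𝐣 f = ∑ c_k ψ_k one has ‖v‖² = ⟨f, v⟩, at most the
H^m norm of f times the H^{-m} norm of v. The latter is at most C 2^{-m|𝐣|₁}‖c‖, and ‖c‖ ≤ C‖v‖ by
the lower Riesz bound. Vanishing moments enter in the H^{-m} estimate: the Fourier coefficient of a
periodized wavelet at n is 2^{-j/2} times a phase times ψ̂(n/2^j), with ψ̂(ξ) = O(min(1, |ξ|^m)),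
and the phases are summed by discrete Parseval (`tsum_dualWeight_natCast_le`). No smoothness of ψ is
needed. Weights and coefficients are products, so `tsum_enorm_sq_tensor_le` carries the bounds from
the circle to the torus.

Completeness on the circle (`eq_zero_of_inner_circleWavelet_eq_zero`) is delicate, because φ has
neither compact support nor stable translates. If a unit vector h is orthogonal to 1 and to all
periodized wavelets, cut its periodic extension to 2M+1 periods. Only wavelets meeting the cuts have
nonzero coefficients, so the distance to V₀ is bounded independently of M; the same holds for the
constant 1. Thus V₀ would almost contain long blocks of two mutually orthogonal orthonormal
sequences of translates, which is impossible for a space generated by the translates of one function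
(`not_bounded_dist_principal`).

For the second inequality, biorthogonality gives that N is the sum of 2^{|𝐣|₁} over the admissible
levels, which lies between 2^n and a constant times n^{d-1} 2^n. -/

theorem tsum_enorm_sq_tensor_le {κ : Type*} : ∀ {d : ℕ} {ι : Fin d → Type} [∀ i, Fintype (ι i)]
    (A : ∀ i, ι i → κ → ℂ) (B : Fin d → ℝ≥0∞)
    (_ : ∀ i (c : ι i → ℂ), ∑' y, ‖∑ x, c x * A i x y‖ₑ ^ 2 ≤ B i * ∑ x, ‖c x‖ₑ ^ 2)
    (c : (∀ i, ι i) → ℂ),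
    ∑' y : Fin d → κ, ‖∑ x, c x * ∏ i, A i (x i) (y i)‖ₑ ^ 2 ≤ (∏ i, B i) * ∑ x, ‖c x‖ₑ ^ 2
  | 0, ι, _, A, B, _, c => by
    rw [tsum_eq_single (default : Fin 0 → κ) (fun b hb => (hb (Subsingleton.elim _ _)).elim)]
    simp
  | d + 1, ι, _, A, B, h, c => by
    have ih := tsum_enorm_sq_tensor_le (d := d) (ι := fun i => ι i.succ) (fun i => A i.succ)
      (fun i => B i.succ) (fun i => h i.succ)
    have e1 : ∀ f : (∀ i, ι i) → ℝ≥0∞,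
        ∑ x, f x = ∑ x0, ∑ x' : ∀ i : Fin d, ι i.succ, f (Fin.cons x0 x') := fun f => by
      rw [← (Fin.consEquiv ι).sum_comp, Fintype.sum_prod_type]; rfl
    have e2 : ∀ f : (∀ i, ι i) → ℂ,
        ∑ x, f x = ∑ x0, ∑ x' : ∀ i : Fin d, ι i.succ, f (Fin.cons x0 x') := fun f => by
      rw [← (Fin.consEquiv ι).sum_comp, Fintype.sum_prod_type]; rfl
    rw [← (Fin.consEquiv fun _ => κ).tsum_eq, ENNReal.tsum_prod', ENNReal.tsum_comm, e1]
    have e3 : ∀ (y' : Fin d → κ) (y0 : κ),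
        ∑ x, c x * ∏ i, A i (x i) ((Fin.consEquiv fun _ => κ) (y0, y') i) =
        ∑ x0, (∑ x', c (Fin.cons x0 x') * ∏ i : Fin d, A i.succ (x' i) (y' i)) * A 0 x0 y0 := by
      intro y' y0
      rw [e2]
      refine Finset.sum_congr rfl fun x0 _ => ?_
      rw [Finset.sum_mul]
      refine Finset.sum_congr rfl fun x' _ => ?_
      rw [Fin.prod_univ_succ]
      simp [Fin.consEquiv]
      ring
    -- With `y'` frozen, the sums over `x'` form a coefficient vector for the first factor. Once its
    -- bound is used, the induction hypothesis applies for each fixed first index `x0`.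
    calc _ ≤ ∑' y' : Fin d → κ, B 0 * ∑ x0, ‖∑ x' : ∀ i : Fin d, ι i.succ, c (Fin.cons x0 x') *
            ∏ i : Fin d, A i.succ (x' i) (y' i)‖ₑ ^ 2 := by
          refine ENNReal.tsum_le_tsum fun y' => ?_
          simp_rw [e3]
          exact h 0 _
      _ = B 0 * ∑ x0, ∑' y' : Fin d → κ, ‖∑ x' : ∀ i : Fin d, ι i.succ, c (Fin.cons x0 x') *
            ∏ i : Fin d, A i.succ (x' i) (y' i)‖ₑ ^ 2 := by
          rw [ENNReal.tsum_mul_left, Summable.tsum_finsetSum fun _ _ => ENNReal.summable]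
      _ ≤ B 0 * ∑ x0, ((∏ i : Fin d, B i.succ) * ∑ x', ‖c (Fin.cons x0 x')‖ₑ ^ 2) := by
          gcongr with x0
          exact ih fun x' => c (Fin.cons x0 x')
      _ = _ := by rw [← Finset.mul_sum, Fin.prod_univ_succ, mul_assoc]

/-! ### The discrete Parseval identity -/

/-- The exponential vectors are orthogonal with squared norm N: off the diagonal their inner product
is a full geometric sum of a nontrivial N-th root of unity. -/
theorem sum_norm_sq_dft {N : ℕ} (hN : 0 < N) (c : Fin N → ℂ) :
    ∑ r : Fin N, ‖∑ k : Fin N, c k * Complex.exp (-2 * Real.pi * Complex.I * k * r / N)‖ ^ 2 =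
      N * ∑ k, ‖c k‖ ^ 2 := by
  have hN' : (N : ℂ) ≠ 0 := by exact_mod_cast hN.ne'
  have hpi : (Real.pi : ℂ) ≠ 0 := by exact_mod_cast Real.pi_ne_zero
  have key : ∀ k l : Fin N, ∑ r : Fin N,
      Complex.exp (-2 * Real.pi * Complex.I * k * r / N) *
        (starRingEnd ℂ) (Complex.exp (-2 * Real.pi * Complex.I * l * r / N)) =
      if k = l then (N : ℂ) else 0 := by
    intro k l
    set ζ := Complex.exp (-2 * Real.pi * Complex.I * ((k : ℂ) - l) / N) with hζ
    have e : ∀ r : Fin N, Complex.exp (-2 * Real.pi * Complex.I * k * r / N) *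
        (starRingEnd ℂ) (Complex.exp (-2 * Real.pi * Complex.I * l * r / N)) = ζ ^ (r : ℕ) := by
      intro r
      rw [← Complex.exp_conj, ← Complex.exp_add, hζ, ← Complex.exp_nat_mul]
      congr 1
      simp only [map_div₀, map_mul, map_neg, map_ofNat, Complex.conj_ofReal, Complex.conj_I,
        map_natCast]
      ring
    simp_rw [e]
    rw [Fin.sum_univ_eq_sum_range (fun r => ζ ^ r)]
    split_ifs with hkl
    · subst hkl
      have : ζ = 1 := by rw [hζ]; simp
      simp [this]
    · have h1 : ζ ^ N = 1 := by
        rw [hζ, ← Complex.exp_nat_mul, Complex.exp_eq_one_iff]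
        refine ⟨(l : ℤ) - k, ?_⟩
        push_cast
        field_simp
        ring
      have h2 : ζ - 1 ≠ 0 := by
        rw [sub_ne_zero, hζ]
        intro h
        obtain ⟨n, hn⟩ := Complex.exp_eq_one_iff.1 h
        have : ((l : ℂ) - k) = n * N := by
          field_simp at hn
          have hI := Complex.I_ne_zero
          linear_combination hn
        have h3 : ((l : ℤ) - k) = n * N := by exact_mod_cast this
        have hn0 : n = 0 := by
          have := k.2; have := l.2
          by_contra hn0
          rcases lt_or_gt_of_ne hn0 with h | h
          · nlinarith
          · nlinarith
        rw [hn0] at h3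
        exact hkl (Fin.ext (by omega))
      have := mul_geom_sum ζ N
      rw [h1, sub_self] at this
      exact (mul_eq_zero.1 this).resolve_left h2
  have : ((∑ r : Fin N, ‖∑ k : Fin N, c k *
      Complex.exp (-2 * Real.pi * Complex.I * k * r / N)‖ ^ 2 : ℝ) : ℂ) =
      ((N * ∑ k, ‖c k‖ ^ 2 : ℝ) : ℂ) := by
    push_cast
    simp_rw [← Complex.mul_conj', map_sum, map_mul, Finset.sum_mul_sum]
    rw [Finset.sum_comm]
    rw [Finset.mul_sum]
    refine Finset.sum_congr rfl fun k _ => ?_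
    rw [Finset.sum_comm]
    have : ∀ l : Fin N, ∑ r : Fin N, c k * Complex.exp (-2 * Real.pi * Complex.I * k * r / N) *
        ((starRingEnd ℂ) (c l) *
          (starRingEnd ℂ) (Complex.exp (-2 * Real.pi * Complex.I * l * r / N))) =
        c k * (starRingEnd ℂ) (c l) * if k = l then (N : ℂ) else 0 := by
      intro l
      rw [← key, Finset.mul_sum]
      exact Finset.sum_congr rfl fun r _ => by ring
    simp_rw [this]
    simp
    ring
  exact_mod_cast this

/-! ### Two orthonormal sequences close to a principal shift-invariant space -/

section Hilbert

variable {E : Type*} [NormedAddCommGroup E] [InnerProductSpace ℂ E]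

theorem summable_inner_mul_inner_neg {a b : ℤ → E} (ha : Orthonormal ℂ a) (hb : Orthonormal ℂ b)
    (f g : E) : Summable (fun k => ⟪a k, f⟫_ℂ * ⟪b (-k), g⟫_ℂ) ∧
      ‖∑' k, ⟪a k, f⟫_ℂ * ⟪b (-k), g⟫_ℂ‖ ≤ ‖f‖ * ‖g‖ := by
  have hb' : Orthonormal ℂ fun k => b (-k) := hb.comp _ neg_injective
  have h := Real.summable_and_inner_le_Lp_mul_Lq_tsum_of_nonneg (ι := ℤ)
    (f := fun k => ‖⟪a k, f⟫_ℂ‖) (g := fun k => ‖⟪b (-k), g⟫_ℂ‖) (p := 2) (q := 2)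
    Real.HolderConjugate.two_two (fun _ => norm_nonneg _) (fun _ => norm_nonneg _)
    (by simpa using ha.inner_products_summable f) (by simpa using hb'.inner_products_summable g)
  have hs : Summable fun k => ‖⟪a k, f⟫_ℂ * ⟪b (-k), g⟫_ℂ‖ := by simpa using h.1
  refine ⟨hs.of_norm, (norm_tsum_le_tsum_norm hs).trans ?_⟩
  simp only [norm_mul]
  refine h.2.trans ?_
  have h1 := ha.tsum_inner_products_le f
  have h2 := hb'.tsum_inner_products_le g
  simp only [Real.rpow_two, ← Real.sqrt_eq_rpow]
  gcongr
  · exact Real.sqrt_le_iff.2 ⟨norm_nonneg _, h1⟩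
  · exact Real.sqrt_le_iff.2 ⟨norm_nonneg _, h2⟩

/-- The bilinear form `(f, g) ↦ ∑ₖ ⟨aₖ, f⟩ ⟨b₋ₖ, g⟩`. -/
def convForm {a b : ℤ → E} (ha : Orthonormal ℂ a) (hb : Orthonormal ℂ b) : E →L[ℂ] E →L[ℂ] ℂ :=
  LinearMap.mkContinuous₂
    (LinearMap.mk₂ ℂ (fun f g => ∑' k, ⟪a k, f⟫_ℂ * ⟪b (-k), g⟫_ℂ)
      (fun f f' g => by
        rw [← (summable_inner_mul_inner_neg ha hb f g).1.tsum_add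
          (summable_inner_mul_inner_neg ha hb f' g).1]
        exact tsum_congr fun k => by rw [inner_add_right, add_mul])
      (fun c f g => by
        rw [smul_eq_mul, ← tsum_mul_left]
        exact tsum_congr fun k => by rw [inner_smul_right, mul_assoc])
      (fun f g g' => by
        rw [← (summable_inner_mul_inner_neg ha hb f g).1.tsum_add
          (summable_inner_mul_inner_neg ha hb f g').1]
        exact tsum_congr fun k => by rw [inner_add_right, mul_add])
      (fun c f g => by
        rw [smul_eq_mul, ← tsum_mul_left]
        exact tsum_congr fun k => by rw [inner_smul_right]; ring)) 1
    (fun f g => by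
      rw [one_mul]
      exact (summable_inner_mul_inner_neg ha hb f g).2)

theorem convForm_apply {a b : ℤ → E} (ha : Orthonormal ℂ a) (hb : Orthonormal ℂ b) (f g : E) :
    convForm ha hb f g = ∑' k, ⟪a k, f⟫_ℂ * ⟪b (-k), g⟫_ℂ := rfl

theorem norm_convForm_apply_le {a b : ℤ → E} (ha : Orthonormal ℂ a) (hb : Orthonormal ℂ b)
    (f g : E) : ‖convForm ha hb f g‖ ≤ ‖f‖ * ‖g‖ :=
  (summable_inner_mul_inner_neg ha hb f g).2

/-- On generators the form is a convolution: with α(k) = ⟨a k, φ 0⟩ and β(k) = ⟨b k, φ 0⟩,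
translation covariance gives (α ∗ β)(−i−j), and convolution commutes. The reflection in `b (-k)` is
there for this purpose. Continuity extends the identity to the closed span. -/
theorem convForm_comm_of_mem {a b φ : ℤ → E} (ha : Orthonormal ℂ a) (hb : Orthonormal ℂ b)
    (haφ : ∀ k j i, ⟪a (k + i), φ (j + i)⟫_ℂ = ⟪a k, φ j⟫_ℂ)
    (hbφ : ∀ k j i, ⟪b (k + i), φ (j + i)⟫_ℂ = ⟪b k, φ j⟫_ℂ) {f g : E}
    (hf : f ∈ (Submodule.span ℂ (Set.range φ)).topologicalClosure)
    (hg : g ∈ (Submodule.span ℂ (Set.range φ)).topologicalClosure) :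
    convForm ha hb f g = convForm hb ha f g := by
  set D := convForm ha hb - convForm hb ha with hD
  have h0 : ∀ i j, D (φ i) (φ j) = 0 := by
    intro i j
    simp only [hD, sub_apply, sub_eq_zero, convForm_apply]
    have e1 : ∀ k, ⟪a k, φ i⟫_ℂ = ⟪a (k - i), φ 0⟫_ℂ := fun k => by
      simpa using haφ (k - i) 0 i
    have e2 : ∀ k, ⟪a k, φ j⟫_ℂ = ⟪a (k - j), φ 0⟫_ℂ := fun k => by
      simpa using haφ (k - j) 0 j
    have e3 : ∀ k, ⟪b k, φ i⟫_ℂ = ⟪b (k - i), φ 0⟫_ℂ := fun k => by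
      simpa using hbφ (k - i) 0 i
    have e4 : ∀ k, ⟪b k, φ j⟫_ℂ = ⟪b (k - j), φ 0⟫_ℂ := fun k => by
      simpa using hbφ (k - j) 0 j
    simp_rw [e1, e2, e3, e4]
    -- The reflection k ↦ (i − j) − k interchanges the two factors.
    rw [← (Equiv.subLeft (i - j)).tsum_eq]
    refine tsum_congr fun k => ?_
    simp only [Equiv.subLeft_apply]
    rw [mul_comm]
    congr 3 <;> ring_nf
  have h1 : ∀ j, D f (φ j) = 0 := by
    intro j
    have : (Submodule.span ℂ (Set.range φ)).topologicalClosure ≤ (D.flip (φ j)).ker := by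
      refine Submodule.topologicalClosure_minimal _ (Submodule.span_le.2 ?_)
        (D.flip (φ j)).isClosed_ker
      rintro _ ⟨i, rfl⟩
      exact h0 i j
    exact this hf
  have : (Submodule.span ℂ (Set.range φ)).topologicalClosure ≤ (D f).ker := by
    refine Submodule.topologicalClosure_minimal _ (Submodule.span_le.2 ?_) (D f).isClosed_ker
    rintro _ ⟨i, rfl⟩
    exact h1 i
  have h2 : D f g = 0 := this hg
  simpa [hD, sub_eq_zero] using h2

/-- The antisymmetrized form D vanishes on the closed span of the translates, but equals 2M+1 on the
two block sums. These have norm √(2M+1) and lie within C of the span, so D is also O(√M) there, a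
contradiction for large M. -/
theorem not_bounded_dist_principal {a b φ : ℤ → E} (ha : Orthonormal ℂ a) (hb : Orthonormal ℂ b)
    (hab : ∀ k l, ⟪a k, b l⟫_ℂ = 0)
    (haφ : ∀ k j i, ⟪a (k + i), φ (j + i)⟫_ℂ = ⟪a k, φ j⟫_ℂ)
    (hbφ : ∀ k j i, ⟪b (k + i), φ (j + i)⟫_ℂ = ⟪b k, φ j⟫_ℂ) (C : ℝ)
    (hCa : ∀ M : ℕ, ∃ v ∈ (Submodule.span ℂ (Set.range φ)).topologicalClosure,
      ‖∑ k ∈ Finset.Icc (-M : ℤ) M, a k - v‖ ≤ C)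
    (hCb : ∀ M : ℕ, ∃ v ∈ (Submodule.span ℂ (Set.range φ)).topologicalClosure,
      ‖∑ k ∈ Finset.Icc (-M : ℤ) M, b k - v‖ ≤ C) : False := by
  have hba : ∀ k l, ⟪b k, a l⟫_ℂ = 0 := fun k l => by rw [← inner_conj_symm, hab, map_zero]
  have main : ∀ M : ℕ, (2 * M + 1 : ℝ) ≤ 2 * (2 * C * Real.sqrt (2 * M + 1) + C ^ 2) := by
    intro M
    obtain ⟨v, hv, hvC⟩ := hCa M
    obtain ⟨w, hw, hwC⟩ := hCb M
    set s := Finset.Icc (-M : ℤ) M with hs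
    have hcard : (s.card : ℝ) = 2 * M + 1 := by
      rw [hs, Int.card_Icc]
      have : ((M : ℤ) + 1 - -M).toNat = 2 * M + 1 := by omega
      rw [this]; push_cast; ring
    set f := ∑ k ∈ s, a k with hf
    set g := ∑ k ∈ s, b k with hg
    have nrm : ∀ {u : ℤ → E}, Orthonormal ℂ u → ‖∑ k ∈ s, u k‖ = Real.sqrt (2 * M + 1) := by
      intro u hu
      rw [← hcard, eq_comm, Real.sqrt_eq_iff_mul_self_eq (by positivity) (by positivity), ← sq]
      have := hu.inner_sum (fun _ => 1) (fun _ => 1) s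
      simp only [one_smul, map_one, mul_one, Finset.sum_const, nsmul_eq_mul] at this
      rw [inner_self_eq_norm_sq_to_K] at this
      have h : ((‖∑ k ∈ s, u k‖ ^ 2 : ℝ) : ℂ) = ((s.card : ℝ) : ℂ) := by
        push_cast
        exact this
      exact (Complex.ofReal_injective h).symm
    have nf : ‖f‖ = Real.sqrt (2 * M + 1) := nrm ha
    have ng : ‖g‖ = Real.sqrt (2 * M + 1) := nrm hb
    have coef : ∀ {u : ℤ → E}, Orthonormal ℂ u → ∀ k,
        ⟪u k, ∑ l ∈ s, u l⟫_ℂ = if k ∈ s then 1 else 0 := by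
      intro u hu k
      rw [inner_sum]
      simp_rw [orthonormal_iff_ite.1 hu]
      simp
    -- The block is symmetric about 0, so `-k` stays in it and each of its 2M+1 indices contributes
    -- 1.
    have hDab : convForm ha hb f g = 2 * M + 1 := by
      rw [convForm_apply]
      simp_rw [hf, hg, coef ha, coef hb]
      rw [tsum_eq_sum (s := s) (fun k hk => by simp [hk])]
      have : ∀ k ∈ s, ((if k ∈ s then (1 : ℂ) else 0) * if -k ∈ s then 1 else 0) = 1 := by
        intro k hk
        have : -k ∈ s := by rw [hs, Finset.mem_Icc] at hk ⊢; omega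
        simp [hk, this]
      rw [Finset.sum_congr rfl this]
      simp only [Finset.sum_const, nsmul_eq_mul, mul_one]
      exact_mod_cast congrArg (fun x : ℝ => (x : ℂ)) hcard
    have hDba : convForm hb ha f g = 0 := by
      rw [convForm_apply]
      simp [hf, hba]
    set D := convForm ha hb - convForm hb ha with hD
    have hDb : ∀ x y, ‖D x y‖ ≤ 2 * (‖x‖ * ‖y‖) := fun x y => by
      have h1 := norm_convForm_apply_le ha hb x y
      have h2 := norm_convForm_apply_le hb ha x y
      simp only [hD, sub_apply]
      exact (norm_sub_le _ _).trans (by linarith)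
    have h0 : D v w = 0 := by
      simp [hD, convForm_comm_of_mem ha hb haφ hbφ hv hw]
    -- Since D v w = 0, only terms containing an error `f - v` or `g - w` survive.
    have h1 : D f g = D (f - v) g + D f (g - w) - D (f - v) (g - w) := by
      simp only [map_sub, sub_apply, h0]
      ring
    have h2 : ‖D f g‖ = 2 * M + 1 := by
      simp only [hD, sub_apply, hDab, hDba, sub_zero]
      have : ((2 * M + 1 : ℂ)) = ((2 * M + 1 : ℝ) : ℂ) := by push_cast; ring
      rw [this, Complex.norm_real, Real.norm_of_nonneg (by positivity)]
    have hC : 0 ≤ C := (norm_nonneg _).trans hvC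
    have h3 := hDb (f - v) g
    have h4 := hDb f (g - w)
    have h5 := hDb (f - v) (g - w)
    rw [ng] at h3
    rw [nf] at h4
    have h6 : ‖f - v‖ * Real.sqrt (2 * M + 1) ≤ C * Real.sqrt (2 * M + 1) := by gcongr
    have h7 : Real.sqrt (2 * M + 1) * ‖g - w‖ ≤ Real.sqrt (2 * M + 1) * C := by gcongr
    have h8 : ‖f - v‖ * ‖g - w‖ ≤ C * C := by gcongr
    calc (2 * M + 1 : ℝ) = ‖D f g‖ := h2.symm
      _ ≤ ‖D (f - v) g‖ + ‖D f (g - w)‖ + ‖D (f - v) (g - w)‖ :=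
          h1 ▸ (norm_sub_le _ _).trans (by gcongr; exact norm_add_le _ _)
      _ ≤ _ := by nlinarith
  have hC : 0 ≤ C := by
    obtain ⟨v, _, hv⟩ := hCa 0
    exact (norm_nonneg _).trans hv
  -- With r = √(2M+1) ≥ 8C + 8, the inequality r² ≤ 4Cr + 2C² fails.
  obtain ⟨M, hM⟩ := exists_nat_gt ((8 * C + 8) ^ 2)
  have h1 := main M
  set r := Real.sqrt (2 * M + 1) with hr
  have h2 : r ^ 2 = 2 * M + 1 := Real.sq_sqrt (by positivity)
  have h3 : 8 * C + 8 ≤ r := by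
    apply Real.le_sqrt_of_sq_le
    linarith
  rw [← h2] at h1
  nlinarith

end Hilbert

end HyperbolicWavelet
end
noncomputable section
namespace HyperbolicWavelet
open scoped ENNReal InnerProductSpace ComplexConjugate

/-! ### Classes of square integrable functions -/

section ToL2

variable {α : Type*} [MeasurableSpace α] {μ : Measure α}

theorem toL2_eq {g : α → ℂ} (h : MemLp g 2 μ) : toL2 μ g = h.toLp g := dif_pos h

theorem coeFn_toL2 {g : α → ℂ} (h : MemLp g 2 μ) : toL2 μ g =ᵐ[μ] g := by
  rw [toL2_eq h]; exact h.coeFn_toLp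

theorem toL2_congr {f g : α → ℂ} (hf : MemLp f 2 μ) (h : f =ᵐ[μ] g) : toL2 μ f = toL2 μ g := by
  rw [toL2_eq hf, toL2_eq (hf.ae_eq h)]
  exact (MemLp.toLp_eq_toLp_iff _ _).2 h

theorem toL2_coeFn (f : Lp ℂ 2 μ) : toL2 μ f = f := by
  rw [toL2_eq (Lp.memLp f)]; exact Lp.toLp_coeFn f _

theorem toL2_add {f g : α → ℂ} (hf : MemLp f 2 μ) (hg : MemLp g 2 μ) :
    toL2 μ (fun x => f x + g x) = toL2 μ f + toL2 μ g := by
  rw [toL2_eq hf, toL2_eq hg]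
  exact toL2_eq (hf.add hg)

theorem toL2_const_mul {f : α → ℂ} (hf : MemLp f 2 μ) (c : ℂ) :
    toL2 μ (fun x => c * f x) = c • toL2 μ f := by
  rw [toL2_eq hf]
  exact toL2_eq (hf.const_mul c)

theorem toL2_sum {ι : Type*} (s : Finset ι) {f : ι → α → ℂ} (hf : ∀ i ∈ s, MemLp (f i) 2 μ) :
    toL2 μ (fun x => ∑ i ∈ s, f i x) = ∑ i ∈ s, toL2 μ (f i) := by
  classical
  induction s using Finset.induction_on with
  | empty =>
    simp only [Finset.sum_empty]
    exact toL2_eq (MemLp.zero (ε := ℂ))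
  | insert i s hi ih =>
    simp only [Finset.sum_insert hi]
    rw [toL2_add (hf i (Finset.mem_insert_self _ _))
      (memLp_finsetSum s fun j hj => hf j (Finset.mem_insert_of_mem hj)),
      ih fun j hj => hf j (Finset.mem_insert_of_mem hj)]

theorem inner_toL2 {f g : α → ℂ} (hf : MemLp f 2 μ) (hg : MemLp g 2 μ) :
    ⟪toL2 μ f, toL2 μ g⟫_ℂ = ∫ x, conj (f x) * g x ∂μ := by
  rw [L2.inner_def]
  refine integral_congr_ae ?_
  filter_upwards [coeFn_toL2 hf, coeFn_toL2 hg] with x h1 h2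
  rw [h1, h2, RCLike.inner_apply']

theorem integrable_conj_mul {f g : α → ℂ} (hf : MemLp f 2 μ) (hg : MemLp g 2 μ) :
    Integrable (fun x => conj (f x) * g x) μ :=
  hf.star.integrable_mul hg

theorem norm_toL2_sq {f : α → ℂ} (hf : MemLp f 2 μ) :
    ((‖toL2 μ f‖ ^ 2 : ℝ) : ℂ) = ∫ x, conj (f x) * f x ∂μ := by
  rw [← inner_toL2 hf hf, inner_self_eq_norm_sq_to_K]
  push_cast
  rfl

end ToL2

/-! ### Dilations and translations on the line -/

theorem memLp_comp_mul_sub {g : ℝ → ℂ} (hg : MemLp g 2 (volume : Measure ℝ)) {a : ℝ} (ha : a ≠ 0)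
    (b : ℝ) : MemLp (fun x => g (a * x - b)) 2 (volume : Measure ℝ) := by
  have h1 : MemLp (fun x => g (x - b)) 2 (volume : Measure ℝ) :=
    hg.comp_measurePreserving (measurePreserving_sub_right volume b)
  have h2 : MemLp (fun x => g (x - b)) 2 (Measure.map (a * ·) (volume : Measure ℝ)) := by
    rw [Real.map_volume_mul_left ha]
    exact h1.smul_measure (by finiteness)
  exact ((measurableEmbedding_mulLeft₀ ha).memLp_map_measure_iff).1 h2

theorem memLp_dilate {g : ℝ → ℂ} (hg : MemLp g 2 (volume : Measure ℝ)) (j : ℕ) (k : ℤ) :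
    MemLp (dilate g j k) 2 (volume : Measure ℝ) :=
  (memLp_comp_mul_sub hg (by positivity) k).const_mul _

theorem dilate_add (g : ℝ → ℂ) (j : ℕ) (k l : ℤ) (x : ℝ) :
    dilate g j k (x + l) = dilate g j (k - 2 ^ j * l) x := by
  simp only [dilate]
  push_cast
  congr 2
  ring

theorem rpow_half_sq (j : ℕ) : ((2 : ℝ) ^ ((j : ℝ) / 2)) * (2 : ℝ) ^ ((j : ℝ) / 2) = 2 ^ j := by
  rw [← Real.rpow_add (by norm_num), add_halves, Real.rpow_natCast]

/-- The normalization cancels the Jacobian, so these integrals do not depend on j. This is what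
allows `riesz_line` to pass from one level to another. -/
theorem integral_dilate_mul (g g' : ℝ → ℂ) (j : ℕ) (k k' : ℤ) :
    ∫ x, conj (dilate g j k x) * dilate g' j k' x = ∫ x, conj (g x) * g' (x - (k' - k : ℤ)) := by
  have h1 : ∀ x, conj (dilate g j k x) * dilate g' j k' x =
      ((2 : ℝ) ^ j : ℝ) • (fun y => conj (g (y - k)) * g' (y - k')) (2 ^ j * x) := by
    intro x
    simp only [dilate, map_mul, Complex.conj_ofReal, ← rpow_half_sq, Complex.real_smul]
    push_cast
    ring
  simp_rw [h1]
  rw [integral_smul, Measure.integral_comp_mul_left (fun y => conj (g (y - k)) * g' (y - k')), smul_smul,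
    abs_of_pos (by positivity), mul_inv_cancel₀ (by positivity), one_smul,
    ← integral_sub_right_eq_self (fun x => conj (g x) * g' (x - (k' - k : ℤ))) (k : ℝ)]
  refine integral_congr_ae (Filter.Eventually.of_forall fun x => ?_)
  simp only
  congr 2
  push_cast
  ring

/-! ### The circle -/

theorem volume_eq_haarAddCircle :
    (volume : Measure UnitAddCircle) = AddCircle.haarAddCircle := by
  rw [AddCircle.volume_eq_smul_haarAddCircle]; simp

theorem measurePreserving_coe_Ioc (t : ℝ) :
    MeasurePreserving ((↑) : ℝ → UnitAddCircle) (volume.restrict (Set.Ioc t (t + 1)))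
      AddCircle.haarAddCircle := by
  rw [← volume_eq_haarAddCircle]
  exact UnitAddCircle.measurePreserving_mk t

theorem intervalIntegral_coe (t : ℝ) (f : UnitAddCircle → ℂ) :
    ∫ a in t..t + 1, f a = ∫ b, f b ∂AddCircle.haarAddCircle := by
  rw [← volume_eq_haarAddCircle]
  exact UnitAddCircle.intervalIntegral_preimage t f

/-- The restriction of the periodic function `h` to the cell `(k, k + 1]`. -/
def cell (h : UnitAddCircle → ℂ) (k : ℤ) : ℝ → ℂ :=
  (Set.Ioc (k : ℝ) (k + 1)).indicator fun x => h x

theorem memLp_cell {h : UnitAddCircle → ℂ} (hh : MemLp h 2 AddCircle.haarAddCircle) (k : ℤ) :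
    MemLp (cell h k) 2 (volume : Measure ℝ) :=
  (memLp_indicator_iff_restrict measurableSet_Ioc).2
    (hh.comp_measurePreserving (measurePreserving_coe_Ioc k))

/-- Cells are open on the left and closed on the right, so x lies in cell ⌈x⌉ − 1. -/
theorem cell_apply (h : UnitAddCircle → ℂ) (k : ℤ) (x : ℝ) :
    cell h k x = if ⌈x⌉ - 1 = k then h x else 0 := by
  rw [cell, Set.indicator_apply]
  refine if_congr ?_ rfl rfl
  rw [sub_eq_iff_eq_add, Int.ceil_eq_iff, Set.mem_Ioc]
  push_cast
  simp

theorem sum_cell_apply (h : UnitAddCircle → ℂ) (s : Finset ℤ) (x : ℝ) :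
    ∑ k ∈ s, cell h k x = if ⌈x⌉ - 1 ∈ s then h x else 0 := by
  simp_rw [cell_apply]
  simp

theorem memLp_sum_cell {h : UnitAddCircle → ℂ} (hh : MemLp h 2 AddCircle.haarAddCircle)
    (s : Finset ℤ) : MemLp (fun x => ∑ k ∈ s, cell h k x) 2 (volume : Measure ℝ) :=
  memLp_finsetSum s fun k _ => memLp_cell hh k

theorem inner_cell {h h' : UnitAddCircle → ℂ} (hh : MemLp h 2 AddCircle.haarAddCircle)
    (hh' : MemLp h' 2 AddCircle.haarAddCircle) (k l : ℤ) :
    ⟪toL2 volume (cell h k), toL2 volume (cell h' l)⟫_ℂ =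
      if k = l then ⟪toL2 AddCircle.haarAddCircle h, toL2 AddCircle.haarAddCircle h'⟫_ℂ else 0 := by
  rw [inner_toL2 (memLp_cell hh k) (memLp_cell hh' l), inner_toL2 hh hh']
  split_ifs with hkl
  · subst hkl
    rw [← intervalIntegral_coe k, intervalIntegral.integral_of_le (by linarith),
      ← integral_indicator measurableSet_Ioc]
    refine integral_congr_ae (Filter.Eventually.of_forall fun x => ?_)
    by_cases hx : x ∈ Set.Ioc (k : ℝ) (k + 1) <;> simp [cell, hx]
  · rw [← integral_zero ℝ ℂ]
    refine integral_congr_ae (Filter.Eventually.of_forall fun x => ?_)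
    simp only [cell_apply]
    split_ifs with h1 h2
    · exact absurd (h1.symm.trans h2) hkl
    all_goals simp

/-! ### Periodization -/

theorem periodize_coe (g : ℝ → ℂ) (x : ℝ) : periodize g x = ∑' l : ℤ, g (x + l) := rfl

theorem periodize_coe_eq_sum {g : ℝ → ℂ} {L : ℕ} (hg : ∀ x : ℝ, (L : ℝ) < |x| → g x = 0)
    {s : Finset ℤ} {x : ℝ} (hs : ∀ l : ℤ, |x + l| ≤ L → l ∈ s) :
    periodize g x = ∑ l ∈ s, g (x + l) := by
  rw [periodize_coe]
  refine tsum_eq_sum fun l hl => hg _ ?_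
  by_contra h
  exact hl (hs l (not_lt.1 h))

theorem mem_Icc_of_abs_add_le {L : ℕ} {K : ℕ} {x : ℝ} (hx : |x| ≤ K) {l : ℤ} (h : |x + l| ≤ L) :
    l ∈ Finset.Icc (-(K + L : ℤ)) (K + L) := by
  rw [abs_le] at hx h
  rw [Finset.mem_Icc]
  constructor
  · have : (-(K + L : ℤ) : ℝ) ≤ l := by push_cast; linarith
    exact_mod_cast this
  · have : (l : ℝ) ≤ (K + L : ℤ) := by push_cast; linarith
    exact_mod_cast this

theorem memLp_periodize {g : ℝ → ℂ} (hg2 : MemLp g 2 (volume : Measure ℝ)) {L : ℕ}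
    (hg : ∀ x : ℝ, (L : ℝ) < |x| → g x = 0) :
    MemLp (periodize g) 2 AddCircle.haarAddCircle := by
  set s := Finset.Icc (-((1 : ℕ) + L : ℤ)) ((1 : ℕ) + L) with hs
  have h1 : MemLp (fun x => ∑ l ∈ s, g (x + l)) 2 (volume.restrict (Set.Ioc (0 : ℝ) (0 + 1))) :=
    (memLp_finsetSum s fun l _ =>
      hg2.comp_measurePreserving (measurePreserving_add_right volume (l : ℝ))).restrict _
  have h2 : periodize g = AddCircle.liftIoc 1 0 (fun x => ∑ l ∈ s, g (x + l)) := by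
    ext t
    obtain ⟨x, hx, rfl⟩ : ∃ x ∈ Set.Ioc (0 : ℝ) (0 + 1), (x : UnitAddCircle) = t :=
      ⟨_, (AddCircle.equivIoc 1 0 t).2, (AddCircle.equivIoc 1 0).symm_apply_apply t⟩
    rw [AddCircle.liftIoc_coe_apply hx]
    refine periodize_coe_eq_sum hg fun l hl => mem_Icc_of_abs_add_le ?_ hl
    rw [abs_le]
    constructor <;> push_cast <;> linarith [hx.1, hx.2]
  rw [h2]
  exact h1.memLp_liftIoc.haarAddCircle

/-- On the window |x| ≤ L the periodic function coincides with a finite sum of its cells, which is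
square integrable on the line. -/
theorem integrable_mul_coe {g : ℝ → ℂ} (hg2 : MemLp g 2 (volume : Measure ℝ)) {L : ℕ}
    (hg : ∀ x : ℝ, (L : ℝ) < |x| → g x = 0) {h : UnitAddCircle → ℂ}
    (hh : MemLp h 2 AddCircle.haarAddCircle) : Integrable fun x : ℝ => g x * h x := by
  have h1 := (hg2.integrable_mul (memLp_sum_cell hh (Finset.Icc (-(L : ℤ) - 1) L)))
  refine h1.congr (Filter.Eventually.of_forall fun x => ?_)
  simp only [Pi.mul_apply, sum_cell_apply]
  by_cases hx : (L : ℝ) < |x|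
  · simp [hg x hx]
  · rw [not_lt, abs_le] at hx
    rw [if_pos]
    rw [Finset.mem_Icc]
    constructor
    · have : -(L : ℤ) ≤ ⌈x⌉ := by
        have h1 := Int.le_ceil x
        have : (-(L : ℤ) : ℝ) ≤ (⌈x⌉ : ℝ) := by push_cast; linarith
        exact_mod_cast this
      omega
    · have : ⌈x⌉ ≤ (L : ℤ) := Int.ceil_le.2 (by push_cast; exact hx.2)
      omega

/-- Unfolding of an integral against a periodization. -/
theorem integral_periodize_mul {g : ℝ → ℂ} (hg2 : MemLp g 2 (volume : Measure ℝ)) {L : ℕ}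
    (hg : ∀ x : ℝ, (L : ℝ) < |x| → g x = 0) {h : UnitAddCircle → ℂ}
    (hh : MemLp h 2 AddCircle.haarAddCircle) :
    ∫ t, periodize g t * h t ∂AddCircle.haarAddCircle = ∫ x : ℝ, g x * h x := by
  have hint := integrable_mul_coe hg2 hg hh
  set s := Finset.Icc (-((1 : ℕ) + L : ℤ)) ((1 : ℕ) + L) with hs
  have hmem : ∀ x ∈ Set.Icc (0 : ℝ) 1, ∀ l : ℤ, |x + l| ≤ L → l ∈ s := fun x hx l hl =>
    mem_Icc_of_abs_add_le (by rw [abs_le]; constructor <;> push_cast <;> linarith [hx.1, hx.2]) hl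
  have hper : ∀ (x : ℝ) (l : ℤ), h ((x + l : ℝ) : UnitAddCircle) = h x := fun x l => by
    congr 1
    have : ((l : ℝ) : UnitAddCircle) = 0 := by
      rw [AddCircle.coe_eq_zero_iff]
      exact ⟨l, by simp⟩
    rw [AddCircle.coe_add, this, add_zero]
  rw [← hint.hasSum_intervalIntegral_comp_add_int.tsum_eq, tsum_eq_sum (s := s)]
  · refine Eq.trans ?_ (intervalIntegral.integral_finsetSum (μ := volume) (a := 0) (b := 1)
      fun l _ => (hint.comp_add_right (l : ℝ)).intervalIntegrable)
    rw [← intervalIntegral_coe 0, zero_add]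
    refine intervalIntegral.integral_congr fun x hx => ?_
    rw [Set.uIcc_of_le zero_le_one] at hx
    simp only [hper]
    rw [periodize_coe_eq_sum hg (hmem x hx), Finset.sum_mul]
  · intro l hl
    refine (intervalIntegral.integral_congr (g := fun _ => (0 : ℂ)) fun x hx => ?_).trans
      intervalIntegral.integral_zero
    rw [Set.uIcc_of_le zero_le_one] at hx
    simp only
    rw [hg, zero_mul]
    by_contra h
    exact hl (hmem x hx l (not_lt.1 h))

theorem conj_periodize (g : ℝ → ℂ) (t : UnitAddCircle) :
    conj (periodize g t) = periodize (fun x => conj (g x)) t := by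
  induction t using QuotientAddGroup.induction_on with
  | H x => exact Complex.conj_tsum _

theorem inner_periodize {g : ℝ → ℂ} (hg2 : MemLp g 2 (volume : Measure ℝ)) {L : ℕ}
    (hg : ∀ x : ℝ, (L : ℝ) < |x| → g x = 0) {h : UnitAddCircle → ℂ}
    (hh : MemLp h 2 AddCircle.haarAddCircle) :
    ⟪toL2 AddCircle.haarAddCircle (periodize g), toL2 AddCircle.haarAddCircle h⟫_ℂ =
      ∫ x : ℝ, conj (g x) * h x := by
  rw [inner_toL2 (memLp_periodize hg2 hg) hh]
  simp_rw [conj_periodize]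
  exact integral_periodize_mul (g := fun x => conj (g x)) hg2.star (L := L)
    (fun x hx => by simp [hg x hx]) hh

theorem inner_periodize_periodize {g g' : ℝ → ℂ} (hg2 : MemLp g 2 (volume : Measure ℝ)) {L : ℕ}
    (hg : ∀ x : ℝ, (L : ℝ) < |x| → g x = 0) (hg2' : MemLp g' 2 (volume : Measure ℝ)) {L' : ℕ}
    (hg' : ∀ x : ℝ, (L' : ℝ) < |x| → g' x = 0) {s : Finset ℤ}
    (hs : ∀ l : ℤ, |l| ≤ L + L' → l ∈ s) :
    ⟪toL2 AddCircle.haarAddCircle (periodize g), toL2 AddCircle.haarAddCircle (periodize g')⟫_ℂ =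
      ∑ l ∈ s, ∫ x : ℝ, conj (g x) * g' (x + l) := by
  rw [inner_periodize hg2 hg (memLp_periodize hg2' hg'), ← integral_finsetSum]
  · refine integral_congr_ae (Filter.Eventually.of_forall fun x => ?_)
    simp only
    by_cases hx : (L : ℝ) < |x|
    · simp [hg x hx]
    · rw [periodize_coe_eq_sum hg' (s := s), Finset.mul_sum]
      intro l hl
      have := mem_Icc_of_abs_add_le (not_lt.1 hx) hl
      exact hs l (abs_le.2 (Finset.mem_Icc.1 this))
  · intro l _
    exact integrable_conj_mul hg2
      (hg2'.comp_measurePreserving (measurePreserving_add_right volume (l : ℝ)))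

end HyperbolicWavelet
end
noncomputable section
namespace HyperbolicWavelet
open scoped ENNReal InnerProductSpace ComplexConjugate

/-! ### Norms and Bessel bounds of finite families in an inner product space -/

section Hilbert

variable {E F : Type*} [NormedAddCommGroup E] [InnerProductSpace ℂ E] [NormedAddCommGroup F]
  [InnerProductSpace ℂ F]

theorem norm_sum_smul_sq_eq_of_gram_eq {ι : Type*} (s : Finset ι) (c : ι → ℂ) (x : ι → E)
    (y : ι → F) (h : ∀ i ∈ s, ∀ j ∈ s, ⟪x i, x j⟫_ℂ = ⟪y i, y j⟫_ℂ) :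
    ‖∑ i ∈ s, c i • x i‖ ^ 2 = ‖∑ i ∈ s, c i • y i‖ ^ 2 := by
  rw [← inner_self_eq_norm_sq (𝕜 := ℂ), ← inner_self_eq_norm_sq (𝕜 := ℂ)]
  congr 1
  simp_rw [sum_inner, inner_sum, inner_smul_left, inner_smul_right]
  exact Finset.sum_congr rfl fun i hi => Finset.sum_congr rfl fun j hj => by rw [h i hi j hj]

theorem norm_sum_sq_of_pairwise_inner_eq_zero {ι : Type*} (s : Finset ι) (x : ι → E)
    (h : ∀ i ∈ s, ∀ j ∈ s, i ≠ j → ⟪x i, x j⟫_ℂ = 0) :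
    ‖∑ i ∈ s, x i‖ ^ 2 = ∑ i ∈ s, ‖x i‖ ^ 2 := by
  rw [← inner_self_eq_norm_sq (𝕜 := ℂ), sum_inner, map_sum]
  refine Finset.sum_congr rfl fun i hi => ?_
  rw [inner_sum, Finset.sum_eq_single_of_mem i hi fun j hj hij => h i hi j hj hij.symm,
    inner_self_eq_norm_sq]

theorem norm_inner_sum_smul_sq_le {ι : Type*} (s : Finset ι) (c : ι → ℂ) (x : ι → E) (g : E) :
    ‖⟪g, ∑ i ∈ s, c i • x i⟫_ℂ‖ ^ 2 ≤ (∑ i ∈ s, ‖c i‖ ^ 2) * ∑ i ∈ s, ‖⟪x i, g⟫_ℂ‖ ^ 2 := by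
  refine le_trans ?_ (Finset.sum_mul_sq_le_sq_mul_sq s (fun i => ‖c i‖) fun i => ‖⟪x i, g⟫_ℂ‖)
  gcongr
  rw [inner_sum]
  refine (norm_sum_le _ _).trans (Finset.sum_le_sum fun i _ => ?_)
  rw [inner_smul_right, norm_mul, norm_inner_symm]

/-- A bound for the synthesis map is a bound for its adjoint, the analysis map; the test vector is
the synthesis of the coefficients ⟨x k, f⟩ themselves. -/
theorem sum_norm_inner_sq_le_of_norm_sum_sq_le {ι : Type*} (s : Finset ι) {x : ι → E} {B : ℝ}
    (hB0 : 0 ≤ B) (hB : ∀ c : ι → ℂ, ‖∑ k ∈ s, c k • x k‖ ^ 2 ≤ B * ∑ k ∈ s, ‖c k‖ ^ 2) (f : E) :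
    ∑ k ∈ s, ‖⟪x k, f⟫_ℂ‖ ^ 2 ≤ B * ‖f‖ ^ 2 := by
  set c : ι → ℂ := fun k => ⟪x k, f⟫_ℂ with hc
  set A := ∑ k ∈ s, ‖c k‖ ^ 2 with hA
  have hA0 : 0 ≤ A := Finset.sum_nonneg fun _ _ => sq_nonneg _
  set v := ∑ k ∈ s, c k • x k with hv
  have h1 : ‖v‖ ^ 2 ≤ B * A := hB c
  have h2 : ⟪v, f⟫_ℂ = (A : ℂ) := by
    rw [hv, sum_inner, hA]
    push_cast
    refine Finset.sum_congr rfl fun p _ => ?_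
    rw [inner_smul_left, ← Complex.conj_mul']
  have h3 : A ≤ ‖v‖ * ‖f‖ := by
    have := norm_inner_le_norm (𝕜 := ℂ) v f
    rwa [h2, Complex.norm_real, Real.norm_of_nonneg hA0] at this
  have h4 : A ^ 2 ≤ B * A * ‖f‖ ^ 2 := by
    calc A ^ 2 ≤ (‖v‖ * ‖f‖) ^ 2 := by gcongr
      _ = ‖v‖ ^ 2 * ‖f‖ ^ 2 := by ring
      _ ≤ _ := by gcongr
  rcases hA0.eq_or_lt with h5 | h5
  · rw [← h5]; positivity
  · refine le_of_mul_le_mul_right ?_ h5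
    calc A * A = A ^ 2 := (sq A).symm
      _ ≤ _ := h4
      _ = _ := by ring

end Hilbert

/-! ### Orthogonality and Riesz bounds for wavelets on the line and on the circle -/

/-- The class of `ψ_{j,k}` in `L₂(ℝ)`. -/
def lineWavelet (ψ : ℝ → ℝ) (p : ℕ × ℤ) : Lp ℂ 2 (volume : Measure ℝ) :=
  toL2 volume (dilate (complexify ψ) p.1 p.2)

/-- The class of `ψ^per_{j,k}` in `L₂(𝕋)`. -/
def circleWavelet (ψ : ℝ → ℝ) (j k : ℤ) : Lp ℂ 2 (AddCircle.haarAddCircle (T := (1 : ℝ))) :=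
  toL2 AddCircle.haarAddCircle (perWavelet ψ j k)

/-- The autocorrelation of `ψ` at the integers. -/
def autocorr (ψ : ℝ → ℝ) (n : ℤ) : ℂ := ∫ x, conj (complexify ψ x) * complexify ψ (x - n)

variable {m : ℕ} {S γ δ : ℝ} {φ ψ : ℝ → ℝ}

theorem perWavelet_natCast (ψ : ℝ → ℝ) (j : ℕ) (k : ℤ) :
    perWavelet ψ j k = periodize (dilate (complexify ψ) j k) := by
  simp [perWavelet]

theorem perWavelet_neg (ψ : ℝ → ℝ) {j : ℤ} (hj : j < 0) (k : ℤ) :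
    perWavelet ψ j k = fun _ => 1 := by
  simp [perWavelet, hj]

theorem IsWavelet.mem_of_dilate_ne_zero (hW : IsWavelet m S γ δ ψ) {j : ℕ} {k : ℤ} {x : ℝ}
    (h : dilate (complexify ψ) j k x ≠ 0) : 0 ≤ 2 ^ j * x - k ∧ 2 ^ j * x - k ≤ S := by
  have : ψ (2 ^ j * x - k) ≠ 0 := fun h0 => h (by simp [dilate, complexify, h0])
  exact hW.support_subset this

/-- Since 2^j ≥ 1, the support bound for j = 0 serves all levels. -/
theorem IsWavelet.dilate_eq_zero (hW : IsWavelet m S γ δ ψ) (j : ℕ) (k : ℤ) (x : ℝ)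
    (h : ((k.natAbs + ⌈S⌉₊ : ℕ) : ℝ) < |x|) : dilate (complexify ψ) j k x = 0 := by
  by_contra h0
  obtain ⟨h1, h2⟩ := hW.mem_of_dilate_ne_zero h0
  have h3 : |x| ≤ |2 ^ j * x| := by
    rw [abs_mul, abs_of_pos (by positivity : (0 : ℝ) < 2 ^ j)]
    exact le_mul_of_one_le_left (abs_nonneg _) (one_le_pow₀ (by norm_num))
  have h4 : |2 ^ j * x| ≤ |(k : ℝ)| + S := by
    have e : 2 ^ j * x = k + (2 ^ j * x - k) := by ring
    rw [e]
    refine (abs_add_le _ _).trans ?_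
    rw [abs_of_nonneg h1]
    linarith
  have h5 : ((k.natAbs : ℕ) : ℝ) = |(k : ℝ)| := by
    rw [← Int.cast_natCast, Int.natCast_natAbs, Int.cast_abs]
  push_cast at h
  have := Nat.le_ceil S
  linarith

theorem memLp_perWavelet (hψ : MemLp (complexify ψ) 2 (volume : Measure ℝ))
    (hW : IsWavelet m S γ δ ψ) (j k : ℤ) :
    MemLp (perWavelet ψ j k) 2 AddCircle.haarAddCircle := by
  by_cases hj : j < 0
  · rw [perWavelet_neg ψ hj]
    exact memLp_const 1
  · lift j to ℕ using not_lt.1 hj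
    rw [perWavelet_natCast]
    exact memLp_periodize (memLp_dilate hψ j k) (hW.dilate_eq_zero j k)

theorem inner_lineWavelet (hψ : MemLp (complexify ψ) 2 (volume : Measure ℝ)) (j : ℕ) (k k' : ℤ) :
    ⟪lineWavelet ψ (j, k), lineWavelet ψ (j, k')⟫_ℂ = autocorr ψ (k' - k) := by
  rw [lineWavelet, lineWavelet, inner_toL2 (memLp_dilate hψ j k) (memLp_dilate hψ j k')]
  exact integral_dilate_mul _ _ j k k'

theorem IsWavelet.autocorr_eq_zero (hW : IsWavelet m S γ δ ψ) {n : ℤ} (hn : (⌈S⌉₊ : ℤ) < |n|) :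
    autocorr ψ n = 0 := by
  rw [autocorr, ← integral_zero ℝ ℂ]
  refine integral_congr_ae (Filter.Eventually.of_forall fun x => ?_)
  simp only
  by_contra h
  obtain ⟨h1, h2⟩ := mul_ne_zero_iff.1 h
  have h1' : x ∈ Set.Icc 0 S := hW.support_subset fun h0 => h1 (by simp [complexify, h0])
  have h2' : x - n ∈ Set.Icc 0 S := hW.support_subset fun h0 => h2 (by simp [complexify, h0])
  have h3 : |(n : ℝ)| ≤ S := by
    rw [abs_le]
    constructor <;> linarith [h1'.1, h1'.2, h2'.1, h2'.2]
  have h4 : ((⌈S⌉₊ : ℤ) : ℝ) < |(n : ℝ)| := by exact_mod_cast hn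
  have := Nat.le_ceil S
  push_cast at h4
  linarith

/-- Unfolding one periodization leaves finitely many line inner products, a shift by l changing the
index by 2^j' · l. Orthogonality of levels thus passes from line to circle. The clause `0 ∈ s` keeps
the unwrapped term available. -/
theorem inner_circleWavelet_natCast (hψ : MemLp (complexify ψ) 2 (volume : Measure ℝ))
    (hW : IsWavelet m S γ δ ψ) {j j' : ℕ} {k k' : ℤ} :
    ∃ s : Finset ℤ, 0 ∈ s ∧ ⟪circleWavelet ψ j k, circleWavelet ψ j' k'⟫_ℂ =
      ∑ l ∈ s, ⟪lineWavelet ψ (j, k), lineWavelet ψ (j', k' - 2 ^ j' * l)⟫_ℂ := by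
  refine ⟨Finset.Icc (-((k.natAbs + ⌈S⌉₊ : ℕ) + (k'.natAbs + ⌈S⌉₊ : ℕ) : ℤ))
    ((k.natAbs + ⌈S⌉₊ : ℕ) + (k'.natAbs + ⌈S⌉₊ : ℕ)), ?_, ?_⟩
  · rw [Finset.mem_Icc]; omega
  · rw [circleWavelet, circleWavelet, perWavelet_natCast, perWavelet_natCast,
      inner_periodize_periodize (memLp_dilate hψ j k) (hW.dilate_eq_zero j k)
        (memLp_dilate hψ j' k') (hW.dilate_eq_zero j' k')
        (fun l hl => Finset.mem_Icc.2 (abs_le.1 hl))]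
    refine Finset.sum_congr rfl fun l _ => ?_
    rw [lineWavelet, lineWavelet, inner_toL2 (memLp_dilate hψ _ _) (memLp_dilate hψ _ _)]
    simp_rw [dilate_add]

/-- No wrap-around: every term with l ≠ 0 has a shift of at least 2^j − |k' − k| > ⌈S⌉, where the
autocorrelation vanishes. -/
theorem inner_circleWavelet_eq_autocorr (hψ : MemLp (complexify ψ) 2 (volume : Measure ℝ))
    (hW : IsWavelet m S γ δ ψ) {j : ℕ} {k k' : ℤ} (h : |k' - k| + ⌈S⌉₊ < 2 ^ j) :
    ⟪circleWavelet ψ j k, circleWavelet ψ j k'⟫_ℂ = autocorr ψ (k' - k) := by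
  obtain ⟨s, h0, hs⟩ := inner_circleWavelet_natCast (j := j) (j' := j) (k := k) (k' := k') hψ hW
  rw [hs, Finset.sum_eq_single_of_mem 0 h0]
  · rw [inner_lineWavelet hψ]; simp
  · intro l _ hl
    rw [inner_lineWavelet hψ]
    refine hW.autocorr_eq_zero ?_
    have h1 : (2 : ℤ) ^ j ≤ |2 ^ j * l| := by
      rw [abs_mul, abs_of_pos (by positivity : (0 : ℤ) < 2 ^ j)]
      exact le_mul_of_one_le_right (by positivity) (Int.one_le_abs hl)
    have h2 : |2 ^ j * l| ≤ |k' - k| + |k' - 2 ^ j * l - k| := by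
      have e : 2 ^ j * l = (k' - k) - (k' - 2 ^ j * l - k) := by ring
      rw [e]
      refine (abs_sub _ _).trans (by rw [← e])
    omega

/-- The Riesz bounds on the line are inherited from those on the circle. -/
theorem riesz_line (hψ : MemLp (complexify ψ) 2 (volume : Measure ℝ))
    (hW : IsWavelet m S γ δ ψ) (j : ℕ) (s : Finset ℤ) (c : ℤ → ℂ) :
    γ * ∑ k ∈ s, ‖c k‖ ^ 2 ≤ ‖∑ k ∈ s, c k • lineWavelet ψ (j, k)‖ ^ 2 ∧
      ‖∑ k ∈ s, c k • lineWavelet ψ (j, k)‖ ^ 2 ≤ δ * ∑ k ∈ s, ‖c k‖ ^ 2 := by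
  classical
  obtain ⟨K, hK⟩ : ∃ K : ℕ, ∀ k ∈ s, |k| ≤ K := by
    refine ⟨∑ k ∈ s, k.natAbs, fun k hk => ?_⟩
    rw [Int.abs_eq_natAbs]
    exact_mod_cast Finset.single_le_sum (f := fun k : ℤ => k.natAbs) (fun _ _ => Nat.zero_le _) hk
  -- `J` is so fine that the indices shifted by `K` fit into [0, 2^J) without interacting around the
  -- circle. It is unrelated to `j`, because the Gram entries depend only on k' − k.
  obtain ⟨J, hJ⟩ : ∃ J : ℕ, 2 * K + ⌈S⌉₊ < 2 ^ J := ⟨_, Nat.lt_two_pow_self⟩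
  have hJ' : (2 * K + ⌈S⌉₊ : ℤ) < 2 ^ J := by exact_mod_cast hJ
  have hgram : ‖∑ k ∈ s, c k • lineWavelet ψ (j, k)‖ ^ 2 =
      ‖∑ k ∈ s, c k • circleWavelet ψ J (k + K)‖ ^ 2 := by
    refine norm_sum_smul_sq_eq_of_gram_eq s c _ _ fun k hk k' hk' => ?_
    rw [inner_lineWavelet hψ, inner_circleWavelet_eq_autocorr hψ hW]
    · congr 1; ring
    · have h1 := abs_le.1 (hK k hk)
      have h2 := abs_le.1 (hK k' hk')
      have : |k' + K - (k + K)| ≤ 2 * K := by rw [abs_le]; omega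
      omega
  have hpos : 0 < 2 ^ J := by positivity
  set e : ℤ → Fin (2 ^ J) := fun k => ⟨(k + K).toNat % 2 ^ J, Nat.mod_lt _ hpos⟩ with he
  have hev : ∀ k ∈ s, ((e k : ℕ) : ℤ) = k + K := by
    intro k hk
    have h1 := abs_le.1 (hK k hk)
    have h2 : (k + K).toNat < 2 ^ J := by
      have : ((k + K).toNat : ℤ) < 2 ^ J := by rw [Int.toNat_of_nonneg (by omega)]; omega
      exact_mod_cast this
    simp only [he, Nat.mod_eq_of_lt h2]
    exact Int.toNat_of_nonneg (by omega)
  have hinj : Set.InjOn e s := fun k hk k' hk' hkk => by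
    have h1 := hev k hk
    have h2 := hev k' hk'
    rw [hkk] at h1
    omega
  set c' : Fin (2 ^ J) → ℂ := fun i => if (i : ℤ) - K ∈ s then c (i - K) else 0 with hc'
  have hc'e : ∀ k ∈ s, c' (e k) = c k := fun k hk => by
    simp [hc', hev k hk, hk]
  have hc'0 : ∀ i, i ∉ e '' s → c' i = 0 := fun i hi => by
    simp only [hc']
    rw [if_neg]
    intro h
    exact hi ⟨_, h, Fin.ext (by have := hev _ h; omega)⟩
  have hsum : ∑ k ∈ s, c k • circleWavelet ψ J (k + K) =
      ∑ i, c' i • circleWavelet ψ J (i : ℕ) := by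
    refine Finset.sum_of_injOn e hinj (fun _ _ => Finset.mem_univ _) ?_ ?_
    · intro i _ hi
      rw [hc'0 i hi, zero_smul]
    · intro k hk
      rw [hc'e k hk, hev k hk]
  have hnorm : ∑ k ∈ s, ‖c k‖ ^ 2 = ∑ i, ‖c' i‖ ^ 2 := by
    refine Finset.sum_of_injOn e hinj (fun _ _ => Finset.mem_univ _) ?_ ?_
    · intro i _ hi
      rw [hc'0 i hi]; simp
    · intro k hk
      rw [hc'e k hk]
  rw [hgram, hsum, hnorm]
  exact ⟨hW.riesz_lower J c', hW.riesz_upper J c'⟩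

theorem IsWavelet.nonneg_upper (hW : IsWavelet m S γ δ ψ) : 0 ≤ δ := by
  have := (sq_nonneg _).trans (hW.riesz_upper 0 fun _ => 1)
  simpa using this

theorem lineWavelet_mem (ψ : ℝ → ℝ) (p : ℕ × ℤ) :
    lineWavelet ψ p ∈ shiftSpace (complexify ψ) p.1 :=
  Submodule.le_topologicalClosure _ (Submodule.subset_span ⟨p.2, rfl⟩)

theorem IsScalingPair.monotone (hS : IsScalingPair φ ψ) :
    Monotone fun j => shiftSpace (complexify φ) j :=
  monotone_nat_of_le_succ fun j => by rw [← hS.sup_eq j]; exact le_sup_left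

theorem IsScalingPair.inner_scaling_lineWavelet (hS : IsScalingPair φ ψ) (j : ℕ) {i : ℕ}
    (hij : i ≤ j) {v : Lp ℂ 2 (volume : Measure ℝ)} (hv : v ∈ shiftSpace (complexify φ) i)
    (k : ℤ) : ⟪v, lineWavelet ψ (j, k)⟫_ℂ = 0 :=
  (hS.orthogonal j).inner_eq (hS.monotone hij hv) (lineWavelet_mem ψ (j, k))

theorem IsScalingPair.inner_lineWavelet_of_ne (hS : IsScalingPair φ ψ) {j j' : ℕ} (h : j ≠ j')
    (k k' : ℤ) : ⟪lineWavelet ψ (j, k), lineWavelet ψ (j', k')⟫_ℂ = 0 := by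
  have key : ∀ {j j' : ℕ}, j < j' → ∀ k k' : ℤ,
      ⟪lineWavelet ψ (j, k), lineWavelet ψ (j', k')⟫_ℂ = 0 := by
    intro j j' h k k'
    refine hS.inner_scaling_lineWavelet j' (Nat.succ_le_of_lt h) ?_ k'
    rw [← hS.sup_eq j]
    exact (le_sup_right : _ ≤ shiftSpace (complexify φ) j ⊔ _) (lineWavelet_mem ψ (j, k))
  rcases lt_or_gt_of_ne h with h | h
  · exact key h k k'
  · rw [← inner_conj_symm, key h k' k, map_zero]

theorem integrable_complexify (hψ : MemLp (complexify ψ) 2 (volume : Measure ℝ))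
    (hW : IsWavelet m S γ δ ψ) : Integrable (complexify ψ) := by
  have h : (Set.Icc 0 S).indicator (complexify ψ) = complexify ψ := by
    rw [Set.indicator_eq_self]
    intro x hx
    exact hW.support_subset fun h0 => hx (by simp [complexify, h0])
  rw [← h, integrable_indicator_iff measurableSet_Icc]
  exact (hψ.restrict _).integrable (by norm_num)

theorem inner_circleWavelet_one (hm : 1 ≤ m) (hψ : MemLp (complexify ψ) 2 (volume : Measure ℝ))
    (hW : IsWavelet m S γ δ ψ) (j : ℕ) (k : ℤ) :
    ⟪circleWavelet ψ j k, toL2 AddCircle.haarAddCircle fun _ => 1⟫_ℂ = 0 := by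
  rw [circleWavelet, perWavelet_natCast, inner_periodize (memLp_dilate hψ j k)
    (hW.dilate_eq_zero j k) (memLp_const 1)]
  have h0 : ∫ x, (ψ x : ℂ) = 0 := by
    have := hW.moments 0 hm
    simp only [pow_zero, mul_one] at this
    rw [integral_complex_ofReal, this, Complex.ofReal_zero]
  have h1 : ∀ x : ℝ, conj (dilate (complexify ψ) j k x) * 1 =
      (((2 : ℝ) ^ ((j : ℝ) / 2) : ℝ) : ℂ) * (fun y => (ψ (y - k) : ℂ)) (2 ^ j * x) := by
    intro x
    simp [dilate, complexify]
  simp_rw [h1]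
  rw [integral_const_mul, Measure.integral_comp_mul_left (fun y => (ψ (y - k) : ℂ)),
    integral_sub_right_eq_self (fun y => (ψ y : ℂ)) (k : ℝ), h0]
  simp

theorem circleWavelet_neg (ψ : ℝ → ℝ) {j : ℤ} (hj : j < 0) (k : ℤ) :
    circleWavelet ψ j k = toL2 AddCircle.haarAddCircle fun _ => 1 := by
  rw [circleWavelet, perWavelet_neg ψ hj]

theorem inner_circleWavelet_of_ne (hm : 1 ≤ m) (hS : IsScalingPair φ ψ)
    (hW : IsWavelet m S γ δ ψ) {j j' : ℤ} (hj : -1 ≤ j) (hj' : -1 ≤ j') (h : j ≠ j') (k k' : ℤ) :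
    ⟪circleWavelet ψ j k, circleWavelet ψ j' k'⟫_ℂ = 0 := by
  have hψ := hS.memLp_wavelet
  rcases lt_or_ge j 0 with h1 | h1 <;> rcases lt_or_ge j' 0 with h2 | h2
  · omega
  · lift j' to ℕ using h2
    rw [circleWavelet_neg ψ h1, ← inner_conj_symm, inner_circleWavelet_one hm hψ hW, map_zero]
  · lift j to ℕ using h1
    rw [circleWavelet_neg ψ h2, inner_circleWavelet_one hm hψ hW]
  · lift j to ℕ using h1
    lift j' to ℕ using h2
    obtain ⟨s, -, hs⟩ := inner_circleWavelet_natCast (j := j) (j' := j') (k := k) (k' := k') hψ hW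
    rw [hs]
    exact Finset.sum_eq_zero fun l _ => hS.inner_lineWavelet_of_ne (by simpa using h) _ _

theorem norm_sum_lineWavelet_sq (hS : IsScalingPair φ ψ) (J : ℕ) (s : Finset ℤ) (c : ℕ × ℤ → ℂ) :
    ‖∑ p ∈ Finset.range J ×ˢ s, c p • lineWavelet ψ p‖ ^ 2 =
      ∑ j ∈ Finset.range J, ‖∑ k ∈ s, c (j, k) • lineWavelet ψ (j, k)‖ ^ 2 := by
  rw [Finset.sum_product]
  refine norm_sum_sq_of_pairwise_inner_eq_zero _ _ fun i _ j _ hij => ?_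
  simp_rw [sum_inner, inner_sum, inner_smul_left, inner_smul_right,
    hS.inner_lineWavelet_of_ne hij]
  simp

theorem riesz_line_levels (hS : IsScalingPair φ ψ) (hW : IsWavelet m S γ δ ψ) (J : ℕ)
    (s : Finset ℤ) (c : ℕ × ℤ → ℂ) :
    γ * ∑ p ∈ Finset.range J ×ˢ s, ‖c p‖ ^ 2 ≤
        ‖∑ p ∈ Finset.range J ×ˢ s, c p • lineWavelet ψ p‖ ^ 2 ∧
      ‖∑ p ∈ Finset.range J ×ˢ s, c p • lineWavelet ψ p‖ ^ 2 ≤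
        δ * ∑ p ∈ Finset.range J ×ˢ s, ‖c p‖ ^ 2 := by
  rw [norm_sum_lineWavelet_sq hS, Finset.sum_product, Finset.mul_sum, Finset.mul_sum]
  exact ⟨Finset.sum_le_sum fun j _ => (riesz_line hS.memLp_wavelet hW j s fun k => c (j, k)).1,
    Finset.sum_le_sum fun j _ => (riesz_line hS.memLp_wavelet hW j s fun k => c (j, k)).2⟩

theorem bessel_line (hS : IsScalingPair φ ψ) (hW : IsWavelet m S γ δ ψ) (J : ℕ)
    (s : Finset ℤ) (h : Lp ℂ 2 (volume : Measure ℝ)) :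
    ∑ p ∈ Finset.range J ×ˢ s, ‖⟪lineWavelet ψ p, h⟫_ℂ‖ ^ 2 ≤ δ * ‖h‖ ^ 2 :=
  sum_norm_inner_sq_le_of_norm_sum_sq_le _ hW.nonneg_upper
    (fun c => (riesz_line_levels hS hW J s c).2) h

end HyperbolicWavelet
end
noncomputable section
namespace HyperbolicWavelet
open scoped ENNReal InnerProductSpace ComplexConjugate

variable {m : ℕ} {S γ δ : ℝ} {φ ψ : ℝ → ℝ}

/-! ### Completeness of the periodized wavelets in L₂(𝕋) -/

theorem isClosed_shiftSpace (g : ℝ → ℂ) (j : ℕ) :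
    IsClosed (shiftSpace g j : Set (Lp ℂ 2 (volume : Measure ℝ))) :=
  Submodule.isClosed_topologicalClosure _

theorem IsScalingPair.sup_span_dense (hS : IsScalingPair φ ψ) :
    (shiftSpace (complexify φ) 0 ⊔
      Submodule.span ℂ (Set.range (lineWavelet ψ))).topologicalClosure = ⊤ := by
  set D := shiftSpace (complexify φ) 0 ⊔ Submodule.span ℂ (Set.range (lineWavelet ψ)) with hD
  have hW : ∀ j, shiftSpace (complexify ψ) j ≤ D.topologicalClosure := by
    intro j
    refine Submodule.topologicalClosure_mono (le_trans (Submodule.span_mono ?_) le_sup_right)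
    rintro _ ⟨k, rfl⟩
    exact ⟨(j, k), rfl⟩
  have hV : ∀ j, shiftSpace (complexify φ) j ≤ D.topologicalClosure := by
    intro j
    induction j with
    | zero => exact le_sup_left.trans (Submodule.le_topologicalClosure _)
    | succ j ih =>
      rw [← hS.sup_eq j]
      exact sup_le ih (hW j)
  rw [eq_top_iff, ← hS.dense]
  exact Submodule.topologicalClosure_minimal _ (iSup_le hV)
    (Submodule.isClosed_topologicalClosure _)

theorem exists_sum_of_mem_span_lineWavelet {v : Lp ℂ 2 (volume : Measure ℝ)}
    (hv : v ∈ Submodule.span ℂ (Set.range (lineWavelet ψ))) :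
    ∃ (J : ℕ) (s : Finset ℤ) (c : ℕ × ℤ → ℂ),
      v = ∑ p ∈ Finset.range J ×ˢ s, c p • lineWavelet ψ p := by
  obtain ⟨c, rfl⟩ := Finsupp.mem_span_range_iff_exists_finsupp.1 hv
  refine ⟨(c.support.image Prod.fst).sup id + 1, c.support.image Prod.snd, c, ?_⟩
  rw [Finsupp.sum]
  refine Finset.sum_subset (fun p hp => ?_) fun p _ hp => ?_
  · rw [Finset.mem_product, Finset.mem_range]
    exact ⟨Nat.lt_succ_of_le (Finset.le_sup (f := id) (Finset.mem_image_of_mem _ hp)),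
      Finset.mem_image_of_mem _ hp⟩
  · rw [Finsupp.notMem_support_iff.1 hp, zero_smul]

/-- If all wavelet coefficients of `g` are controlled, then `g` is close to `V_0`. -/
theorem exists_mem_scaling_norm_sub_le (hγ : 0 < γ) (hS : IsScalingPair φ ψ)
    (hW : IsWavelet m S γ δ ψ) (g : Lp ℂ 2 (volume : Measure ℝ)) (B : ℝ)
    (hB : ∀ (J : ℕ) (s : Finset ℤ),
      ∑ p ∈ Finset.range J ×ˢ s, ‖⟪lineWavelet ψ p, g⟫_ℂ‖ ^ 2 ≤ B) :
    ∃ v ∈ shiftSpace (complexify φ) 0, ‖g - v‖ ≤ Real.sqrt (B / γ) := by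
  have : CompleteSpace (shiftSpace (complexify φ) 0) :=
    (isClosed_shiftSpace (complexify φ) 0).completeSpace_coe
  obtain ⟨v, hv, e, he, rfl⟩ :=
    (shiftSpace (complexify φ) 0).exists_add_mem_mem_orthogonal g
  refine ⟨v, hv, ?_⟩
  rw [add_sub_cancel_left]
  have hB0 : 0 ≤ B := by simpa using hB 0 ∅
  -- The residual e is estimated as a functional. Both e and the wavelet part z are orthogonal to
  -- V₀, so ⟨e, y + z⟩ = ⟨v + e, z⟩, which Cauchy–Schwarz bounds through the wavelet coefficients of
  -- g and the lower Riesz bound. By density, x = e may then be inserted.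
  have key : ∀ x ∈ shiftSpace (complexify φ) 0 ⊔ Submodule.span ℂ (Set.range (lineWavelet ψ)),
      ‖⟪e, x⟫_ℂ‖ ≤ Real.sqrt (B / γ) * ‖x‖ := by
    intro x hx
    obtain ⟨y, hy, z, hz, rfl⟩ := Submodule.mem_sup.1 hx
    obtain ⟨J, s, c, rfl⟩ := exists_sum_of_mem_span_lineWavelet hz
    set z := ∑ p ∈ Finset.range J ×ˢ s, c p • lineWavelet ψ p with hzdef
    have hVz : ∀ u ∈ shiftSpace (complexify φ) 0, ⟪u, z⟫_ℂ = 0 := by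
      intro u hu
      rw [hzdef, inner_sum]
      refine Finset.sum_eq_zero fun p _ => ?_
      rw [inner_smul_right, hS.inner_scaling_lineWavelet p.1 (Nat.zero_le _) hu, mul_zero]
    have h1 : ⟪e, y + z⟫_ℂ = ⟪v + e, z⟫_ℂ := by
      rw [inner_add_right, inner_add_left, hVz v hv, Submodule.inner_left_of_mem_orthogonal hy he]
    have h2 : ‖z‖ ^ 2 ≤ ‖y + z‖ ^ 2 := by
      have := norm_add_sq_eq_norm_sq_add_norm_sq_of_inner_eq_zero y z (hVz y hy)
      nlinarith [norm_nonneg y]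
    have h3 : ∑ p ∈ Finset.range J ×ˢ s, ‖c p‖ ^ 2 ≤ ‖z‖ ^ 2 / γ := by
      rw [le_div_iff₀ hγ, mul_comm]
      exact (riesz_line_levels hS hW J s c).1
    rw [h1]
    refine abs_le_of_sq_le_sq' ?_ (by positivity) |>.2
    rw [mul_pow, Real.sq_sqrt (by positivity)]
    calc ‖⟪v + e, z⟫_ℂ‖ ^ 2 ≤ (∑ p ∈ Finset.range J ×ˢ s, ‖c p‖ ^ 2) *
          ∑ p ∈ Finset.range J ×ˢ s, ‖⟪lineWavelet ψ p, v + e⟫_ℂ‖ ^ 2 :=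
          norm_inner_sum_smul_sq_le _ _ _ _
      _ ≤ ‖z‖ ^ 2 / γ * B := by
          gcongr
          exact hB J s
      _ ≤ ‖y + z‖ ^ 2 / γ * B := by gcongr
      _ = _ := by ring
  have key2 : ∀ x, ‖⟪e, x⟫_ℂ‖ ≤ Real.sqrt (B / γ) * ‖x‖ := by
    intro x
    have hx : x ∈ (shiftSpace (complexify φ) 0 ⊔
        Submodule.span ℂ (Set.range (lineWavelet ψ))).topologicalClosure := by
      rw [hS.sup_span_dense]; trivial
    have hcl : IsClosed {x : Lp ℂ 2 (volume : Measure ℝ) |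
        ‖⟪e, x⟫_ℂ‖ ≤ Real.sqrt (B / γ) * ‖x‖} :=
      isClosed_le (by fun_prop) (by fun_prop)
    exact closure_minimal key hcl hx
  have h := key2 e
  rw [inner_self_eq_norm_sq_to_K, norm_pow] at h
  have h' : ‖e‖ * ‖e‖ ≤ Real.sqrt (B / γ) * ‖e‖ := by
    simpa [sq] using h
  rcases (norm_nonneg e).eq_or_lt with h0 | h0
  · rw [← h0]; positivity
  · exact le_of_mul_le_mul_right h' h0

theorem norm_sum_cell_sq {h : UnitAddCircle → ℂ} (hh : MemLp h 2 AddCircle.haarAddCircle)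
    (s : Finset ℤ) : ‖toL2 volume (fun x => ∑ k ∈ s, cell h k x)‖ ^ 2 =
      s.card * ‖toL2 AddCircle.haarAddCircle h‖ ^ 2 := by
  rw [toL2_sum s fun k _ => memLp_cell hh k, norm_sum_sq_of_pairwise_inner_eq_zero]
  · rw [← nsmul_eq_mul, ← Finset.sum_const]
    refine Finset.sum_congr rfl fun k _ => ?_
    rw [← inner_self_eq_norm_sq (𝕜 := ℂ), inner_cell hh hh, if_pos rfl, inner_self_eq_norm_sq]
  · intro i _ j _ hij
    rw [inner_cell hh hh, if_neg hij]

/-- A wavelet supported inside the block sees the whole periodic function, so its coefficient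
vanishes by unfolding. Any other wavelet has support of length at most S reaching an end of the
block, and inside the block it meets only the ⌈S⌉ + 1 cells next to that end. -/
theorem inner_lineWavelet_sum_cell (hψ : MemLp (complexify ψ) 2 (volume : Measure ℝ))
    (hW : IsWavelet m S γ δ ψ) {h : UnitAddCircle → ℂ}
    (hh : MemLp h 2 AddCircle.haarAddCircle) (hz : ∀ (j : ℕ) (k : ℤ),
      ⟪circleWavelet ψ j k, toL2 AddCircle.haarAddCircle h⟫_ℂ = 0) (M : ℕ) (p : ℕ × ℤ) :
    ‖⟪lineWavelet ψ p, toL2 volume fun x => ∑ i ∈ Finset.Icc (-M : ℤ) M, cell h i x⟫_ℂ‖ ^ 2 ≤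
      ‖⟪lineWavelet ψ p, toL2 volume fun x =>
        ∑ i ∈ Finset.Icc (-M : ℤ) (min M (-M + ⌈S⌉₊)), cell h i x⟫_ℂ‖ ^ 2 +
      ‖⟪lineWavelet ψ p, toL2 volume fun x =>
        ∑ i ∈ Finset.Icc (max (-M : ℤ) (M - ⌈S⌉₊)) M, cell h i x⟫_ℂ‖ ^ 2 := by
  obtain ⟨j, k⟩ := p
  have hceil := Nat.le_ceil S
  have h2j : (0 : ℝ) < 2 ^ j := by positivity
  have h2j1 : (1 : ℝ) ≤ 2 ^ j := one_le_pow₀ (by norm_num)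
  set a : ℝ := k / 2 ^ j with ha
  have hsupp : ∀ x, dilate (complexify ψ) j k x ≠ 0 → a ≤ x ∧ x ≤ a + S := by
    intro x hx
    obtain ⟨h1, h2⟩ := hW.mem_of_dilate_ne_zero hx
    have e : 2 ^ j * a = k := by rw [ha]; field_simp
    have hS0 : 0 ≤ S := h1.trans h2
    constructor
    · exact le_of_mul_le_mul_left (by linarith) h2j
    · refine le_of_mul_le_mul_left (a := (2 : ℝ) ^ j) ?_ h2j
      rw [mul_add, e]
      nlinarith
  have hcongr : ∀ s : Finset ℤ, (∀ x, dilate (complexify ψ) j k x ≠ 0 →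
      (⌈x⌉ - 1 ∈ Finset.Icc (-M : ℤ) M ↔ ⌈x⌉ - 1 ∈ s)) →
      ⟪lineWavelet ψ (j, k), toL2 volume fun x => ∑ i ∈ Finset.Icc (-M : ℤ) M, cell h i x⟫_ℂ =
      ⟪lineWavelet ψ (j, k), toL2 volume fun x => ∑ i ∈ s, cell h i x⟫_ℂ := by
    intro s hs
    rw [lineWavelet, inner_toL2 (memLp_dilate hψ j k) (memLp_sum_cell hh _),
      inner_toL2 (memLp_dilate hψ j k) (memLp_sum_cell hh _)]
    refine integral_congr_ae (Filter.Eventually.of_forall fun x => ?_)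
    simp only [sum_cell_apply]
    by_cases hx : dilate (complexify ψ) j k x = 0
    · simp [hx]
    · simp only [hs x hx]
  by_cases hleft : a ≤ -M
  · rw [hcongr (Finset.Icc (-M : ℤ) (min M (-M + ⌈S⌉₊)))]
    · exact le_add_of_nonneg_right (sq_nonneg _)
    · intro x hx
      obtain ⟨-, h2⟩ := hsupp x hx
      have : ⌈x⌉ ≤ -M + (⌈S⌉₊ : ℤ) := Int.ceil_le.2 (by push_cast; linarith)
      rw [Finset.mem_Icc, Finset.mem_Icc]
      omega
  by_cases hright : M + 1 < a + S
  · rw [hcongr (Finset.Icc (max (-M : ℤ) (M - ⌈S⌉₊)) M)]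
    · exact le_add_of_nonneg_left (sq_nonneg _)
    · intro x hx
      obtain ⟨h1, -⟩ := hsupp x hx
      have : (M + 1 - ⌈S⌉₊ : ℤ) ≤ ⌈x⌉ := by
        have h3 := Int.le_ceil x
        have : ((M + 1 - ⌈S⌉₊ : ℤ) : ℝ) ≤ (⌈x⌉ : ℝ) := by push_cast; linarith
        exact_mod_cast this
      rw [Finset.mem_Icc, Finset.mem_Icc]
      omega
  · have h0 : ⟪lineWavelet ψ (j, k),
        toL2 volume fun x => ∑ i ∈ Finset.Icc (-M : ℤ) M, cell h i x⟫_ℂ = 0 := by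
      rw [← hz j k, circleWavelet, perWavelet_natCast,
        inner_periodize (memLp_dilate hψ j k) (hW.dilate_eq_zero j k) hh, lineWavelet,
        inner_toL2 (memLp_dilate hψ j k) (memLp_sum_cell hh _)]
      refine integral_congr_ae (Filter.Eventually.of_forall fun x => ?_)
      simp only [sum_cell_apply]
      by_cases hx : dilate (complexify ψ) j k x = 0
      · simp [hx]
      · rw [if_pos]
        obtain ⟨h1, h2⟩ := hsupp x hx
        have h3 : (-M : ℤ) < ⌈x⌉ := by
          rw [Int.lt_ceil]; push_cast; linarith
        have h4 : ⌈x⌉ ≤ (M + 1 : ℤ) := Int.ceil_le.2 (by push_cast; linarith)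
        rw [Finset.mem_Icc]
        omega
    rw [h0]
    rw [norm_zero, zero_pow two_ne_zero]
    positivity

/-- Each end piece has at most ⌈S⌉ + 1 cells, so by Bessel the square sum of all wavelet
coefficients of the block is bounded independently of M. -/
theorem exists_bound_dist_scaling (hγ : 0 < γ) (hS : IsScalingPair φ ψ)
    (hW : IsWavelet m S γ δ ψ) {h : UnitAddCircle → ℂ}
    (hh : MemLp h 2 AddCircle.haarAddCircle) (hz : ∀ (j : ℕ) (k : ℤ),
      ⟪circleWavelet ψ j k, toL2 AddCircle.haarAddCircle h⟫_ℂ = 0) :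
    ∃ C : ℝ, ∀ M : ℕ, ∃ v ∈ shiftSpace (complexify φ) 0,
      ‖∑ k ∈ Finset.Icc (-M : ℤ) M, toL2 volume (cell h k) - v‖ ≤ C := by
  set A := ‖toL2 AddCircle.haarAddCircle h‖ ^ 2 with hA
  refine ⟨Real.sqrt ((2 * (δ * ((⌈S⌉₊ + 1 : ℝ) * A))) / γ), fun M => ?_⟩
  rw [← toL2_sum _ fun k _ => memLp_cell hh k]
  refine exists_mem_scaling_norm_sub_le hγ hS hW _ _ fun J s => ?_
  refine (Finset.sum_le_sum fun p _ =>
    inner_lineWavelet_sum_cell hS.memLp_wavelet hW hh hz M p).trans ?_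
  rw [Finset.sum_add_distrib, two_mul]
  have hδ := hW.nonneg_upper
  refine add_le_add ((bessel_line hS hW J s _).trans ?_) ((bessel_line hS hW J s _).trans ?_)
  all_goals
    rw [norm_sum_cell_sq hh]
    gcongr
    rw [Int.card_Icc]
    refine (Nat.cast_le.2 (?_ : _ ≤ ⌈S⌉₊ + 1)).trans_eq (Nat.cast_add_one _)
    omega

theorem circleWavelet_add (ψ : ℝ → ℝ) (j : ℕ) (k l : ℤ) :
    circleWavelet ψ j (k + 2 ^ j * l) = circleWavelet ψ j k := by
  rw [circleWavelet, circleWavelet]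
  congr 1
  ext t
  induction t using QuotientAddGroup.induction_on with
  | H x =>
    rw [perWavelet_natCast, perWavelet_natCast]
    change ∑' i : ℤ, _ = ∑' i : ℤ, _
    rw [← (Equiv.addRight l).tsum_eq]
    refine tsum_congr fun i => ?_
    rw [dilate_add, dilate_add]
    congr 1
    simp
    ring

theorem inner_cell_translate {g : ℝ → ℂ} (hg : MemLp g 2 (volume : Measure ℝ))
    {h : UnitAddCircle → ℂ} (hh : MemLp h 2 AddCircle.haarAddCircle) (k j i : ℤ) :
    ⟪toL2 volume (cell h (k + i)), toL2 volume (dilate g 0 (j + i))⟫_ℂ =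
      ⟪toL2 volume (cell h k), toL2 volume (dilate g 0 j)⟫_ℂ := by
  rw [inner_toL2 (memLp_cell hh _) (memLp_dilate hg _ _),
    inner_toL2 (memLp_cell hh _) (memLp_dilate hg _ _),
    ← integral_add_right_eq_self _ (i : ℝ)]
  refine integral_congr_ae (Filter.Eventually.of_forall fun x => ?_)
  simp only [cell_apply, dilate_add]
  have h1 : ⌈x + i⌉ - 1 = k + i ↔ ⌈x⌉ - 1 = k := by
    rw [Int.ceil_add_intCast]; omega
  have h2 : ((x + i : ℝ) : UnitAddCircle) = x := by
    rw [AddCircle.coe_add, add_eq_left, AddCircle.coe_eq_zero_iff]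
    exact ⟨i, by simp⟩
  simp only [h1, h2]
  congr 2
  ring

/-- The constant function and the periodized wavelets are complete in `L₂(𝕋)`. -/
theorem eq_zero_of_inner_circleWavelet_eq_zero (hm : 1 ≤ m) (hγ : 0 < γ)
    (hS : IsScalingPair φ ψ) (hW : IsWavelet m S γ δ ψ)
    (h : Lp ℂ 2 (AddCircle.haarAddCircle (T := (1 : ℝ))))
    (hz : ∀ (j : ℤ), -1 ≤ j → ∀ k : Idx j, ⟪circleWavelet ψ j (k : ℕ), h⟫_ℂ = 0) : h = 0 := by
  -- A nonzero h, normalized, supplies a second orthonormal sequence of cells near V₀ next to the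
  -- one from the constant function.
  by_contra hne
  have hz' : ∀ (j : ℕ) (k : ℤ), ⟪circleWavelet ψ j k, h⟫_ℂ = 0 := by
    intro j k
    have h2 : (0 : ℤ) < 2 ^ j := by positivity
    have h3 := Int.emod_nonneg k h2.ne'
    have h4 := Int.emod_lt_of_pos k h2
    have h5 : (k % 2 ^ j).toNat < 2 ^ ((j : ℤ)).toNat := by
      rw [Int.toNat_natCast]
      have : ((k % 2 ^ j).toNat : ℤ) < 2 ^ j := by rwa [Int.toNat_of_nonneg h3]
      exact_mod_cast this
    have := hz j (by omega) ⟨_, h5⟩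
    rw [← Int.emod_add_mul_ediv k (2 ^ j), circleWavelet_add]
    rwa [Int.toNat_of_nonneg h3] at this
  set u := ((‖h‖⁻¹ : ℝ) : ℂ) • h with hu
  have hun : ‖u‖ = 1 := by
    rw [hu, norm_smul, Complex.norm_real, norm_inv, norm_norm,
      inv_mul_cancel₀ (norm_ne_zero_iff.2 hne)]
  have hmu : MemLp u 2 AddCircle.haarAddCircle := Lp.memLp u
  have hm1 : MemLp (fun _ : UnitAddCircle => (1 : ℂ)) 2 AddCircle.haarAddCircle := memLp_const 1
  have h11 : ⟪toL2 AddCircle.haarAddCircle fun _ : UnitAddCircle => (1 : ℂ),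
      toL2 AddCircle.haarAddCircle fun _ : UnitAddCircle => (1 : ℂ)⟫_ℂ = 1 := by
    rw [inner_toL2 hm1 hm1]; simp
  have h1u : ⟪toL2 AddCircle.haarAddCircle fun _ : UnitAddCircle => (1 : ℂ), u⟫_ℂ = 0 := by
    have := hz (-1) le_rfl ⟨0, by simp⟩
    rw [circleWavelet_neg ψ (by norm_num)] at this
    rw [hu, inner_smul_right, this, mul_zero]
  obtain ⟨C, hC⟩ := exists_bound_dist_scaling hγ hS hW hmu fun j k => by
    rw [toL2_coeFn, hu, inner_smul_right, hz', mul_zero]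
  -- The constant function qualifies because the zeroth moment of ψ vanishes; this is where m ≥ 1 is
  -- used.
  obtain ⟨C', hC'⟩ := exists_bound_dist_scaling hγ hS hW hm1 fun j k =>
    inner_circleWavelet_one hm hS.memLp_wavelet hW j k
  have ho : ∀ {f : UnitAddCircle → ℂ}, MemLp f 2 AddCircle.haarAddCircle →
      ⟪toL2 AddCircle.haarAddCircle f, toL2 AddCircle.haarAddCircle f⟫_ℂ = 1 →
      Orthonormal ℂ fun k => toL2 volume (cell f k) := by
    intro f hf h1
    rw [orthonormal_iff_ite]
    intro i j
    rw [inner_cell hf hf, h1]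
  refine not_bounded_dist_principal (φ := fun k : ℤ => toL2 volume (dilate (complexify φ) 0 k))
    (ho hmu ?_) (ho hm1 h11) ?_ (inner_cell_translate hS.memLp_scaling hmu)
    (inner_cell_translate hS.memLp_scaling hm1) (max C C') ?_ ?_
  · rw [toL2_coeFn, inner_self_eq_norm_sq_to_K, hun]; simp
  · intro k l
    rw [inner_cell hmu hm1, toL2_coeFn, ← inner_conj_symm, h1u, map_zero, ite_self]
  · intro M
    obtain ⟨v, hv, hvC⟩ := hC M
    exact ⟨v, hv, hvC.trans (le_max_left _ _)⟩
  · intro M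
    obtain ⟨v, hv, hvC⟩ := hC' M
    exact ⟨v, hv, hvC.trans (le_max_right _ _)⟩

end HyperbolicWavelet
end
noncomputable section
namespace HyperbolicWavelet
open scoped ENNReal InnerProductSpace ComplexConjugate

variable {m : ℕ} {S γ δ : ℝ} {φ ψ : ℝ → ℝ}

/-! ### The Fourier transform of the wavelet -/

/-- The Fourier transform of `ψ`. -/
def waveletFT (ψ : ℝ → ℝ) (ξ : ℝ) : ℂ :=
  ∫ x : ℝ, complexify ψ x * Complex.exp (-2 * Real.pi * Complex.I * x * ξ)

theorem norm_exp_neg_two_pi (x ξ : ℝ) :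
    ‖Complex.exp (-2 * Real.pi * Complex.I * x * ξ)‖ = 1 := by
  have : -2 * Real.pi * Complex.I * x * ξ = ((-2 * Real.pi * x * ξ : ℝ) : ℂ) * Complex.I := by
    push_cast; ring
  rw [this, Complex.norm_exp_ofReal_mul_I]

/-- On [0, S] one has |ψ| ≤ 1 + |ψ|², and ‖ψ‖₂² ≤ δ is the upper Riesz bound for a single
coefficient. Thereby the Fourier bounds depend on m, S and δ only. -/
theorem integral_norm_wavelet_le (hψ : MemLp (complexify ψ) 2 (volume : Measure ℝ))
    (hW : IsWavelet m S γ δ ψ) : ∫ x, ‖complexify ψ x‖ ≤ |S| + δ := by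
  have h0 : Integrable fun x => ‖complexify ψ x‖ ^ 2 :=
    (memLp_two_iff_integrable_sq_norm hψ.1).1 hψ
  have h1 : ∫ x, ‖complexify ψ x‖ ^ 2 ≤ δ := by
    have := (riesz_line hψ hW 0 {0} fun _ => 1).2
    simp only [Finset.sum_singleton, one_smul, norm_one, one_pow, mul_one] at this
    have e : ((‖lineWavelet ψ (0, 0)‖ ^ 2 : ℝ) : ℂ) = ((∫ x, ‖complexify ψ x‖ ^ 2 : ℝ) : ℂ) := by
      have := inner_lineWavelet hψ 0 0 0
      rw [inner_self_eq_norm_sq_to_K] at this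
      rw [← integral_complex_ofReal]
      push_cast
      refine this.trans ?_
      rw [autocorr]
      refine integral_congr_ae (Filter.Eventually.of_forall fun x => ?_)
      simp [Complex.conj_mul']
    rw [← Complex.ofReal_injective e]
    exact this
  have h2 : Integrable ((Set.Icc 0 S).indicator fun _ : ℝ => (1 : ℝ)) :=
    (integrable_indicator_iff measurableSet_Icc).2 (by simp)
  have h3 : ∫ x, (Set.Icc 0 S).indicator (fun _ : ℝ => (1 : ℝ)) x ≤ |S| := by
    rw [integral_indicator measurableSet_Icc]
    simp
    exact le_abs_self S
  calc ∫ x, ‖complexify ψ x‖ ≤ ∫ x, ((Set.Icc 0 S).indicator (fun _ : ℝ => (1 : ℝ)) x +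
        ‖complexify ψ x‖ ^ 2) := by
        refine integral_mono (integrable_complexify hψ hW).norm (h2.add h0) fun x => ?_
        by_cases hx : ψ x = 0
        · simp only [complexify, hx, Complex.ofReal_zero, norm_zero]
          have := Set.indicator_nonneg (s := Set.Icc 0 S) (f := fun _ : ℝ => (1 : ℝ))
            (fun _ _ => zero_le_one) x
          positivity
        · simp only [Set.indicator_of_mem (hW.support_subset hx)]
          nlinarith [sq_nonneg (‖complexify ψ x‖ - 1), norm_nonneg (complexify ψ x)]
    _ ≤ _ := by
        rw [integral_add h2 h0]
        exact add_le_add h3 h1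

theorem norm_waveletFT_le (hψ : MemLp (complexify ψ) 2 (volume : Measure ℝ))
    (hW : IsWavelet m S γ δ ψ) (ξ : ℝ) : ‖waveletFT ψ ξ‖ ≤ |S| + δ := by
  refine (norm_integral_le_integral_norm _).trans ?_
  simp_rw [norm_mul, norm_exp_neg_two_pi, mul_one]
  exact integral_norm_wavelet_le hψ hW

/-- The moments annihilate the Taylor polynomial of the exponential of degree below m; the remainder
is at most |z|^m e^{|z|}, with |z| ≤ 2π|S||ξ| on the support. -/
theorem norm_waveletFT_le_pow (hψ : MemLp (complexify ψ) 2 (volume : Measure ℝ))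
    (hW : IsWavelet m S γ δ ψ) {ξ : ℝ} (hξ : |ξ| ≤ 1) : ‖waveletFT ψ ξ‖ ≤
      (2 * Real.pi * |S|) ^ m * Real.exp (2 * Real.pi * |S|) * (|S| + δ) * |ξ| ^ m := by
  have hint := integrable_complexify hψ hW
  set z : ℝ → ℂ := fun x => -2 * Real.pi * Complex.I * x * ξ with hz
  have hsupp : ∀ x, complexify ψ x ≠ 0 → |x| ≤ |S| := by
    intro x hx
    have := hW.support_subset (show ψ x ≠ 0 from fun h0 => hx (by simp [complexify, h0]))
    rw [abs_of_nonneg this.1]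
    exact this.2.trans (le_abs_self S)
  have hznorm : ∀ x, ‖z x‖ = 2 * Real.pi * |x| * |ξ| := by
    intro x
    simp [hz, abs_of_pos Real.pi_pos]
  have hmom : ∀ β < m, ∫ x : ℝ, complexify ψ x * (z x ^ β / β.factorial) = 0 := by
    intro β hβ
    have h1 : ∀ x : ℝ, complexify ψ x * (z x ^ β / β.factorial) =
        ((-2 * Real.pi * Complex.I * ξ) ^ β / β.factorial) * ((ψ x * x ^ β : ℝ) : ℂ) := by
      intro x
      simp only [hz, complexify]
      push_cast
      ring
    simp_rw [h1]
    rw [integral_const_mul, integral_complex_ofReal, hW.moments β hβ]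
    simp
  have hpolyint : ∀ β, Integrable fun x : ℝ => complexify ψ x * (z x ^ β / β.factorial) := by
    intro β
    have h2 : Integrable (fun x : ℝ => complexify ψ x * (z x ^ β / β.factorial)) ↔ IntegrableOn
        (fun x : ℝ => complexify ψ x * (z x ^ β / β.factorial)) (Set.Icc (-|S|) |S|) := by
      rw [integrableOn_iff_integrable_of_support_subset]
      intro x hx
      exact abs_le.1 (hsupp x (left_ne_zero_of_mul hx))
    rw [h2]
    exact hint.integrableOn.mul_continuousOn (by fun_prop) isCompact_Icc
  have hexpint : Integrable fun x : ℝ => complexify ψ x * Complex.exp (z x) := by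
    refine hint.mul_bdd (c := 1) (by fun_prop) (Filter.Eventually.of_forall fun x => ?_)
    exact (norm_exp_neg_two_pi x ξ).le
  have hrepr : waveletFT ψ ξ = ∫ x : ℝ, complexify ψ x *
      (Complex.exp (z x) - ∑ β ∈ Finset.range m, z x ^ β / β.factorial) := by
    simp_rw [mul_sub, Finset.mul_sum]
    rw [integral_sub hexpint (integrable_finsetSum _ fun β _ => hpolyint β),
      integral_finsetSum _ fun β _ => hpolyint β,
      Finset.sum_eq_zero fun β hβ => hmom β (Finset.mem_range.1 hβ), sub_zero]
    rfl
  rw [hrepr]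
  refine (norm_integral_le_of_norm_le (g := fun x => (2 * Real.pi * |S|) ^ m *
    Real.exp (2 * Real.pi * |S|) * |ξ| ^ m * ‖complexify ψ x‖) (hint.norm.const_mul _)
    (Filter.Eventually.of_forall fun x => ?_)).trans ?_
  · by_cases hx : complexify ψ x = 0
    · simp [hx]
    · rw [norm_mul, mul_comm]
      gcongr
      refine (Complex.norm_exp_sub_sum_le_norm_mul_exp _ _).trans ?_
      have h1 : 2 * Real.pi * |x| * |ξ| ≤ 2 * Real.pi * |S| * |ξ| :=
        mul_le_mul_of_nonneg_right (mul_le_mul_of_nonneg_left (hsupp x hx) (by positivity))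
          (abs_nonneg _)
      have h2 : 2 * Real.pi * |x| * |ξ| ≤ 2 * Real.pi * |S| :=
        h1.trans (mul_le_of_le_one_right (by positivity) hξ)
      rw [hznorm]
      calc (2 * Real.pi * |x| * |ξ|) ^ m * Real.exp (2 * Real.pi * |x| * |ξ|)
          ≤ (2 * Real.pi * |S| * |ξ|) ^ m * Real.exp (2 * Real.pi * |S|) := by gcongr
        _ = _ := by rw [mul_pow]; ring
  · rw [integral_const_mul]
    calc _ ≤ (2 * Real.pi * |S|) ^ m * Real.exp (2 * Real.pi * |S|) * |ξ| ^ m * (|S| + δ) := by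
          gcongr
          exact integral_norm_wavelet_le hψ hW
      _ = _ := by ring

/-- A bound for the Fourier transform of all admissible wavelets. -/
def ftBound (m : ℕ) (S δ : ℝ) : ℝ :=
  (1 + (2 * Real.pi * |S|) ^ m * Real.exp (2 * Real.pi * |S|)) * (|S| + δ)

/-- Put ξ = n/2^j. For |ξ| ≤ 1 the factor |ξ|^{2m} from the moments is absorbed by the weight. For
|ξ| > 1 the weight alone gives 2^{-2jm}|ξ|^{-2m}, and m ≥ 1 makes this at most 2^{-2jm}|ξ|^{-2}. In
6 = 2 · 3, the 2 comes from comparison with 1/(1 + ξ²) and the 3 from replacing ξ by its integer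
part. -/
theorem norm_waveletFT_sq_div_le (hm : 1 ≤ m)
    (hψ : MemLp (complexify ψ) 2 (volume : Measure ℝ)) (hW : IsWavelet m S γ δ ψ) (j : ℕ) (n : ℤ) :
    ‖waveletFT ψ (n / 2 ^ j)‖ ^ 2 / (1 + (n : ℝ) ^ 2) ^ m ≤
      6 * ftBound m S δ ^ 2 * ((2 ^ j : ℝ) ^ (2 * m))⁻¹ *
        (1 / (1 + ((n / 2 ^ j : ℤ) : ℝ) ^ 2)) := by
  have hδ := hW.nonneg_upper
  set K := ftBound m S δ with hK
  have hK0 : 0 ≤ K := by rw [hK, ftBound]; positivity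
  set ξ : ℝ := n / 2 ^ j with hξ
  have h2j : (0 : ℝ) < 2 ^ j := by positivity
  have hn : (n : ℝ) = 2 ^ j * ξ := by rw [hξ]; field_simp
  have hb1 : ‖waveletFT ψ ξ‖ ≤ K := by
    refine (norm_waveletFT_le hψ hW ξ).trans ?_
    rw [hK, ftBound]
    exact le_mul_of_one_le_left (by positivity) (le_add_of_nonneg_right (by positivity))
  have hb2 : |ξ| ≤ 1 → ‖waveletFT ψ ξ‖ ≤ K * |ξ| ^ m := by
    intro h
    refine (norm_waveletFT_le_pow hψ hW h).trans ?_
    rw [hK, ftBound]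
    gcongr
    exact le_add_of_nonneg_left zero_le_one
  have hfloor : 1 / (1 + ξ ^ 2) ≤ 3 * (1 / (1 + ((n / 2 ^ j : ℤ) : ℝ) ^ 2)) := by
    set l : ℤ := n / 2 ^ j with hl
    have hd := Int.emod_add_mul_ediv n (2 ^ j)
    rw [← hl] at hd
    have hr0 := Int.emod_nonneg n (show (2 ^ j : ℤ) ≠ 0 by positivity)
    have hr1 := Int.emod_lt_of_pos n (show (0 : ℤ) < 2 ^ j by positivity)
    have hl1 : (l : ℝ) ≤ ξ := by
      have h : 2 ^ j * l ≤ n := by omega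
      have h' : (2 ^ j * l : ℝ) ≤ n := by exact_mod_cast h
      rw [hn] at h'
      exact le_of_mul_le_mul_left h' h2j
    have hl2 : ξ ≤ l + 1 := by
      have h : n ≤ 2 ^ j * (l + 1) := by rw [mul_add, mul_one]; omega
      have h' : (n : ℝ) ≤ 2 ^ j * (l + 1) := by exact_mod_cast h
      rw [hn] at h'
      exact le_of_mul_le_mul_left h' h2j
    rw [mul_one_div, div_le_div_iff₀ (by positivity) (by positivity)]
    nlinarith [sq_nonneg (ξ + 1), sq_nonneg (ξ - 1), sq_nonneg ξ]
  have hpow : ((2 ^ j : ℝ) ^ (2 * m)) = ((2 ^ j : ℝ) ^ 2) ^ m := pow_mul _ _ _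
  have main : ‖waveletFT ψ ξ‖ ^ 2 / (1 + (n : ℝ) ^ 2) ^ m ≤
      K ^ 2 * ((2 ^ j : ℝ) ^ (2 * m))⁻¹ * (2 * (1 / (1 + ξ ^ 2))) := by
    rcases le_or_gt |ξ| 1 with h | h
    · have hξ2 : ξ ^ 2 ≤ 1 := by rw [← sq_abs]; exact pow_le_one₀ (abs_nonneg _) h
      have h1 : ‖waveletFT ψ ξ‖ ^ 2 ≤ K ^ 2 * (ξ ^ 2) ^ m := by
        calc _ ≤ (K * |ξ| ^ m) ^ 2 := by gcongr; exact hb2 h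
          _ = K ^ 2 * (|ξ| ^ 2) ^ m := by ring
          _ = _ := by rw [sq_abs]
      have h2 : (1 : ℝ) ≤ 2 * (1 / (1 + ξ ^ 2)) := by
        rw [mul_one_div, le_div_iff₀ (by positivity)]; linarith
      refine le_trans ?_ (le_mul_of_one_le_right (by positivity) h2)
      rw [div_le_iff₀ (by positivity)]
      refine h1.trans ?_
      rw [mul_assoc]
      gcongr
      rw [hpow, ← inv_pow, ← mul_pow]
      gcongr
      rw [hn, mul_pow, mul_add, ← mul_assoc, inv_mul_cancel₀ (by positivity), one_mul]
      exact le_add_of_nonneg_left (by positivity)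
    · have hξ2 : 1 ≤ ξ ^ 2 := by rw [← sq_abs]; exact one_le_pow₀ h.le
      have h1 : (2 ^ j : ℝ) ^ (2 * m) * ξ ^ 2 ≤ (1 + (n : ℝ) ^ 2) ^ m := by
        calc (2 ^ j : ℝ) ^ (2 * m) * ξ ^ 2 ≤ (2 ^ j : ℝ) ^ (2 * m) * (ξ ^ 2) ^ m := by
              gcongr
              exact le_self_pow₀ hξ2 (by omega)
          _ = ((2 ^ j * ξ) ^ 2) ^ m := by rw [hpow, ← mul_pow, ← mul_pow]
          _ ≤ _ := by
              rw [hn]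
              gcongr
              exact le_add_of_nonneg_left zero_le_one
      calc _ ≤ K ^ 2 / ((2 ^ j : ℝ) ^ (2 * m) * ξ ^ 2) := by gcongr
        _ = K ^ 2 * ((2 ^ j : ℝ) ^ (2 * m))⁻¹ * (1 / ξ ^ 2) := by field_simp
        _ ≤ _ := by
          gcongr
          rw [mul_one_div, div_le_div_iff₀ (by positivity) (by positivity)]
          linarith
  calc _ ≤ _ := main
    _ ≤ K ^ 2 * ((2 ^ j : ℝ) ^ (2 * m))⁻¹ * (2 * (3 * (1 / (1 + ((n / 2 ^ j : ℤ) : ℝ) ^ 2)))) := by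
        gcongr
    _ = _ := by ring

theorem fourierCoeff_perWavelet (hψ : MemLp (complexify ψ) 2 (volume : Measure ℝ))
    (hW : IsWavelet m S γ δ ψ) (j : ℕ) (k n : ℤ) :
    fourierCoeff (perWavelet ψ j k) n = (((2 : ℝ) ^ ((j : ℝ) / 2) : ℝ) : ℂ)⁻¹ *
      (Complex.exp (-2 * Real.pi * Complex.I * k * n / 2 ^ j) * waveletFT ψ (n / 2 ^ j)) := by
  have hmem : MemLp (fourier (T := 1) (-n)) 2 AddCircle.haarAddCircle :=
    (memLp_top_of_bound (by fun_prop) 1 (Filter.Eventually.of_forall fun x => by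
      rw [fourier_apply, Circle.norm_coe])).mono_exponent le_top
  rw [fourierCoeff, perWavelet_natCast]
  simp_rw [smul_eq_mul, mul_comm (fourier (-n) _)]
  rw [integral_periodize_mul (memLp_dilate hψ j k) (hW.dilate_eq_zero j k) hmem]
  set E := Complex.exp (-2 * Real.pi * Complex.I * k * n / 2 ^ j) with hE
  set r := (((2 : ℝ) ^ ((j : ℝ) / 2) : ℝ) : ℂ) with hr
  have hr2 : r * r = 2 ^ j := by
    rw [hr, ← Complex.ofReal_mul, rpow_half_sq]; push_cast; rfl
  have hr0 : r ≠ 0 := by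
    intro h; rw [h, mul_zero] at hr2; exact pow_ne_zero j two_ne_zero hr2.symm
  have h1 : ∀ x : ℝ, dilate (complexify ψ) j k x * fourier (-n) (x : UnitAddCircle) =
      r * E * (fun y : ℝ => complexify ψ (y - k) * Complex.exp (-2 * Real.pi * Complex.I *
        ((y - k : ℝ) : ℂ) * ((n / 2 ^ j : ℝ) : ℂ))) (2 ^ j * x) := by
    intro x
    have h2 : fourier (-n) (x : UnitAddCircle) = E * Complex.exp (-2 * Real.pi * Complex.I *
        ((2 ^ j * x - k : ℝ) : ℂ) * ((n / 2 ^ j : ℝ) : ℂ)) := by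
      rw [fourier_coe_apply, hE, ← Complex.exp_add]
      congr 1
      push_cast
      field_simp
      ring
    simp only [dilate]
    rw [h2]
    ring
  simp_rw [h1]
  rw [integral_const_mul, Measure.integral_comp_mul_left (fun y : ℝ => complexify ψ (y - k) *
    Complex.exp (-2 * Real.pi * Complex.I * ((y - k : ℝ) : ℂ) * ((n / 2 ^ j : ℝ) : ℂ))),
    integral_sub_right_eq_self (fun y : ℝ => complexify ψ y *
    Complex.exp (-2 * Real.pi * Complex.I * (y : ℂ) * ((n / 2 ^ j : ℝ) : ℂ))) (k : ℝ)]
  change r * E * (|((2 : ℝ) ^ j)⁻¹| • waveletFT ψ (n / 2 ^ j)) = _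
  rw [abs_of_pos (by positivity), Complex.real_smul]
  push_cast
  rw [← hr2]
  field_simp

/-! ### The single-scale estimate in the dual Sobolev norm -/

theorem summable_inv_one_add_int_sq : Summable fun l : ℤ => 1 / (1 + (l : ℝ) ^ 2) := by
  have h1 : Summable fun l : ℤ => 1 / (l : ℝ) ^ 2 + if l = 0 then 1 else 0 :=
    (Real.summable_one_div_int_pow.2 one_lt_two).add (hasSum_ite_eq 0 1).summable
  refine Summable.of_nonneg_of_le (fun l => by positivity) (fun l => ?_) h1
  by_cases hl : l = 0
  · simp [hl]
  · have : (l : ℝ) ≠ 0 := by exact_mod_cast hl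
    simp only [hl, if_false, add_zero]
    gcongr
    linarith

theorem enorm_sq_eq_ofReal {E : Type*} [SeminormedAddGroup E] (z : E) :
    ‖z‖ₑ ^ 2 = ENNReal.ofReal (‖z‖ ^ 2) := by
  rw [← ofReal_norm, ENNReal.ofReal_pow (norm_nonneg _)]

/-- The multiplier of the dual Sobolev norm. -/
def dualWeight (m : ℕ) (n : ℤ) : ℝ := (Real.sqrt ((1 + (n : ℝ) ^ 2) ^ m))⁻¹

theorem dualWeight_sq (m : ℕ) (n : ℤ) : dualWeight m n ^ 2 = ((1 + (n : ℝ) ^ 2) ^ m)⁻¹ := by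
  rw [dualWeight, inv_pow, Real.sq_sqrt (by positivity)]

/-- The constant in the single-scale estimate. -/
def levelConst (m : ℕ) (S δ : ℝ) : ℝ :=
  1 + 6 * ftBound m S δ ^ 2 * ∑' l : ℤ, 1 / (1 + (l : ℝ) ^ 2)

theorem one_le_levelConst (m : ℕ) (S δ : ℝ) : 1 ≤ levelConst m S δ := by
  rw [levelConst]
  have : 0 ≤ ∑' l : ℤ, 1 / (1 + (l : ℝ) ^ 2) := tsum_nonneg fun l => by positivity
  exact le_add_of_nonneg_right (by positivity)

/-- Write n = l · 2^j + r. The phases depend on r only, so the sum over k is a discrete Fourier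
transform. Its square sum over r carries a factor 2^j, which cancels the 2^{-j} of the
normalization; the weights are then summed over l. -/
theorem tsum_dualWeight_natCast_le (hm : 1 ≤ m)
    (hψ : MemLp (complexify ψ) 2 (volume : Measure ℝ)) (hW : IsWavelet m S γ δ ψ) (j : ℕ)
    (c : Fin (2 ^ j) → ℂ) :
    ∑' n : ℤ, ‖∑ k, c k * (dualWeight m n * fourierCoeff (perWavelet ψ j (k : ℕ)) n)‖ₑ ^ 2 ≤
      ENNReal.ofReal (levelConst m S δ * ((2 ^ j : ℝ) ^ (2 * m))⁻¹) * ∑ k, ‖c k‖ₑ ^ 2 := by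
  set A := 6 * ftBound m S δ ^ 2 * ((2 ^ j : ℝ) ^ (2 * m))⁻¹ with hA
  have hA0 : 0 ≤ A := by positivity
  set D : Fin (2 ^ j) → ℝ := fun r => ‖∑ k : Fin (2 ^ j), c k *
    Complex.exp (-2 * Real.pi * Complex.I * k * r / (2 ^ j : ℕ))‖ ^ 2 with hD
  have hD0 : ∀ r, 0 ≤ D r := fun r => sq_nonneg _
  have hDsum : ∑ r, D r = (2 ^ j : ℕ) * ∑ k, ‖c k‖ ^ 2 := sum_norm_sq_dft (by positivity) c
  have hpt : ∀ (l : ℤ) (r : Fin (2 ^ j)),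
      ‖∑ k, c k * (dualWeight m ((Int.divModEquiv (2 ^ j)).symm (l, r)) *
        fourierCoeff (perWavelet ψ j (k : ℕ)) ((Int.divModEquiv (2 ^ j)).symm (l, r)))‖ₑ ^ 2 ≤
      ENNReal.ofReal (A * (2 ^ j : ℝ)⁻¹ * (1 / (1 + (l : ℝ) ^ 2)) * D r) := by
    intro l r
    set n := (Int.divModEquiv (2 ^ j)).symm (l, r) with hn
    have hn1 : n = l * (2 ^ j : ℕ) + r := rfl
    have hn2 : n / 2 ^ j = l := by
      have := congrArg Prod.fst ((Int.divModEquiv (2 ^ j)).apply_symm_apply (l, r))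
      rw [← hn] at this
      simpa using this
    rw [enorm_sq_eq_ofReal]
    refine ENNReal.ofReal_le_ofReal ?_
    have hexp : ∀ k : Fin (2 ^ j), Complex.exp (-2 * Real.pi * Complex.I * ((k : ℕ) : ℤ) * n / 2 ^ j)
        = Complex.exp (-2 * Real.pi * Complex.I * k * r / (2 ^ j : ℕ)) := by
      intro k
      rw [Complex.exp_eq_exp_iff_exists_int]
      refine ⟨-(k * l), ?_⟩
      rw [hn1]
      push_cast
      field_simp
      ring
    have hsum : ∑ k, c k * (dualWeight m n * fourierCoeff (perWavelet ψ j (k : ℕ)) n) =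
        (dualWeight m n * (((2 : ℝ) ^ ((j : ℝ) / 2) : ℝ) : ℂ)⁻¹ * waveletFT ψ (n / 2 ^ j)) *
        ∑ k : Fin (2 ^ j), c k *
          Complex.exp (-2 * Real.pi * Complex.I * k * r / (2 ^ j : ℕ)) := by
      rw [Finset.mul_sum]
      refine Finset.sum_congr rfl fun k _ => ?_
      rw [← hexp, fourierCoeff_perWavelet hψ hW]
      ring
    rw [hsum, norm_mul, mul_pow, norm_mul, norm_mul, mul_pow, mul_pow, norm_inv, Complex.norm_real,
      Complex.norm_real, Real.norm_eq_abs, Real.norm_eq_abs, sq_abs, dualWeight_sq, inv_pow,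
      sq_abs, sq ((2 : ℝ) ^ ((j : ℝ) / 2)), rpow_half_sq]
    have := norm_waveletFT_sq_div_le hm hψ hW j n
    rw [hn2] at this
    refine mul_le_mul_of_nonneg_right ?_ (hD0 r)
    calc _ = ‖waveletFT ψ (n / 2 ^ j)‖ ^ 2 / (1 + (n : ℝ) ^ 2) ^ m * (2 ^ j : ℝ)⁻¹ := by ring
      _ ≤ A * (1 / (1 + (l : ℝ) ^ 2)) * (2 ^ j : ℝ)⁻¹ := by gcongr
      _ = _ := by ring
  rw [← (Int.divModEquiv (2 ^ j)).symm.tsum_eq, ENNReal.tsum_prod']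
  set Q := ∑' l : ℤ, 1 / (1 + (l : ℝ) ^ 2) with hQ
  calc _ ≤ ∑' l : ℤ, ∑' r, ENNReal.ofReal (A * (2 ^ j : ℝ)⁻¹ * (1 / (1 + (l : ℝ) ^ 2)) * D r) :=
        ENNReal.tsum_le_tsum fun l => ENNReal.tsum_le_tsum fun r => hpt l r
    _ = ∑' l : ℤ, ENNReal.ofReal (A * (∑ k, ‖c k‖ ^ 2) * (1 / (1 + (l : ℝ) ^ 2))) := by
        refine tsum_congr fun l => ?_
        rw [tsum_fintype, ← ENNReal.ofReal_sum_of_nonneg fun r _ => by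
          have := hD0 r; positivity, ← Finset.mul_sum, hDsum]
        congr 1
        push_cast
        field_simp
    _ = ENNReal.ofReal (A * (∑ k, ‖c k‖ ^ 2) * Q) := by
        rw [← ENNReal.ofReal_tsum_of_nonneg (fun l => by positivity)
          (summable_inv_one_add_int_sq.mul_left _), tsum_mul_left]
    _ ≤ _ := by
        simp_rw [enorm_sq_eq_ofReal]
        rw [← ENNReal.ofReal_sum_of_nonneg fun k _ => sq_nonneg _,
          ← ENNReal.ofReal_mul (by have := one_le_levelConst m S δ; positivity)]
        refine ENNReal.ofReal_le_ofReal ?_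
        calc A * (∑ k, ‖c k‖ ^ 2) * Q = (6 * ftBound m S δ ^ 2 * Q) * ((2 ^ j : ℝ) ^ (2 * m))⁻¹ *
              ∑ k, ‖c k‖ ^ 2 := by rw [hA]; ring
          _ ≤ _ := by
            gcongr
            rw [levelConst]
            linarith

theorem subsingleton_idx {j : ℤ} (hj : j < 0) : Subsingleton (Idx j) := by
  have : j.toNat = 0 := Int.toNat_of_nonpos hj.le
  rw [Idx, this]
  exact inferInstanceAs (Subsingleton (Fin 1))

/-- The point `0` of the index set. -/
def idxZero (j : ℤ) : Idx j := ⟨0, by positivity⟩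

theorem tsum_dualWeight_le (hm : 1 ≤ m)
    (hψ : MemLp (complexify ψ) 2 (volume : Measure ℝ)) (hW : IsWavelet m S γ δ ψ) (j : ℤ)
    (c : Idx j → ℂ) :
    ∑' n : ℤ, ‖∑ k : Idx j, c k * (dualWeight m n *
        fourierCoeff (perWavelet ψ j (k : ℕ)) n)‖ₑ ^ 2 ≤
      ENNReal.ofReal (levelConst m S δ * ((2 ^ j.toNat : ℝ) ^ (2 * m))⁻¹) * ∑ k, ‖c k‖ₑ ^ 2 := by
  rcases lt_or_ge j 0 with hj | hj
  · have := subsingleton_idx hj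
    have hj0 : j.toNat = 0 := Int.toNat_of_nonpos hj.le
    simp_rw [Fintype.sum_subsingleton _ (idxZero j), perWavelet_neg ψ hj]
    have h1 : ∀ n : ℤ, fourierCoeff (fun _ : UnitAddCircle => (1 : ℂ)) n =
        if n = 0 then 1 else 0 := by
      intro n
      have := fourierCoeff_fourier (T := 1) 0
      have h2 : (fun _ : UnitAddCircle => (1 : ℂ)) = fourier (T := 1) 0 := by
        ext x; simp
      rw [h2, this, Pi.single_apply]
    simp_rw [h1]
    rw [tsum_eq_single 0 fun n hn => by simp [hn]]
    rw [hj0]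
    simp only [if_true, pow_zero, one_pow, inv_one, mul_one, dualWeight]
    simp only [Int.cast_zero, ne_eq, OfNat.ofNat_ne_zero, not_false_eq_true, zero_pow, add_zero,
      one_pow, Real.sqrt_one, inv_one, Complex.ofReal_one, mul_one]
    -- At level −1 only the frequency 0 contributes, with weight 1. The summand 1 in `levelConst`
    -- covers this case.
    refine le_mul_of_one_le_left (by positivity) ?_
    rw [ENNReal.one_le_ofReal]
    exact one_le_levelConst m S δ
  · lift j to ℕ using hj
    exact tsum_dualWeight_natCast_le hm hψ hW j c

end HyperbolicWavelet
end
noncomputable section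
namespace HyperbolicWavelet
open scoped ENNReal InnerProductSpace ComplexConjugate ComplexOrder

variable {m : ℕ} {S γ δ : ℝ} {φ ψ : ℝ → ℝ}

/-! ### Dual wavelets on the circle -/

/-- The class of the dual wavelet in `L₂(𝕋)`. -/
def circleDual (ψ : ℝ → ℝ) (j : ℤ) (k : Idx j) : Lp ℂ 2 (AddCircle.haarAddCircle (T := (1 : ℝ))) :=
  toL2 AddCircle.haarAddCircle (dualWavelet ψ j k)

/-- Level −1 consists of one function of norm 1; hence `min 1 γ`. -/
theorem riesz_lower_circle (hW : IsWavelet m S γ δ ψ) (j : ℤ) (c : Idx j → ℂ) :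
    min 1 γ * ∑ k, ‖c k‖ ^ 2 ≤ ‖∑ k : Idx j, c k • circleWavelet ψ j (k : ℕ)‖ ^ 2 := by
  rcases lt_or_ge j 0 with hj | hj
  · have := subsingleton_idx hj
    simp_rw [Fintype.sum_subsingleton _ (idxZero j), circleWavelet_neg ψ hj]
    have h1 : ‖toL2 AddCircle.haarAddCircle fun _ : UnitAddCircle => (1 : ℂ)‖ ^ 2 = 1 := by
      have := norm_toL2_sq (μ := AddCircle.haarAddCircle (T := (1 : ℝ)))
        (memLp_const (1 : ℂ))
      simp only [map_one, mul_one, integral_const, probReal_univ, one_smul] at this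
      exact_mod_cast this
    rw [norm_smul, mul_pow, h1, mul_one]
    exact mul_le_of_le_one_left (sq_nonneg _) (min_le_left _ _)
  · lift j to ℕ using hj
    exact (mul_le_mul_of_nonneg_right (min_le_right _ _)
      (Finset.sum_nonneg fun _ _ => sq_nonneg _)).trans (hW.riesz_lower j c)

theorem isUnit_gramMatrix (hγ : 0 < γ) (hW : IsWavelet m S γ δ ψ) (j : ℤ) :
    IsUnit (gramMatrix ψ j).det := by
  have hli : LinearIndependent ℂ fun k : Idx j => circleWavelet ψ j (k : ℕ) := by
    rw [Fintype.linearIndependent_iff]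
    intro c hc k
    have h1 := riesz_lower_circle hW j c
    rw [hc, norm_zero, zero_pow two_ne_zero] at h1
    have h2 : ∑ k, ‖c k‖ ^ 2 ≤ 0 :=
      nonpos_of_mul_nonpos_right h1 (lt_min one_pos hγ)
    have h3 := (Finset.single_le_sum (f := fun k => ‖c k‖ ^ 2) (fun _ _ => sq_nonneg _)
      (Finset.mem_univ k)).trans h2
    simpa using le_antisymm h3 (sq_nonneg _)
  exact (Matrix.isUnit_iff_isUnit_det _).1 (Matrix.posDef_gram_of_linearIndependent hli).isUnit

theorem memLp_dualWavelet (hψ : MemLp (complexify ψ) 2 (volume : Measure ℝ))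
    (hW : IsWavelet m S γ δ ψ) (j : ℤ) (k : Idx j) :
    MemLp (dualWavelet ψ j k) 2 AddCircle.haarAddCircle :=
  memLp_finsetSum _ fun l _ => (memLp_perWavelet hψ hW j (l : ℕ)).const_mul _

theorem circleDual_eq_sum (hψ : MemLp (complexify ψ) 2 (volume : Measure ℝ))
    (hW : IsWavelet m S γ δ ψ) (j : ℤ) (k : Idx j) :
    circleDual ψ j k = ∑ l : Idx j, (gramMatrix ψ j)⁻¹ l k • circleWavelet ψ j (l : ℕ) := by
  refine (toL2_sum Finset.univ (f := fun (l : Idx j) t => (gramMatrix ψ j)⁻¹ l k *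
    perWavelet ψ j (l : ℕ) t) fun l _ => (memLp_perWavelet hψ hW j (l : ℕ)).const_mul _).trans ?_
  exact Finset.sum_congr rfl fun l _ => toL2_const_mul (memLp_perWavelet hψ hW j (l : ℕ)) _

theorem inner_circleDual_self (hγ : 0 < γ) (hψ : MemLp (complexify ψ) 2 (volume : Measure ℝ))
    (hW : IsWavelet m S γ δ ψ) (j : ℤ) (k l : Idx j) :
    ⟪circleDual ψ j k, circleWavelet ψ j (l : ℕ)⟫_ℂ = if k = l then 1 else 0 := by
  have hH : (gramMatrix ψ j).IsHermitian := Matrix.isHermitian_gram ℂ _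
  have h1 : ((gramMatrix ψ j)⁻¹ * gramMatrix ψ j) k l = if k = l then 1 else 0 := by
    rw [Matrix.nonsing_inv_mul _ (isUnit_gramMatrix hγ hW j), Matrix.one_apply]
  rw [← h1, circleDual_eq_sum hψ hW, sum_inner, Matrix.mul_apply]
  refine Finset.sum_congr rfl fun i _ => ?_
  -- The first slot conjugates the coefficient; hermiticity of the inverse Gram matrix undoes this.
  rw [inner_smul_left, ← hH.inv.apply k i]
  rfl

theorem inner_circleDual_of_ne (hm : 1 ≤ m) (hS : IsScalingPair φ ψ)
    (hW : IsWavelet m S γ δ ψ) {j j' : ℤ} (hj : -1 ≤ j) (hj' : -1 ≤ j') (h : j ≠ j')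
    (k : Idx j) (l : ℤ) : ⟪circleDual ψ j k, circleWavelet ψ j' l⟫_ℂ = 0 := by
  rw [circleDual_eq_sum hS.memLp_wavelet hW, sum_inner]
  refine Finset.sum_eq_zero fun i _ => ?_
  rw [inner_smul_left, inner_circleWavelet_of_ne hm hS hW hj hj' h, mul_zero]

/-- If b are the coefficients of v in the wavelets, biorthogonality gives b k = ⟨dual k, v⟩. So ‖v‖²
≤ ‖c‖‖b‖, and the lower Riesz bound turns ‖b‖ back into ‖v‖. -/
theorem norm_sum_circleDual_sq_le (hγ : 0 < γ)
    (hψ : MemLp (complexify ψ) 2 (volume : Measure ℝ)) (hW : IsWavelet m S γ δ ψ) (j : ℤ)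
    (c : Idx j → ℂ) :
    ‖∑ k, c k • circleDual ψ j k‖ ^ 2 ≤ (min 1 γ)⁻¹ * ∑ k, ‖c k‖ ^ 2 := by
  have hγ' : 0 < min 1 γ := lt_min one_pos hγ
  set v := ∑ k, c k • circleDual ψ j k with hv
  set b : Idx j → ℂ := fun l => ∑ k, c k * (gramMatrix ψ j)⁻¹ l k with hb
  have hvb : v = ∑ l : Idx j, b l • circleWavelet ψ j (l : ℕ) := by
    simp_rw [hv, circleDual_eq_sum hψ hW, Finset.smul_sum, hb, Finset.sum_smul]
    rw [Finset.sum_comm]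
    simp_rw [smul_smul]
  have hinner : ∀ k, ⟪circleDual ψ j k, v⟫_ℂ = b k := by
    intro k
    rw [hvb, inner_sum]
    simp_rw [inner_smul_right, inner_circleDual_self hγ hψ hW]
    simp
  have h1 := norm_inner_sum_smul_sq_le Finset.univ c (circleDual ψ j) v
  rw [← hv, inner_self_eq_norm_sq_to_K] at h1
  simp_rw [hinner] at h1
  have h2 := riesz_lower_circle hW j b
  rw [← hvb] at h2
  have h3 : ‖v‖ ^ 2 * ‖v‖ ^ 2 ≤ (∑ k, ‖c k‖ ^ 2) * ∑ k, ‖b k‖ ^ 2 := by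
    refine le_trans (le_of_eq ?_) h1
    rw [norm_pow, RCLike.norm_ofReal, abs_of_nonneg (norm_nonneg _)]
    ring
  have h4 : ∑ k, ‖b k‖ ^ 2 ≤ (min 1 γ)⁻¹ * ‖v‖ ^ 2 := by
    rw [inv_mul_eq_div, le_div_iff₀ hγ', mul_comm]
    exact h2
  have hc0 : 0 ≤ ∑ k, ‖c k‖ ^ 2 := Finset.sum_nonneg fun _ _ => sq_nonneg _
  rcases (sq_nonneg ‖v‖).eq_or_lt with h0 | h0
  · rw [← h0]; positivity
  · refine le_of_mul_le_mul_right ?_ h0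
    calc _ ≤ _ := h3
      _ ≤ (∑ k, ‖c k‖ ^ 2) * ((min 1 γ)⁻¹ * ‖v‖ ^ 2) := by gcongr
      _ = _ := by ring

theorem tsum_enorm_repr_sq {ι E : Type*} [NormedAddCommGroup E] [InnerProductSpace ℂ E]
    (b : HilbertBasis ι ℂ E) (f : E) :
    ∑' i, ‖b.repr f i‖ₑ ^ 2 = ‖f‖ₑ ^ 2 := by
  simp_rw [enorm_sq_eq_ofReal]
  have h := b.hasSum_inner_mul_inner f f
  have h' := RCLike.hasSum_re ℂ h
  rw [inner_self_eq_norm_sq] at h'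
  have e : ∀ i, RCLike.re (⟪f, b i⟫_ℂ * ⟪b i, f⟫_ℂ) = ‖b.repr f i‖ ^ 2 := by
    intro i
    rw [b.repr_apply_apply, ← inner_conj_symm f (b i), RCLike.conj_mul]
    norm_cast
  simp_rw [e] at h'
  rw [← ENNReal.ofReal_tsum_of_nonneg (fun _ => sq_nonneg _) h'.summable, h'.tsum_eq]

/-- The preceding bound after Parseval, in the form that `tsum_enorm_sq_tensor_le` takes as input.
-/
theorem tsum_circleDual_le (hγ : 0 < γ)
    (hψ : MemLp (complexify ψ) 2 (volume : Measure ℝ)) (hW : IsWavelet m S γ δ ψ) (j : ℤ)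
    (c : Idx j → ℂ) :
    ∑' n : ℤ, ‖∑ k, c k * fourierCoeff (dualWavelet ψ j k) n‖ₑ ^ 2 ≤
      ENNReal.ofReal (min 1 γ)⁻¹ * ∑ k, ‖c k‖ₑ ^ 2 := by
  have h1 : ∀ n : ℤ, ∑ k, c k * fourierCoeff (dualWavelet ψ j k) n =
      fourierBasis.repr (∑ k, c k • circleDual ψ j k) n := by
    intro n
    rw [map_sum, lp.coeFn_sum, Finset.sum_apply]
    refine Finset.sum_congr rfl fun k _ => ?_
    rw [map_smul, lp.coeFn_smul, Pi.smul_apply, smul_eq_mul, fourierBasis_repr]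
    congr 1
    exact (congrFun (fourierCoeff_congr_ae (coeFn_toL2 (memLp_dualWavelet hψ hW j k))) n).symm
  simp_rw [h1]
  rw [tsum_enorm_repr_sq]
  simp_rw [enorm_sq_eq_ofReal]
  have hγ' : 0 < min 1 γ := lt_min one_pos hγ
  rw [← ENNReal.ofReal_sum_of_nonneg fun k _ => sq_nonneg _, ← ENNReal.ofReal_mul (by positivity)]
  exact ENNReal.ofReal_le_ofReal (norm_sum_circleDual_sq_le hγ hψ hW j c)

/-! ### Tensor products of functions on the circle -/

section Tensor

variable {d : ℕ}

theorem memLp_tensor {f : Fin d → UnitAddCircle → ℂ}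
    (hf : ∀ i, MemLp (f i) 2 AddCircle.haarAddCircle) :
    MemLp (fun x : UnitAddTorus (Fin d) => ∏ i, f i (x i)) 2 (torusMeasure d) := by
  rw [memLp_two_iff_integrable_sq_norm]
  · simp_rw [norm_prod, ← Finset.prod_pow]
    exact Integrable.fintype_prod (f := fun i t => ‖f i t‖ ^ 2) fun i =>
      (memLp_two_iff_integrable_sq_norm (hf i).1).1 (hf i)
  · exact Finset.aestronglyMeasurable_fun_prod _ fun i _ =>
      (hf i).1.comp_quasiMeasurePreserving (Measure.quasiMeasurePreserving_eval _ i)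

theorem inner_tensor {f g : Fin d → UnitAddCircle → ℂ}
    (hf : ∀ i, MemLp (f i) 2 AddCircle.haarAddCircle)
    (hg : ∀ i, MemLp (g i) 2 AddCircle.haarAddCircle) :
    ⟪toL2 (torusMeasure d) fun x => ∏ i, f i (x i),
      toL2 (torusMeasure d) fun x => ∏ i, g i (x i)⟫_ℂ =
      ∏ i, ⟪toL2 AddCircle.haarAddCircle (f i), toL2 AddCircle.haarAddCircle (g i)⟫_ℂ := by
  rw [inner_toL2 (memLp_tensor hf) (memLp_tensor hg)]
  simp_rw [fun i => inner_toL2 (hf i) (hg i), map_prod, ← Finset.prod_mul_distrib]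
  exact integral_fintype_prod_eq_prod fun i t => conj (f i t) * g i t

theorem toL2_tensor_congr {f g : Fin d → UnitAddCircle → ℂ}
    (hf : ∀ i, MemLp (f i) 2 AddCircle.haarAddCircle)
    (h : ∀ i, f i =ᵐ[AddCircle.haarAddCircle] g i) :
    toL2 (torusMeasure d) (fun x => ∏ i, f i (x i)) =
      toL2 (torusMeasure d) fun x => ∏ i, g i (x i) := by
  refine toL2_congr (memLp_tensor hf) ?_
  have : ∀ i, ∀ᵐ x ∂torusMeasure d, f i (x i) = g i (x i) := fun i =>
    (Measure.quasiMeasurePreserving_eval _ i).ae_eq_comp (h i)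
  filter_upwards [ae_all_iff.2 this] with x hx
  exact Finset.prod_congr rfl fun i _ => hx i

/-- The tensor product of `d` elements of `L₂(𝕋)`. -/
def tensor (u : Fin d → Lp ℂ 2 (AddCircle.haarAddCircle (T := (1 : ℝ)))) : L2Torus d :=
  toL2 (torusMeasure d) fun x => ∏ i, u i (x i)

theorem tensor_toL2 {f : Fin d → UnitAddCircle → ℂ}
    (hf : ∀ i, MemLp (f i) 2 AddCircle.haarAddCircle) :
    tensor (fun i => toL2 AddCircle.haarAddCircle (f i)) =
      toL2 (torusMeasure d) fun x => ∏ i, f i (x i) :=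
  toL2_tensor_congr (fun _ => Lp.memLp _) fun i => coeFn_toL2 (hf i)

theorem inner_tensor_tensor (u v : Fin d → Lp ℂ 2 (AddCircle.haarAddCircle (T := (1 : ℝ)))) :
    ⟪tensor u, tensor v⟫_ℂ = ∏ i, ⟪u i, v i⟫_ℂ := by
  rw [tensor, tensor, inner_tensor (fun _ => Lp.memLp _) fun _ => Lp.memLp _]
  simp_rw [toL2_coeFn]

theorem norm_tensor (u : Fin d → Lp ℂ 2 (AddCircle.haarAddCircle (T := (1 : ℝ)))) :
    ‖tensor u‖ = ∏ i, ‖u i‖ := by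
  have h : ((‖tensor u‖ ^ 2 : ℝ) : ℂ) = (((∏ i, ‖u i‖) ^ 2 : ℝ) : ℂ) := by
    have := inner_tensor_tensor u u
    simp_rw [inner_self_eq_norm_sq_to_K] at this
    rw [← Finset.prod_pow]
    push_cast
    exact this
  exact (pow_left_inj₀ (norm_nonneg _) (Finset.prod_nonneg fun _ _ => norm_nonneg _)
    two_ne_zero).1 (Complex.ofReal_injective h)

theorem tensor_update_ae {u : Fin d → Lp ℂ 2 (AddCircle.haarAddCircle (T := (1 : ℝ)))}
    (i : Fin d) {v : Lp ℂ 2 (AddCircle.haarAddCircle (T := (1 : ℝ)))} {f : UnitAddCircle → ℂ}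
    (h : v =ᵐ[AddCircle.haarAddCircle] f) :
    tensor (Function.update u i v) =ᵐ[torusMeasure d]
      fun x => f (x i) * ∏ j ∈ Finset.univ.erase i, u j (x j) := by
  refine (coeFn_toL2 (memLp_tensor fun _ => Lp.memLp _)).trans ?_
  filter_upwards [(Measure.quasiMeasurePreserving_eval
    (fun _ : Fin d => AddCircle.haarAddCircle (T := (1 : ℝ))) i).ae_eq_comp h] with x hx
  rw [← Finset.mul_prod_erase _ _ (Finset.mem_univ i)]
  simp only [Function.comp_apply, Function.eval] at hx
  rw [Function.update_self, hx]
  congr 1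
  refine Finset.prod_congr rfl fun j hj => ?_
  rw [Function.update_of_ne (Finset.ne_of_mem_erase hj)]

/-- The tensor product as a function of its `i`-th factor. -/
def tensorSlot (u : Fin d → Lp ℂ 2 (AddCircle.haarAddCircle (T := (1 : ℝ)))) (i : Fin d) :
    Lp ℂ 2 (AddCircle.haarAddCircle (T := (1 : ℝ))) →L[ℂ] L2Torus d :=
  LinearMap.mkContinuous
    { toFun := fun v => tensor (Function.update u i v)
      map_add' := fun v w => by
        refine Lp.ext ?_
        filter_upwards [tensor_update_ae (u := u) i (Lp.coeFn_add v w),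
          tensor_update_ae (u := u) i (Filter.EventuallyEq.refl _ v),
          tensor_update_ae (u := u) i (Filter.EventuallyEq.refl _ w),
          Lp.coeFn_add (tensor (Function.update u i v)) (tensor (Function.update u i w))]
          with x h1 h2 h3 h4
        rw [h1, h4, Pi.add_apply, Pi.add_apply, h2, h3, add_mul]
      map_smul' := fun c v => by
        refine Lp.ext ?_
        filter_upwards [tensor_update_ae (u := u) i (Lp.coeFn_smul c v),
          tensor_update_ae (u := u) i (Filter.EventuallyEq.refl _ v),
          Lp.coeFn_smul c (tensor (Function.update u i v))] with x h1 h2 h3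
        rw [RingHom.id_apply, h1, h3, Pi.smul_apply, Pi.smul_apply, h2, smul_eq_mul, smul_eq_mul,
          mul_assoc] }
    (∏ j ∈ Finset.univ.erase i, ‖u j‖) fun v => by
      change ‖tensor (Function.update u i v)‖ ≤ _
      rw [norm_tensor, ← Finset.mul_prod_erase _ _ (Finset.mem_univ i), Function.update_self,
        mul_comm]
      refine le_of_eq (congrArg (· * ‖v‖) (Finset.prod_congr rfl fun j hj => ?_))
      rw [Function.update_of_ne (Finset.ne_of_mem_erase hj)]

theorem tensorSlot_apply (u : Fin d → Lp ℂ 2 (AddCircle.haarAddCircle (T := (1 : ℝ)))) (i : Fin d)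
    (v : Lp ℂ 2 (AddCircle.haarAddCircle (T := (1 : ℝ)))) :
    tensorSlot u i v = tensor (Function.update u i v) := rfl

/-- Tensor products of total sets are total. -/
theorem tensor_mem_of_total {X : Set (Lp ℂ 2 (AddCircle.haarAddCircle (T := (1 : ℝ))))}
    (hX : (Submodule.span ℂ X).topologicalClosure = ⊤) {E : Submodule ℂ (L2Torus d)}
    (hE : IsClosed (E : Set (L2Torus d))) (h : ∀ u, (∀ i, u i ∈ X) → tensor u ∈ E)
    (u : Fin d → Lp ℂ 2 (AddCircle.haarAddCircle (T := (1 : ℝ)))) : tensor u ∈ E := by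
  -- `I` is the set of slots that may hold arbitrary vectors. Slots are freed one at a time, using
  -- continuity and linearity in the slot.
  have key : ∀ (I : Finset (Fin d)) (u : Fin d → Lp ℂ 2 (AddCircle.haarAddCircle (T := (1 : ℝ)))),
      (∀ i, i ∉ I → u i ∈ X) → tensor u ∈ E := by
    intro I
    induction I using Finset.induction_on with
    | empty => exact fun u hu => h u fun i => hu i (Finset.notMem_empty i)
    | insert i I _ ih =>
      intro u hu
      have h1 : (Submodule.span ℂ X).topologicalClosure ≤ E.comap (tensorSlot u i).toLinearMap := by
        refine Submodule.topologicalClosure_minimal _ (Submodule.span_le.2 fun v hv => ?_)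
          (hE.preimage (tensorSlot u i).continuous)
        refine ih _ fun l hl => ?_
        by_cases hli : l = i
        · subst hli
          rwa [Function.update_self]
        · rw [Function.update_of_ne hli]
          exact hu l (by simp [hli, hl])
      rw [hX] at h1
      have h2 : tensorSlot u i (u i) ∈ E := h1 (Submodule.mem_top (x := u i))
      rwa [tensorSlot_apply, Function.update_eq_self] at h2
  exact key Finset.univ u fun i hi => absurd (Finset.mem_univ i) hi

theorem tensor_fourierLp (n : Fin d → ℤ) :
    tensor (fun i => fourierLp 2 (n i)) = UnitAddTorus.mFourierLp 2 n := by
  have hmem : ∀ l : ℤ, MemLp (fourier (T := 1) l) 2 AddCircle.haarAddCircle := fun l =>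
    (memLp_top_of_bound (by fun_prop) 1 (Filter.Eventually.of_forall fun x => by
      rw [fourier_apply, Circle.norm_coe])).mono_exponent le_top
  refine (toL2_tensor_congr (fun _ => Lp.memLp _) fun i => coeFn_fourierLp 2 (n i)).trans ?_
  refine Lp.ext ((coeFn_toL2 (memLp_tensor fun i => hmem (n i))).trans ?_)
  exact (UnitAddTorus.coeFn_mFourierLp 2 n).symm

theorem mFourierCoeff_tensor {f : Fin d → UnitAddCircle → ℂ}
    (hf : ∀ i, MemLp (f i) 2 AddCircle.haarAddCircle) (n : Fin d → ℤ) :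
    UnitAddTorus.mFourierCoeff (toL2 (torusMeasure d) fun x => ∏ i, f i (x i)) n =
      ∏ i, fourierCoeff (f i) (n i) := by
  change ∫ t, UnitAddTorus.mFourier (-n) t •
    (toL2 (torusMeasure d) fun x => ∏ i, f i (x i)) t ∂torusMeasure d = _
  refine Eq.trans ?_ (integral_fintype_prod_eq_prod (μ := fun _ => AddCircle.haarAddCircle)
    fun (i : Fin d) (t : UnitAddCircle) => fourier (-(n i)) t • f i t)
  refine integral_congr_ae ?_
  filter_upwards [coeFn_toL2 (memLp_tensor hf)] with x hx
  rw [hx, Finset.prod_smul]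
  rfl

end Tensor

end HyperbolicWavelet
end
noncomputable section
namespace HyperbolicWavelet
open scoped ENNReal InnerProductSpace ComplexConjugate

variable {d m : ℕ} {S γ δ : ℝ} {φ ψ : ℝ → ℝ}

/-! ### Tensor product wavelets -/

theorem inner_tensorDual_self (hγ : 0 < γ) (hψ : MemLp (complexify ψ) 2 (volume : Measure ℝ))
    (hW : IsWavelet m S γ δ ψ) (j : Fin d → ℤ) (k l : MultiIdx j) :
    ⟪tensorDual ψ j k, tensorWavelet ψ j l⟫_ℂ = if k = l then 1 else 0 := by
  rw [tensorDual, tensorWavelet, inner_tensor (fun i => memLp_dualWavelet hψ hW (j i) (k i))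
    fun i => memLp_perWavelet hψ hW (j i) (l i : ℕ)]
  have h : ∀ i, ⟪toL2 AddCircle.haarAddCircle (dualWavelet ψ (j i) (k i)),
      toL2 AddCircle.haarAddCircle (perWavelet ψ (j i) (l i : ℕ))⟫_ℂ =
      if k i = l i then 1 else 0 := fun i => inner_circleDual_self hγ hψ hW (j i) (k i) (l i)
  simp_rw [h, Fintype.prod_ite_zero, Finset.prod_const_one]
  exact if_congr funext_iff.symm rfl rfl

theorem inner_tensorDual_of_ne (hm : 1 ≤ m) (hS : IsScalingPair φ ψ)
    (hW : IsWavelet m S γ δ ψ) {j j' : Fin d → ℤ} (hj : ∀ i, -1 ≤ j i) (hj' : ∀ i, -1 ≤ j' i)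
    (h : j ≠ j') (k : MultiIdx j) (l : MultiIdx j') :
    ⟪tensorDual ψ j k, tensorWavelet ψ j' l⟫_ℂ = 0 := by
  rw [tensorDual, tensorWavelet,
    inner_tensor (fun i => memLp_dualWavelet hS.memLp_wavelet hW (j i) (k i))
    fun i => memLp_perWavelet hS.memLp_wavelet hW (j' i) (l i : ℕ)]
  obtain ⟨i, hi⟩ := Function.ne_iff.1 h
  exact Finset.prod_eq_zero (Finset.mem_univ i)
    (inner_circleDual_of_ne hm hS hW (hj i) (hj' i) hi (k i) (l i : ℕ))

theorem inner_tensorWavelet_of_ne (hm : 1 ≤ m) (hS : IsScalingPair φ ψ)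
    (hW : IsWavelet m S γ δ ψ) {j j' : Fin d → ℤ} (hj : ∀ i, -1 ≤ j i) (hj' : ∀ i, -1 ≤ j' i)
    (h : j ≠ j') (k : MultiIdx j) (l : MultiIdx j') :
    ⟪tensorWavelet ψ j k, tensorWavelet ψ j' l⟫_ℂ = 0 := by
  rw [tensorWavelet, tensorWavelet,
    inner_tensor (fun i => memLp_perWavelet hS.memLp_wavelet hW (j i) (k i : ℕ))
    fun i => memLp_perWavelet hS.memLp_wavelet hW (j' i) (l i : ℕ)]
  obtain ⟨i, hi⟩ := Function.ne_iff.1 h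
  exact Finset.prod_eq_zero (Finset.mem_univ i)
    (inner_circleWavelet_of_ne hm hS hW (hj i) (hj' i) hi _ _)

/-- The system of all tensor product wavelets. -/
def waveletSet (d : ℕ) (ψ : ℝ → ℝ) : Set (L2Torus d) :=
  {w | ∃ j : Fin d → ℤ, (∀ i, -1 ≤ j i) ∧ ∃ k : MultiIdx j, tensorWavelet ψ j k = w}

/-- The system of the constant function and the periodized wavelets. -/
def circleSet (ψ : ℝ → ℝ) : Set (Lp ℂ 2 (AddCircle.haarAddCircle (T := (1 : ℝ)))) :=
  {v | ∃ j : ℤ, -1 ≤ j ∧ ∃ k : Idx j, circleWavelet ψ j (k : ℕ) = v}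

theorem span_circleWavelet_dense (hm : 1 ≤ m) (hγ : 0 < γ) (hS : IsScalingPair φ ψ)
    (hW : IsWavelet m S γ δ ψ) :
    (Submodule.span ℂ (circleSet ψ)).topologicalClosure = ⊤ := by
  rw [Submodule.topologicalClosure_eq_top_iff, Submodule.eq_bot_iff]
  intro h hh
  refine eq_zero_of_inner_circleWavelet_eq_zero hm hγ hS hW h fun j hj k => ?_
  have h1 : circleWavelet ψ j (k : ℕ) ∈ circleSet ψ := ⟨j, hj, k, rfl⟩
  exact Submodule.inner_right_of_mem_orthogonal (Submodule.subset_span h1) hh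

/-- Totality on the circle puts every elementary tensor into the closed span; the characters of 𝕋^d
are such tensors and are total. -/
theorem span_waveletSet_dense (hm : 1 ≤ m) (hγ : 0 < γ) (hS : IsScalingPair φ ψ)
    (hW : IsWavelet m S γ δ ψ) :
    (Submodule.span ℂ (waveletSet d ψ)).topologicalClosure = ⊤ := by
  have h1 : ∀ u, tensor u ∈ (Submodule.span ℂ (waveletSet d ψ)).topologicalClosure := by
    intro u
    refine tensor_mem_of_total (span_circleWavelet_dense hm hγ hS hW)
      (Submodule.isClosed_topologicalClosure _) (fun u hu => ?_) u
    have hu' : ∀ i, ∃ j : ℤ, -1 ≤ j ∧ ∃ k : Idx j, circleWavelet ψ j (k : ℕ) = u i := hu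
    choose j hj k hk using hu'
    refine Submodule.le_topologicalClosure _ (Submodule.subset_span ⟨j, hj, k, ?_⟩)
    rw [tensorWavelet, ← tensor_toL2 fun i => memLp_perWavelet hS.memLp_wavelet hW _ _]
    exact congrArg tensor (funext hk)
  rw [eq_top_iff, ← UnitAddTorus.span_mFourierLp_closure_eq_top (d := Fin d) (p := 2) (by simp)]
  refine Submodule.topologicalClosure_minimal _ (Submodule.span_le.2 ?_)
    (Submodule.isClosed_topologicalClosure _)
  rintro _ ⟨n, rfl⟩
  rw [← tensor_fourierLp]
  exact h1 _

/-- The part of `P_n` belonging to one level. -/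
def levelOp (ψ : ℝ → ℝ) (j : Fin d → ℤ) : L2Torus d →L[ℂ] L2Torus d :=
  ∑ k : MultiIdx j, (innerSL ℂ (tensorDual ψ j k)).smulRight (tensorWavelet ψ j k)

theorem waveletProj_eq_sum (d : ℕ) (ψ : ℝ → ℝ) (n : ℕ) :
    waveletProj d ψ n = ∑ j ∈ levels d n, levelOp ψ j := rfl

theorem levelOp_apply (ψ : ℝ → ℝ) (j : Fin d → ℤ) (f : L2Torus d) :
    levelOp ψ j f = ∑ k : MultiIdx j, ⟪tensorDual ψ j k, f⟫_ℂ • tensorWavelet ψ j k := by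
  simp [levelOp]

theorem levelOp_tensorWavelet_self (hγ : 0 < γ)
    (hψ : MemLp (complexify ψ) 2 (volume : Measure ℝ)) (hW : IsWavelet m S γ δ ψ) (j : Fin d → ℤ)
    (k : MultiIdx j) : levelOp ψ j (tensorWavelet ψ j k) = tensorWavelet ψ j k := by
  rw [levelOp_apply]
  simp_rw [inner_tensorDual_self hγ hψ hW]
  simp

theorem levelOp_tensorWavelet_of_ne (hm : 1 ≤ m) (hS : IsScalingPair φ ψ)
    (hW : IsWavelet m S γ δ ψ) {j j' : Fin d → ℤ} (hj : ∀ i, -1 ≤ j i) (hj' : ∀ i, -1 ≤ j' i)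
    (h : j ≠ j') (l : MultiIdx j') : levelOp ψ j (tensorWavelet ψ j' l) = 0 := by
  rw [levelOp_apply]
  simp_rw [inner_tensorDual_of_ne hm hS hW hj hj' h]
  simp

theorem inner_tensorWavelet_levelOp_of_ne (hm : 1 ≤ m) (hS : IsScalingPair φ ψ)
    (hW : IsWavelet m S γ δ ψ) {j j' : Fin d → ℤ} (hj : ∀ i, -1 ≤ j i) (hj' : ∀ i, -1 ≤ j' i)
    (h : j ≠ j') (k : MultiIdx j) (f : L2Torus d) :
    ⟪tensorWavelet ψ j k, levelOp ψ j' f⟫_ℂ = 0 := by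
  rw [levelOp_apply, inner_sum]
  refine Finset.sum_eq_zero fun l _ => ?_
  rw [inner_smul_right, inner_tensorWavelet_of_ne hm hS hW hj hj' h, mul_zero]

theorem inner_levelOp_levelOp_of_ne (hm : 1 ≤ m) (hS : IsScalingPair φ ψ)
    (hW : IsWavelet m S γ δ ψ) {j j' : Fin d → ℤ} (hj : ∀ i, -1 ≤ j i) (hj' : ∀ i, -1 ≤ j' i)
    (h : j ≠ j') (f g : L2Torus d) : ⟪levelOp ψ j f, levelOp ψ j' g⟫_ℂ = 0 := by
  rw [levelOp_apply, sum_inner]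
  refine Finset.sum_eq_zero fun l _ => ?_
  rw [inner_smul_left, inner_tensorWavelet_levelOp_of_ne hm hS hW hj hj' h, mul_zero]

/-- `f` and its level-`𝐣` part have the same inner products with the wavelets of level `𝐣`. -/
theorem inner_tensorWavelet_levelOp (hm : 1 ≤ m) (hγ : 0 < γ) (hS : IsScalingPair φ ψ)
    (hW : IsWavelet m S γ δ ψ) {j : Fin d → ℤ} (hj : ∀ i, -1 ≤ j i) (k : MultiIdx j)
    (f : L2Torus d) :
    ⟪tensorWavelet ψ j k, levelOp ψ j f⟫_ℂ = ⟪tensorWavelet ψ j k, f⟫_ℂ := by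
  -- T measures the difference of the two sides. It is continuous and kills every tensor wavelet,
  -- hence vanishes by completeness.
  set T : L2Torus d →L[ℂ] ℂ :=
    (innerSL ℂ (tensorWavelet ψ j k)).comp (levelOp ψ j) - innerSL ℂ (tensorWavelet ψ j k) with hT
  have h1 : (Submodule.span ℂ (waveletSet d ψ)).topologicalClosure ≤ T.ker := by
    refine Submodule.topologicalClosure_minimal _ (Submodule.span_le.2 ?_) T.isClosed_ker
    rintro _ ⟨j', hj', l, rfl⟩
    change T _ = 0
    simp only [hT, sub_apply, ContinuousLinearMap.comp_apply, innerSL_apply_apply]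
    by_cases h : j = j'
    · subst h
      rw [levelOp_tensorWavelet_self hγ hS.memLp_wavelet hW, sub_self]
    · rw [levelOp_tensorWavelet_of_ne hm hS hW hj hj' h,
        inner_tensorWavelet_of_ne hm hS hW hj hj' h, inner_zero_right, sub_zero]
  rw [span_waveletSet_dense hm hγ hS hW] at h1
  have h2 : T f = 0 := h1 (Submodule.mem_top (x := f))
  simpa only [hT, sub_apply, ContinuousLinearMap.comp_apply, innerSL_apply_apply,
    sub_eq_zero] using h2

theorem tsum_enorm_mFourierCoeff_sq (f : L2Torus d) :
    ∑' n, ‖UnitAddTorus.mFourierCoeff f n‖ₑ ^ 2 = ‖f‖ₑ ^ 2 := by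
  have h := tsum_enorm_repr_sq (UnitAddTorus.mFourierBasis (d := Fin d)) f
  simp_rw [UnitAddTorus.mFourierBasis_repr] at h
  exact h

theorem mFourierCoeff_sum_smul {ι : Type*} (s : Finset ι) (c : ι → ℂ) (x : ι → L2Torus d)
    (n : Fin d → ℤ) : UnitAddTorus.mFourierCoeff (∑ i ∈ s, c i • x i : L2Torus d) n =
      ∑ i ∈ s, c i * UnitAddTorus.mFourierCoeff (x i) n := by
  have h : ∀ f : L2Torus d, UnitAddTorus.mFourierCoeff f n =
      (UnitAddTorus.mFourierBasis (d := Fin d)).repr f n := fun f =>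
    (UnitAddTorus.mFourierBasis_repr f n).symm
  simp_rw [h]
  rw [map_sum, lp.coeFn_sum, Finset.sum_apply]
  refine Finset.sum_congr rfl fun i _ => ?_
  rw [map_smul, lp.coeFn_smul, Pi.smul_apply, smul_eq_mul]

/-- Fourier coefficients of tensors factor, so the bound on the circle tensorizes and Parseval on
𝕋^d returns it to the L₂ norm. -/
theorem norm_sum_tensorDual_sq_le (hγ : 0 < γ)
    (hψ : MemLp (complexify ψ) 2 (volume : Measure ℝ)) (hW : IsWavelet m S γ δ ψ)
    (j : Fin d → ℤ) (c : MultiIdx j → ℂ) :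
    ‖∑ k, c k • tensorDual ψ j k‖ ^ 2 ≤ ((min 1 γ)⁻¹) ^ d * ∑ k, ‖c k‖ ^ 2 := by
  have hγ' : 0 < min 1 γ := lt_min one_pos hγ
  have h := tsum_enorm_sq_tensor_le (fun i (k : Idx (j i)) n => fourierCoeff
    (dualWavelet ψ (j i) k) n) _ (fun i c => tsum_circleDual_le hγ hψ hW (j i) c) c
  have h2 : ∀ n : Fin d → ℤ, ∑ k : MultiIdx j, c k *
      ∏ i, fourierCoeff (dualWavelet ψ (j i) (k i)) (n i) =
      UnitAddTorus.mFourierCoeff (∑ k, c k • tensorDual ψ j k : L2Torus d) n := by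
    intro n
    rw [mFourierCoeff_sum_smul]
    refine Finset.sum_congr rfl fun k _ => ?_
    rw [tensorDual, mFourierCoeff_tensor fun i => memLp_dualWavelet hψ hW (j i) (k i)]
  simp_rw [h2] at h
  rw [tsum_enorm_mFourierCoeff_sq, Finset.prod_const, Finset.card_univ, Fintype.card_fin] at h
  simp_rw [enorm_sq_eq_ofReal] at h
  rw [← ENNReal.ofReal_sum_of_nonneg fun k _ => sq_nonneg _, ← ENNReal.ofReal_pow (by positivity),
    ← ENNReal.ofReal_mul (by positivity)] at h
  exact (ENNReal.ofReal_le_ofReal_iff (mul_nonneg (by positivity)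
    (Finset.sum_nonneg fun _ _ => sq_nonneg _))).1 h

theorem summable_and_tsum_le_of_tsum_ofReal_le {ι : Type*} {a : ι → ℝ} (ha : ∀ i, 0 ≤ a i) {X : ℝ}
    (hX : 0 ≤ X) (h : ∑' i, ENNReal.ofReal (a i) ≤ ENNReal.ofReal X) :
    Summable a ∧ ∑' i, a i ≤ X := by
  have hne : ∑' i, ENNReal.ofReal (a i) ≠ ∞ := (h.trans_lt ENNReal.ofReal_lt_top).ne
  have hs : Summable a := by
    have := ENNReal.summable_toReal hne
    simpa only [ENNReal.toReal_ofReal (ha _)] using this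
  refine ⟨hs, ?_⟩
  rw [← ENNReal.ofReal_tsum_of_nonneg ha hs] at h
  exact (ENNReal.ofReal_le_ofReal_iff hX).1 h

/-- The pairing of H^m_mix with its dual: Cauchy–Schwarz in the Fourier coefficients with the weight
w and its inverse, where the weighted sum for v is the tensorized single-scale estimate. -/
theorem norm_inner_sum_tensorWavelet_sq_le (hm : 1 ≤ m)
    (hψ : MemLp (complexify ψ) 2 (volume : Measure ℝ)) (hW : IsWavelet m S γ δ ψ)
    (j : Fin d → ℤ) (c : MultiIdx j → ℂ) {f : L2Torus d} (hf : MemHMix m f) :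
    ‖⟪f, ∑ k, c k • tensorWavelet ψ j k⟫_ℂ‖ ^ 2 ≤
      hMixNorm m f ^ 2 * ((levelConst m S δ ^ d *
        (((2 : ℝ) ^ ∑ i, (j i).toNat) ^ (2 * m))⁻¹) * ∑ k, ‖c k‖ ^ 2) := by
  set v : L2Torus d := ∑ k, c k • tensorWavelet ψ j k with hv
  set w : (Fin d → ℤ) → ℝ := fun n => ∏ i, dualWeight m (n i) with hw
  set X := (levelConst m S δ ^ d * (((2 : ℝ) ^ ∑ i, (j i).toNat) ^ (2 * m))⁻¹) *
    ∑ k, ‖c k‖ ^ 2 with hX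
  have hL : 0 ≤ levelConst m S δ := zero_le_one.trans (one_le_levelConst m S δ)
  have hX0 : 0 ≤ X := mul_nonneg (by positivity) (Finset.sum_nonneg fun _ _ => sq_nonneg _)
  have hvn : ∀ n, ∑ k : MultiIdx j, c k * ∏ i, ((dualWeight m (n i) : ℂ) *
      fourierCoeff (perWavelet ψ (j i) (k i : ℕ)) (n i)) =
      w n * UnitAddTorus.mFourierCoeff v n := by
    intro n
    rw [hv, mFourierCoeff_sum_smul, Finset.mul_sum]
    refine Finset.sum_congr rfl fun k _ => ?_
    rw [tensorWavelet, mFourierCoeff_tensor fun i => memLp_perWavelet hψ hW (j i) (k i : ℕ),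
      Finset.prod_mul_distrib, hw]
    push_cast
    ring
  have hb : Summable (fun n => (w n * ‖UnitAddTorus.mFourierCoeff v n‖) ^ 2) ∧
      ∑' n, (w n * ‖UnitAddTorus.mFourierCoeff v n‖) ^ 2 ≤ X := by
    refine summable_and_tsum_le_of_tsum_ofReal_le (fun _ => sq_nonneg _) hX0 ?_
    have h := tsum_enorm_sq_tensor_le (fun i (k : Idx (j i)) n => (dualWeight m n : ℂ) *
      fourierCoeff (perWavelet ψ (j i) (k : ℕ)) n) _
      (fun i c => tsum_dualWeight_le hm hψ hW (j i) c) c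
    simp_rw [hvn, enorm_sq_eq_ofReal, norm_mul, Complex.norm_real, mul_pow, Real.norm_eq_abs,
      sq_abs] at h
    simp_rw [mul_pow]
    refine h.trans (le_of_eq ?_)
    rw [← ENNReal.ofReal_sum_of_nonneg fun k _ => sq_nonneg _,
      ← ENNReal.ofReal_prod_of_nonneg fun i _ => by positivity,
      ← ENNReal.ofReal_mul (Finset.prod_nonneg fun i _ => by positivity), Finset.prod_mul_distrib,
      Finset.prod_const, Finset.card_univ, Fintype.card_fin, Finset.prod_inv_distrib,
      Finset.prod_pow, Finset.prod_pow_eq_pow_sum]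
  have hmix0 : ∀ n, 0 ≤ mixTerm m f n := fun n => by rw [mixTerm]; positivity
  have hw0 : ∀ n, 0 ≤ w n := fun n => Finset.prod_nonneg fun i _ => by
    rw [dualWeight]; positivity
  have hab : ∀ n, Real.sqrt (mixTerm m f n) * (w n * ‖UnitAddTorus.mFourierCoeff v n‖) =
      ‖UnitAddTorus.mFourierCoeff f n‖ * ‖UnitAddTorus.mFourierCoeff v n‖ := by
    intro n
    refine (pow_left_inj₀ (mul_nonneg (Real.sqrt_nonneg _) (mul_nonneg (hw0 n) (norm_nonneg _)))
      (by positivity) two_ne_zero).1 ?_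
    have hw2 : (∏ i, (1 + (n i : ℝ) ^ 2) ^ m) * w n ^ 2 = 1 := by
      simp only [hw]
      rw [← Finset.prod_pow, ← Finset.prod_mul_distrib]
      refine Finset.prod_eq_one fun i _ => ?_
      rw [dualWeight_sq, mul_inv_cancel₀ (by positivity)]
    rw [mul_pow, Real.sq_sqrt (hmix0 n), mixTerm]
    calc _ = (‖UnitAddTorus.mFourierCoeff f n‖ * ‖UnitAddTorus.mFourierCoeff v n‖) ^ 2 *
          ((∏ i, (1 + (n i : ℝ) ^ 2) ^ m) * w n ^ 2) := by ring
      _ = _ := by rw [hw2, mul_one]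
  have hsq : ∀ n, Real.sqrt (mixTerm m f n) ^ 2 = mixTerm m f n := fun n => Real.sq_sqrt (hmix0 n)
  have hCS := Real.summable_and_inner_le_Lp_mul_Lq_tsum_of_nonneg Real.HolderConjugate.two_two
    (fun n => Real.sqrt_nonneg (mixTerm m f n))
    (fun n => mul_nonneg (hw0 n) (norm_nonneg (UnitAddTorus.mFourierCoeff v n)))
    (by simp only [Real.rpow_two, hsq]; exact hf) (by simpa only [Real.rpow_two] using hb.1)
  simp only [Real.rpow_two, hsq, hab, ← Real.sqrt_eq_rpow] at hCS
  have hinner : ‖⟪f, v⟫_ℂ‖ ≤ ∑' n, ‖UnitAddTorus.mFourierCoeff f n‖ *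
      ‖UnitAddTorus.mFourierCoeff v n‖ := by
    have h := (UnitAddTorus.mFourierBasis (d := Fin d)).hasSum_inner_mul_inner f v
    have e : ∀ n, ⟪f, UnitAddTorus.mFourierBasis (d := Fin d) n⟫_ℂ *
        ⟪UnitAddTorus.mFourierBasis (d := Fin d) n, v⟫_ℂ =
        conj (UnitAddTorus.mFourierCoeff f n) * UnitAddTorus.mFourierCoeff v n := by
      intro n
      rw [← UnitAddTorus.mFourierBasis_repr f n, ← UnitAddTorus.mFourierBasis_repr v n,
        HilbertBasis.repr_apply_apply, HilbertBasis.repr_apply_apply, inner_conj_symm]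
    simp_rw [e] at h
    have e2 : ∀ n, ‖conj (UnitAddTorus.mFourierCoeff f n) * UnitAddTorus.mFourierCoeff v n‖ =
        ‖UnitAddTorus.mFourierCoeff f n‖ * ‖UnitAddTorus.mFourierCoeff v n‖ := fun n => by
      rw [norm_mul, RCLike.norm_conj]
    have h3 := norm_tsum_le_tsum_norm (f := fun n => conj (UnitAddTorus.mFourierCoeff f n) *
      UnitAddTorus.mFourierCoeff v n) (by simp_rw [e2]; exact hCS.1)
    simp_rw [e2] at h3
    rw [h.tsum_eq] at h3
    exact h3
  have hfin : ‖⟪f, v⟫_ℂ‖ ≤ hMixNorm m f * Real.sqrt X := by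
    refine (hinner.trans hCS.2).trans ?_
    rw [hMixNorm]
    gcongr
    exact hb.2
  calc ‖⟪f, v⟫_ℂ‖ ^ 2 ≤ (hMixNorm m f * Real.sqrt X) ^ 2 := by gcongr
    _ = _ := by rw [mul_pow, Real.sq_sqrt hX0]

/-- The constant in the estimate of a single level on `𝕋^d`. -/
def tensorConst (d m : ℕ) (S γ δ : ℝ) : ℝ := (levelConst m S δ * (min 1 γ)⁻¹) ^ d

theorem tensorConst_nonneg (d m : ℕ) (S δ : ℝ) (hγ : 0 < γ) : 0 ≤ tensorConst d m S γ δ := by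
  have hL : 0 ≤ levelConst m S δ := zero_le_one.trans (one_le_levelConst m S δ)
  have hγ' : 0 < min 1 γ := lt_min one_pos hγ
  rw [tensorConst]
  positivity

/-- Duality gives ‖v‖² = ⟨f, v⟩ ≤ C ‖f‖ 2^{-m|𝐣|₁} ‖c‖ with the mixed norm of f, and the Bessel
bound of the dual system gives ‖c‖ ≤ C‖v‖; one factor ‖v‖ cancels. -/
theorem norm_levelOp_sq_le (hm : 1 ≤ m) (hγ : 0 < γ) (hS : IsScalingPair φ ψ)
    (hW : IsWavelet m S γ δ ψ) {j : Fin d → ℤ} (hj : ∀ i, -1 ≤ j i) {f : L2Torus d}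
    (hf : MemHMix m f) :
    ‖levelOp ψ j f‖ ^ 2 ≤ tensorConst d m S γ δ * hMixNorm m f ^ 2 *
      (((2 : ℝ) ^ ∑ i, (j i).toNat) ^ (2 * m))⁻¹ := by
  have hψ := hS.memLp_wavelet
  have hγ' : 0 < min 1 γ := lt_min one_pos hγ
  have hL : 0 ≤ levelConst m S δ := zero_le_one.trans (one_le_levelConst m S δ)
  set v := levelOp ψ j f with hv
  set c : MultiIdx j → ℂ := fun k => ⟪tensorDual ψ j k, f⟫_ℂ with hc
  have hvc : v = ∑ k, c k • tensorWavelet ψ j k := levelOp_apply ψ j f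
  have hcv : ∀ k, ⟪tensorDual ψ j k, v⟫_ℂ = c k := by
    intro k
    rw [hvc, inner_sum]
    simp_rw [inner_smul_right, inner_tensorDual_self hγ hψ hW]
    simp
  have h1 : ∑ k, ‖c k‖ ^ 2 ≤ ((min 1 γ)⁻¹) ^ d * ‖v‖ ^ 2 := by
    have := sum_norm_inner_sq_le_of_norm_sum_sq_le Finset.univ (by positivity)
      (norm_sum_tensorDual_sq_le hγ hψ hW j) v
    simpa only [hcv] using this
  -- v is a combination of level-𝐣 wavelets, and these do not distinguish f from v.
  have h2 : ⟪f, v⟫_ℂ = ⟪v, v⟫_ℂ := by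
    have h : ∀ g, ⟪v, g⟫_ℂ = ∑ k, conj (c k) * ⟪tensorWavelet ψ j k, g⟫_ℂ := fun g => by
      rw [hvc, sum_inner]
      simp_rw [inner_smul_left]
    rw [← inner_conj_symm f v, ← inner_conj_symm v v, h f, h v]
    simp_rw [hv, inner_tensorWavelet_levelOp hm hγ hS hW hj]
  have h3 := norm_inner_sum_tensorWavelet_sq_le hm hψ hW j c hf
  rw [← hvc, h2, inner_self_eq_norm_sq_to_K, norm_pow, RCLike.norm_ofReal,
    abs_of_nonneg (norm_nonneg _)] at h3
  set R := (((2 : ℝ) ^ ∑ i, (j i).toNat) ^ (2 * m))⁻¹ with hR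
  have hR0 : 0 ≤ R := by positivity
  have h4 : ‖v‖ ^ 2 * ‖v‖ ^ 2 ≤ (tensorConst d m S γ δ * hMixNorm m f ^ 2 * R) * ‖v‖ ^ 2 := by
    calc _ = (‖v‖ ^ 2) ^ 2 := by ring
      _ ≤ _ := h3
      _ ≤ hMixNorm m f ^ 2 * ((levelConst m S δ ^ d * R) * (((min 1 γ)⁻¹) ^ d * ‖v‖ ^ 2)) := by
          gcongr
      _ = _ := by rw [tensorConst, mul_pow]; ring
  rcases (sq_nonneg ‖v‖).eq_or_lt with h0 | h0
  · rw [← h0]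
    exact mul_nonneg (mul_nonneg (tensorConst_nonneg d m S δ hγ) (sq_nonneg _)) hR0
  · exact le_of_mul_le_mul_right h4 h0

end HyperbolicWavelet
end
noncomputable section
namespace HyperbolicWavelet
open scoped ENNReal InnerProductSpace ComplexConjugate

variable {d m : ℕ} {S γ δ : ℝ} {φ ψ : ℝ → ℝ}

/-! ### Counting levels -/

theorem mem_levels {n : ℕ} {j : Fin d → ℤ} :
    j ∈ levels d n ↔ (∀ i, -1 ≤ j i) ∧ ∑ i, (j i).toNat ≤ n := by
  have hsum : ∑ i, max (j i) 0 = ((∑ i, (j i).toNat : ℕ) : ℤ) := by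
    push_cast
    exact Finset.sum_congr rfl fun i _ => (Int.toNat_eq_max _).symm
  rw [levels, Finset.mem_filter, Fintype.mem_piFinset, hsum, Nat.cast_le]
  refine ⟨fun h => ⟨fun i => (Finset.mem_Icc.1 (h.1 i)).1, h.2⟩, fun h => ⟨fun i => ?_, h.2⟩⟩
  have h1 : (j i).toNat ≤ ∑ i, (j i).toNat :=
    Finset.single_le_sum (f := fun i => (j i).toNat) (fun _ _ => Nat.zero_le _) (Finset.mem_univ i)
  have h2 := h.1 i
  have h3 := h.2
  rw [Finset.mem_Icc]
  omega

theorem levels_mono {n N : ℕ} (h : n ≤ N) : levels d n ⊆ levels d N := fun _ hj =>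
  mem_levels.2 ⟨(mem_levels.1 hj).1, (mem_levels.1 hj).2.trans h⟩

/-- Given s and the last e entries, `j 0` is determined once its sign is known. The sign is needed
because −1 and 0 contribute equally to the sum; it accounts for the factor 2. -/
theorem card_level_le (e N s : ℕ) :
    ((levels (e + 1) N).filter fun j => ∑ i, (j i).toNat = s).card ≤ 2 * (s + 2) ^ e := by
  set F : (Fin (e + 1) → ℤ) → Bool × (Fin e → ℤ) := fun j => (decide (j 0 < 0), fun i => j i.succ)
    with hF
  have hmaps : ∀ j ∈ (levels (e + 1) N).filter fun j => ∑ i, (j i).toNat = s,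
      F j ∈ (Finset.univ : Finset Bool) ×ˢ
        Fintype.piFinset fun _ : Fin e => Finset.Icc (-1 : ℤ) s := by
    intro j hj
    obtain ⟨h1, h2⟩ := Finset.mem_filter.1 hj
    refine Finset.mem_product.2 ⟨Finset.mem_univ _, Fintype.mem_piFinset.2 fun i => ?_⟩
    have h3 := (mem_levels.1 h1).1 i.succ
    have h4 : (j i.succ).toNat ≤ ∑ i, (j i).toNat :=
      Finset.single_le_sum (f := fun i => (j i).toNat) (fun _ _ => Nat.zero_le _)
        (Finset.mem_univ _)
    simp only [hF, Finset.mem_Icc]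
    omega
  have hinj : Set.InjOn F ((levels (e + 1) N).filter fun j => ∑ i, (j i).toNat = s) := by
    intro j hj j' hj' h
    obtain ⟨h1, h2⟩ := Finset.mem_filter.1 hj
    obtain ⟨h1', h2'⟩ := Finset.mem_filter.1 hj'
    have h3 : (j 0 < 0 ↔ j' 0 < 0) := by simpa [hF] using congrArg Prod.fst h
    have h4 : ∀ i : Fin e, j i.succ = j' i.succ := fun i => congrFun (congrArg Prod.snd h) i
    have h5 := (mem_levels.1 h1).1 0
    have h5' := (mem_levels.1 h1').1 0
    rw [Fin.sum_univ_succ] at h2 h2'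
    simp_rw [h4] at h2
    funext i
    refine Fin.cases ?_ h4 i
    omega
  refine (Finset.card_le_card_of_injOn F hmaps hinj).trans (le_of_eq ?_)
  rw [Finset.card_product, Fintype.card_piFinset]
  simp only [Finset.card_univ, Fintype.card_bool, Int.card_Icc, Finset.prod_const, Fintype.card_fin]
  congr 2

theorem sum_levels_le {e N : ℕ} {t : Finset (Fin (e + 1) → ℤ)} (ht : t ⊆ levels (e + 1) N)
    {u : Finset ℕ} (hu : ∀ j ∈ t, ∑ i, (j i).toNat ∈ u) {g : ℕ → ℝ} (hg : ∀ s, 0 ≤ g s) :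
    ∑ j ∈ t, g (∑ i, (j i).toNat) ≤ ∑ s ∈ u, 2 * (s + 2 : ℝ) ^ e * g s := by
  rw [← Finset.sum_fiberwise_of_maps_to hu]
  refine Finset.sum_le_sum fun s _ => ?_
  have h1 : ∀ j ∈ t.filter fun j => ∑ i, (j i).toNat = s, g (∑ i, (j i).toNat) = g s :=
    fun j hj => by rw [(Finset.mem_filter.1 hj).2]
  rw [Finset.sum_congr rfl h1, Finset.sum_const, nsmul_eq_mul]
  refine mul_le_mul_of_nonneg_right ?_ (hg s)
  have h2 := (Finset.card_le_card (Finset.filter_subset_filter (fun j => ∑ i, (j i).toNat = s)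
    ht)).trans (card_level_le e N s)
  exact_mod_cast h2

theorem summable_add_three_pow_mul (e : ℕ) :
    Summable fun t : ℕ => (t + 3 : ℝ) ^ e * (1 / 4 : ℝ) ^ t := by
  have h1 : Summable fun t : ℕ => (t : ℝ) ^ e * (1 / 4 : ℝ) ^ t :=
    summable_pow_mul_geometric_of_norm_lt_one e (by norm_num)
  -- 64 = 4³ undoes the effect of the shift by 3 on the geometric factor.
  have h2 := ((summable_nat_add_iff 3).2 h1).mul_left 64
  refine h2.congr fun t => ?_
  push_cast
  ring

/-- The constant in the tail estimate. -/
def tailConst (e : ℕ) : ℝ := 2 * ∑' t : ℕ, (t + 3 : ℝ) ^ e * (1 / 4 : ℝ) ^ t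

theorem tailConst_nonneg (e : ℕ) : 0 ≤ tailConst e :=
  mul_nonneg zero_le_two (tsum_nonneg fun t => by positivity)

/-- With s = n + t, the bound n + t + 2 ≤ n(t + 3), valid for n ≥ 1, separates n from t. Since m ≥
1, 2^{-2mt} ≤ 4^{-t}, so the series in t converges with a constant depending on e only. -/
theorem sum_tail_le {e n : ℕ} (hm : 1 ≤ m) (hn : 1 ≤ n) (N : ℕ) :
    ∑ j ∈ levels (e + 1) N \ levels (e + 1) n, (((2 : ℝ) ^ ∑ i, (j i).toNat) ^ (2 * m))⁻¹ ≤
      tailConst e * ((n : ℝ) ^ e * (((2 : ℝ) ^ n) ^ (2 * m))⁻¹) := by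
  have h1 := sum_levels_le (t := levels (e + 1) N \ levels (e + 1) n)
    (u := (Finset.range (N + 1)).image (n + ·)) (Finset.sdiff_subset) (fun j hj => by
      obtain ⟨h1, h2⟩ := Finset.mem_sdiff.1 hj
      obtain ⟨h3, h4⟩ := mem_levels.1 h1
      have h5 : n < ∑ i, (j i).toNat := by
        by_contra h
        exact h2 (mem_levels.2 ⟨h3, not_lt.1 h⟩)
      exact Finset.mem_image.2 ⟨∑ i, (j i).toNat - n, Finset.mem_range.2 (by omega), by omega⟩)
    (g := fun s => (((2 : ℝ) ^ s) ^ (2 * m))⁻¹) (fun s => by positivity)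
  refine h1.trans ?_
  rw [Finset.sum_image fun a _ b _ h => Nat.add_left_cancel h]
  have h2 : ∀ t : ℕ, 2 * (((n + t : ℕ) : ℝ) + 2) ^ e * (((2 : ℝ) ^ (n + t)) ^ (2 * m))⁻¹ ≤
      2 * ((n : ℝ) ^ e * (((2 : ℝ) ^ n) ^ (2 * m))⁻¹) * ((t + 3 : ℝ) ^ e * (1 / 4 : ℝ) ^ t) := by
    intro t
    have hn' : (1 : ℝ) ≤ n := by exact_mod_cast hn
    have h3 : (((n + t : ℕ) : ℝ) + 2) ^ e ≤ (n : ℝ) ^ e * (t + 3 : ℝ) ^ e := by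
      rw [← mul_pow]
      gcongr
      push_cast
      have ht : (0 : ℝ) ≤ t := Nat.cast_nonneg t
      nlinarith
    have h4 : (((2 : ℝ) ^ (n + t)) ^ (2 * m))⁻¹ ≤
        (((2 : ℝ) ^ n) ^ (2 * m))⁻¹ * (1 / 4 : ℝ) ^ t := by
      rw [pow_add, mul_pow, mul_inv]
      gcongr
      rw [one_div, inv_pow]
      gcongr
      calc (4 : ℝ) ^ t = ((2 : ℝ) ^ t) ^ 2 := by rw [← pow_mul, mul_comm, pow_mul]; norm_num
        _ ≤ _ := pow_le_pow_right₀ (one_le_pow₀ one_le_two) (by omega)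
    calc _ ≤ 2 * ((n : ℝ) ^ e * (t + 3 : ℝ) ^ e) *
          ((((2 : ℝ) ^ n) ^ (2 * m))⁻¹ * (1 / 4 : ℝ) ^ t) := by gcongr
      _ = _ := by ring
  refine (Finset.sum_le_sum fun t _ => h2 t).trans ?_
  rw [← Finset.mul_sum]
  have h5 := (summable_add_three_pow_mul e).sum_le_tsum (Finset.range (N + 1))
    fun t _ => by positivity
  calc _ ≤ 2 * ((n : ℝ) ^ e * (((2 : ℝ) ^ n) ^ (2 * m))⁻¹) *
        ∑' t : ℕ, (t + 3 : ℝ) ^ e * (1 / 4 : ℝ) ^ t := by gcongr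
    _ = _ := by rw [tailConst]; ring

/-! ### The projection -/

theorem waveletProj_apply (n : ℕ) (f : L2Torus d) :
    waveletProj d ψ n f = ∑ j ∈ levels d n, levelOp ψ j f := by
  rw [waveletProj_eq_sum]
  simp

theorem waveletProj_tensorWavelet (hm : 1 ≤ m) (hγ : 0 < γ) (hS : IsScalingPair φ ψ)
    (hW : IsWavelet m S γ δ ψ) {n : ℕ} {j : Fin d → ℤ} (hj : j ∈ levels d n) (k : MultiIdx j) :
    waveletProj d ψ n (tensorWavelet ψ j k) = tensorWavelet ψ j k := by
  rw [waveletProj_apply, Finset.sum_eq_single_of_mem j hj,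
    levelOp_tensorWavelet_self hγ hS.memLp_wavelet hW]
  intro j' hj' h
  exact levelOp_tensorWavelet_of_ne hm hS hW (mem_levels.1 hj').1 (mem_levels.1 hj).1 h k

/-- Although written with a biorthogonal system, `P_n` is an orthogonal projection: f − P_n f is
orthogonal to every wavelet of an admissible level. -/
theorem inner_waveletProj_sub (hm : 1 ≤ m) (hγ : 0 < γ) (hS : IsScalingPair φ ψ)
    (hW : IsWavelet m S γ δ ψ) (n : ℕ) (f : L2Torus d) :
    ⟪waveletProj d ψ n f, f - waveletProj d ψ n f⟫_ℂ = 0 := by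
  have h1 : ∀ j ∈ levels d n, ∀ k : MultiIdx j,
      ⟪tensorWavelet ψ j k, f - waveletProj d ψ n f⟫_ℂ = 0 := by
    intro j hj k
    rw [inner_sub_right, waveletProj_apply, inner_sum, Finset.sum_eq_single_of_mem j hj,
      inner_tensorWavelet_levelOp hm hγ hS hW (mem_levels.1 hj).1, sub_self]
    intro j' hj' h
    exact inner_tensorWavelet_levelOp_of_ne hm hS hW (mem_levels.1 hj).1 (mem_levels.1 hj').1
      h.symm k f
  conv_lhs => rw [waveletProj_apply, sum_inner]
  refine Finset.sum_eq_zero fun j hj => ?_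
  rw [← waveletProj_apply, levelOp_apply, sum_inner]
  refine Finset.sum_eq_zero fun k _ => ?_
  rw [inner_smul_left, h1 j hj k, mul_zero]

theorem norm_sub_waveletProj_le (hm : 1 ≤ m) (hγ : 0 < γ) (hS : IsScalingPair φ ψ)
    (hW : IsWavelet m S γ δ ψ) (n : ℕ) (f : L2Torus d) : ‖f - waveletProj d ψ n f‖ ≤ ‖f‖ := by
  have h := norm_add_sq_eq_norm_sq_add_norm_sq_of_inner_eq_zero _ _
    (inner_waveletProj_sub hm hγ hS hW n f)
  rw [add_sub_cancel] at h
  nlinarith [norm_nonneg f, norm_nonneg (f - waveletProj d ψ n f), norm_nonneg (waveletProj d ψ n f)]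

theorem eventually_waveletProj_eq (hm : 1 ≤ m) (hγ : 0 < γ) (hS : IsScalingPair φ ψ)
    (hW : IsWavelet m S γ δ ψ) {g : L2Torus d} (hg : g ∈ Submodule.span ℂ (waveletSet d ψ)) :
    ∃ N₀ : ℕ, ∀ N ≥ N₀, waveletProj d ψ N g = g := by
  induction hg using Submodule.span_induction with
  | mem x hx =>
    obtain ⟨j, hj, k, rfl⟩ := hx
    exact ⟨∑ i, (j i).toNat, fun N hN =>
      waveletProj_tensorWavelet hm hγ hS hW (mem_levels.2 ⟨hj, hN⟩) k⟩
  | zero => exact ⟨0, fun N _ => map_zero _⟩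
  | add x y _ _ hx hy =>
    obtain ⟨N₁, h₁⟩ := hx
    obtain ⟨N₂, h₂⟩ := hy
    refine ⟨max N₁ N₂, fun N hN => ?_⟩
    rw [map_add, h₁ N (le_of_max_le_left hN), h₂ N (le_of_max_le_right hN)]
  | smul c x _ hx =>
    obtain ⟨N₁, h₁⟩ := hx
    exact ⟨N₁, fun N hN => by rw [map_smul, h₁ N hN]⟩

/-- P_N eventually fixes each finite combination of wavelets, these are dense, and g ↦ g − P_N g
does not increase norms. -/
theorem tendsto_waveletProj (hm : 1 ≤ m) (hγ : 0 < γ) (hS : IsScalingPair φ ψ)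
    (hW : IsWavelet m S γ δ ψ) (f : L2Torus d) :
    Filter.Tendsto (fun N => waveletProj d ψ N f) Filter.atTop (nhds f) := by
  rw [Metric.tendsto_atTop]
  intro ε hε
  have hf : f ∈ closure (Submodule.span ℂ (waveletSet d ψ) : Set (L2Torus d)) := by
    have : f ∈ (Submodule.span ℂ (waveletSet d ψ)).topologicalClosure := by
      rw [span_waveletSet_dense hm hγ hS hW]; trivial
    exact this
  obtain ⟨g, hg, hfg⟩ := Metric.mem_closure_iff.1 hf ε hε
  obtain ⟨N₀, hN₀⟩ := eventually_waveletProj_eq hm hγ hS hW hg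
  refine ⟨N₀, fun N hN => ?_⟩
  have h1 : f - waveletProj d ψ N f = (f - g) - waveletProj d ψ N (f - g) := by
    rw [map_sub, hN₀ N hN]; abel
  rw [dist_comm, dist_eq_norm, h1]
  refine (norm_sub_waveletProj_le hm hγ hS hW N _).trans_lt ?_
  rwa [← dist_eq_norm]

theorem norm_waveletProj_sub_sq (hm : 1 ≤ m) (hS : IsScalingPair φ ψ)
    (hW : IsWavelet m S γ δ ψ) {n N : ℕ} (h : n ≤ N) (f : L2Torus d) :
    ‖waveletProj d ψ N f - waveletProj d ψ n f‖ ^ 2 =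
      ∑ j ∈ levels d N \ levels d n, ‖levelOp ψ j f‖ ^ 2 := by
  rw [waveletProj_apply, waveletProj_apply, ← Finset.sum_sdiff (levels_mono h), add_sub_cancel_right]
  refine norm_sum_sq_of_pairwise_inner_eq_zero _ _ fun i hi j hj hij => ?_
  exact inner_levelOp_levelOp_of_ne hm hS hW (mem_levels.1 (Finset.mem_sdiff.1 hi).1).1
    (mem_levels.1 (Finset.mem_sdiff.1 hj).1).1 hij f f

theorem hMixNorm_nonneg (m : ℕ) (f : L2Torus d) : 0 ≤ hMixNorm m f := Real.sqrt_nonneg _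

theorem norm_sub_waveletProj_sq_le {e : ℕ} (hm : 1 ≤ m) (hγ : 0 < γ) (hS : IsScalingPair φ ψ)
    (hW : IsWavelet m S γ δ ψ) {n : ℕ} (hn : 1 ≤ n) {f : L2Torus (e + 1)} (hf : MemHMix m f) :
    ‖f - waveletProj (e + 1) ψ n f‖ ^ 2 ≤ tensorConst (e + 1) m S γ δ * hMixNorm m f ^ 2 *
      (tailConst e * ((n : ℝ) ^ e * (((2 : ℝ) ^ n) ^ (2 * m))⁻¹)) := by
  have h1 : Filter.Tendsto
      (fun N => ‖waveletProj (e + 1) ψ N f - waveletProj (e + 1) ψ n f‖ ^ 2) Filter.atTop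
      (nhds (‖f - waveletProj (e + 1) ψ n f‖ ^ 2)) :=
    (((tendsto_waveletProj hm hγ hS hW f).sub_const _).norm).pow 2
  refine le_of_tendsto h1 (Filter.eventually_atTop.2 ⟨n, fun N hN => ?_⟩)
  rw [norm_waveletProj_sub_sq hm hS hW hN]
  calc _ ≤ ∑ j ∈ levels (e + 1) N \ levels (e + 1) n, tensorConst (e + 1) m S γ δ *
        hMixNorm m f ^ 2 * (((2 : ℝ) ^ ∑ i, (j i).toNat) ^ (2 * m))⁻¹ :=
        Finset.sum_le_sum fun j hj =>
          norm_levelOp_sq_le hm hγ hS hW (mem_levels.1 (Finset.mem_sdiff.1 hj).1).1 hf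
    _ ≤ _ := by
        rw [← Finset.mul_sum]
        have := tensorConst_nonneg (e + 1) m S δ hγ
        gcongr
        exact sum_tail_le hm hn N

/-! ### The rank of the projection -/

/-- The wavelets of the admissible levels span the range, since P_n fixes them, and are independent
by biorthogonality; level 𝐣 has 2^{|𝐣|₁} of them. -/
theorem projRank_eq_sum (hm : 1 ≤ m) (hγ : 0 < γ) (hS : IsScalingPair φ ψ)
    (hW : IsWavelet m S γ δ ψ) (n : ℕ) :
    projRank d ψ n = ∑ j ∈ levels d n, 2 ^ ∑ i, (j i).toNat := by
  set x : (Σ j : levels d n, MultiIdx j.1) → L2Torus d := fun p => tensorWavelet ψ p.1.1 p.2 with hx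
  have hinner : ∀ p q, ⟪tensorDual ψ p.1.1 p.2, x q⟫_ℂ = if p = q then 1 else 0 := by
    rintro ⟨⟨j, hj⟩, k⟩ ⟨⟨j', hj'⟩, l⟩
    by_cases h : j = j'
    · subst h
      simp only [hx, inner_tensorDual_self hγ hS.memLp_wavelet hW, Sigma.mk.injEq, heq_eq_eq,
        true_and]
    · rw [if_neg (by simp [h])]
      exact inner_tensorDual_of_ne hm hS hW (mem_levels.1 hj).1 (mem_levels.1 hj').1 h k l
  have hli : LinearIndependent ℂ x := by
    rw [Fintype.linearIndependent_iff]
    intro c hc p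
    have h1 : ⟪tensorDual ψ p.1.1 p.2, ∑ q, c q • x q⟫_ℂ = c p := by
      rw [inner_sum]
      simp_rw [inner_smul_right, hinner]
      simp
    rw [← h1, hc, inner_zero_right]
  have hrange : LinearMap.range (waveletProj d ψ n).toLinearMap =
      Submodule.span ℂ (Set.range x) := by
    refine le_antisymm ?_ (Submodule.span_le.2 ?_)
    · rintro _ ⟨f, rfl⟩
      change waveletProj d ψ n f ∈ _
      rw [waveletProj_apply]
      refine Submodule.sum_mem _ fun j hj => ?_
      rw [levelOp_apply]
      exact Submodule.sum_mem _ fun k _ => Submodule.smul_mem _ _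
        (Submodule.subset_span ⟨⟨⟨j, hj⟩, k⟩, rfl⟩)
    · rintro _ ⟨⟨⟨j, hj⟩, k⟩, rfl⟩
      exact ⟨tensorWavelet ψ j k, waveletProj_tensorWavelet hm hγ hS hW hj k⟩
  rw [projRank, hrange, finrank_span_eq_card hli, Fintype.card_sigma,
    ← Finset.sum_coe_sort (levels d n)]
  refine Finset.sum_congr rfl fun j _ => ?_
  rw [Fintype.card_pi, ← Finset.prod_pow_eq_pow_sum]
  simp

theorem two_pow_le_projRank {e : ℕ} (hm : 1 ≤ m) (hγ : 0 < γ) (hS : IsScalingPair φ ψ)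
    (hW : IsWavelet m S γ δ ψ) (n : ℕ) : 2 ^ n ≤ projRank (e + 1) ψ n := by
  rw [projRank_eq_sum hm hγ hS hW]
  -- The single level (n, −1, …, −1) already has 2^n wavelets.
  set j : Fin (e + 1) → ℤ := Fin.cons n fun _ => -1 with hj
  have hsum : ∑ i, (j i).toNat = n := by
    rw [Fin.sum_univ_succ]
    simp [hj]
  have hmem : j ∈ levels (e + 1) n := by
    refine mem_levels.2 ⟨fun i => ?_, hsum.le⟩
    refine Fin.cases ?_ (fun i => ?_) i
    · simp only [hj, Fin.cons_zero]; omega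
    · simp [hj]
  have := Finset.single_le_sum (f := fun j : Fin (e + 1) → ℤ => 2 ^ ∑ i, (j i).toNat)
    (fun _ _ => Nat.zero_le _) hmem
  simpa only [hsum] using this

theorem projRank_le {e : ℕ} (hm : 1 ≤ m) (hγ : 0 < γ) (hS : IsScalingPair φ ψ)
    (hW : IsWavelet m S γ δ ψ) {n : ℕ} (hn : 1 ≤ n) :
    (projRank (e + 1) ψ n : ℝ) ≤ 4 * 3 ^ e * ((n : ℝ) ^ e * 2 ^ n) := by
  rw [projRank_eq_sum hm hγ hS hW]
  push_cast
  have hn' : (1 : ℝ) ≤ n := by exact_mod_cast hn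
  calc ∑ j ∈ levels (e + 1) n, (2 : ℝ) ^ ∑ i, (j i).toNat
      ≤ ∑ s ∈ Finset.range (n + 1), 2 * (s + 2 : ℝ) ^ e * 2 ^ s :=
        sum_levels_le (g := fun s => (2 : ℝ) ^ s) subset_rfl
          (fun j hj => Finset.mem_range.2 (Nat.lt_succ_of_le (mem_levels.1 hj).2))
          fun s => by positivity
    _ ≤ ∑ s ∈ Finset.range (n + 1), 2 * (3 ^ e * (n : ℝ) ^ e) * 2 ^ s := by
        refine Finset.sum_le_sum fun s hs => ?_
        rw [← mul_pow]
        have : (s : ℝ) ≤ n := by exact_mod_cast Nat.lt_succ_iff.1 (Finset.mem_range.1 hs)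
        gcongr
        linarith
    _ = 2 * (3 ^ e * (n : ℝ) ^ e) * (2 ^ (n + 1) - 1) := by
        rw [← Finset.mul_sum, geom_sum_eq (by norm_num)]; norm_num
    _ ≤ 2 * (3 ^ e * (n : ℝ) ^ e) * 2 ^ (n + 1) := by gcongr; linarith
    _ = _ := by ring

/-- The upper bound on R bounds R^{-m} from below at the cost of n^{me}. The lower bound gives log R
≥ n log 2, whose power (m + 1/2)e recovers n^{me} and leaves n^{e/2}. -/
theorem rate_le_of_rank_bounds {e n m : ℕ} (hn : 1 ≤ n) {A R : ℝ} (hA : 0 < A)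
    (h1 : (2 : ℝ) ^ n ≤ R) (h2 : R ≤ A * ((n : ℝ) ^ e * 2 ^ n)) :
    (2 : ℝ) ^ (-((m : ℝ) * n)) * (n : ℝ) ^ ((e : ℝ) / 2) ≤
      A ^ m * (Real.log 2 ^ (((m : ℝ) + 1 / 2) * e))⁻¹ *
        (R ^ (-(m : ℝ)) * Real.log R ^ (((m : ℝ) + 1 / 2) * e)) := by
  have hn' : (0 : ℝ) < n := by exact_mod_cast hn
  have hR : 0 < R := lt_of_lt_of_le (by positivity) h1
  have hlog2 : 0 < Real.log 2 := Real.log_pos one_lt_two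
  set p : ℝ := ((m : ℝ) + 1 / 2) * e with hp
  have hp0 : 0 ≤ p := by positivity
  have hlog : (n : ℝ) * Real.log 2 ≤ Real.log R := by
    rw [← Real.log_pow]
    exact Real.log_le_log (by positivity) h1
  have h3 : (n : ℝ) ^ p * Real.log 2 ^ p ≤ Real.log R ^ p := by
    rw [← Real.mul_rpow hn'.le hlog2.le]
    exact Real.rpow_le_rpow (by positivity) hlog hp0
  have h4 : (A ^ m * ((n : ℝ) ^ ((m : ℝ) * e) * 2 ^ ((m : ℝ) * n)))⁻¹ ≤ R ^ (-(m : ℝ)) := by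
    rw [Real.rpow_neg hR.le, Real.rpow_natCast]
    refine inv_anti₀ (by positivity) ?_
    refine (pow_le_pow_left₀ hR.le h2 m).trans (le_of_eq ?_)
    rw [mul_pow, mul_pow, ← pow_mul, ← pow_mul, ← Nat.cast_mul, ← Nat.cast_mul, Real.rpow_natCast,
      Real.rpow_natCast, mul_comm e, mul_comm n]
  have h5 : (n : ℝ) ^ p = (n : ℝ) ^ ((m : ℝ) * e) * (n : ℝ) ^ ((e : ℝ) / 2) := by
    rw [← Real.rpow_add hn']
    congr 1
    rw [hp]; ring
  have hq : 0 < Real.log 2 ^ p := Real.rpow_pos_of_pos hlog2 p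
  have hne : 0 < (n : ℝ) ^ ((m : ℝ) * e) := Real.rpow_pos_of_pos hn' _
  have h2ne : 0 < (2 : ℝ) ^ ((m : ℝ) * n) := Real.rpow_pos_of_pos two_pos _
  have hne' : 0 < (n : ℝ) ^ ((e : ℝ) / 2) := Real.rpow_pos_of_pos hn' _
  calc (2 : ℝ) ^ (-((m : ℝ) * n)) * (n : ℝ) ^ ((e : ℝ) / 2)
      = A ^ m * (Real.log 2 ^ p)⁻¹ * ((A ^ m * ((n : ℝ) ^ ((m : ℝ) * e) * 2 ^ ((m : ℝ) * n)))⁻¹ *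
          ((n : ℝ) ^ p * Real.log 2 ^ p)) := by
        rw [h5, Real.rpow_neg zero_le_two]
        field_simp
    _ ≤ _ := by gcongr

end HyperbolicWavelet
end
-- The error estimate and its comparison with the rank
open HyperbolicWavelet in
theorem mainTheorem7 (d m : ℕ) (hd : 1 ≤ d) (hm : 1 ≤ m) (S γ δ : ℝ) (hγ : 0 < γ) :
    ∃ C₁ C₂ : ℝ, ∀ φ ψ : ℝ → ℝ, IsScalingPair φ ψ → IsWavelet m S γ δ ψ →
      ∀ f : L2Torus d, MemHMix m f → ∀ n : ℕ, 1 ≤ n →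
        ‖f - waveletProj d ψ n f‖ ≤
            C₁ * ((2 : ℝ) ^ (-((m : ℝ) * n)) * (n : ℝ) ^ (((d : ℝ) - 1) / 2) * hMixNorm m f) ∧
        (2 : ℝ) ^ (-((m : ℝ) * n)) * (n : ℝ) ^ (((d : ℝ) - 1) / 2) * hMixNorm m f ≤
            C₂ * ((projRank d ψ n : ℝ) ^ (-(m : ℝ)) *
              Real.log (projRank d ψ n) ^ (((m : ℝ) + 1 / 2) * ((d : ℝ) - 1)) *
              hMixNorm m f) := by
  obtain ⟨e, rfl⟩ : ∃ e, d = e + 1 := ⟨d - 1, by omega⟩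
  have he : ((e + 1 : ℕ) : ℝ) - 1 = e := by push_cast; ring
  rw [he]
  -- Both constants are fixed before φ and ψ. The square root appears because the error is bounded
  -- in squared form; 4 · 3^e is the constant of `projRank_le`.
  refine ⟨Real.sqrt (tensorConst (e + 1) m S γ δ * tailConst e),
    (4 * 3 ^ e) ^ m * (Real.log 2 ^ (((m : ℝ) + 1 / 2) * e))⁻¹, fun φ ψ hS hW f hf n hn => ⟨?_, ?_⟩⟩
  · have hT := tensorConst_nonneg (e + 1) m S δ hγ
    have hK := tailConst_nonneg e
    have hH := hMixNorm_nonneg m f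
    refine (abs_le_of_sq_le_sq' ?_ (by positivity)).2
    refine (norm_sub_waveletProj_sq_le hm hγ hS hW hn hf).trans (le_of_eq ?_)
    have h1 : ((n : ℝ) ^ ((e : ℝ) / 2)) ^ 2 = (n : ℝ) ^ e := by
      rw [← Real.rpow_natCast, ← Real.rpow_mul (Nat.cast_nonneg n), Nat.cast_two,
        div_mul_cancel₀ _ two_ne_zero, Real.rpow_natCast]
    have h2 : ((2 : ℝ) ^ (-((m : ℝ) * n))) ^ 2 = (((2 : ℝ) ^ n) ^ (2 * m))⁻¹ := by
      rw [Real.rpow_neg zero_le_two, inv_pow, ← Nat.cast_mul, Real.rpow_natCast, ← pow_mul,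
        ← pow_mul]
      congr 2
      ring
    rw [mul_pow, mul_pow, mul_pow, Real.sq_sqrt (by positivity), h1, h2]
    ring
  · rw [← mul_assoc]
    refine mul_le_mul_of_nonneg_right ?_ (hMixNorm_nonneg m f)
    refine rate_le_of_rank_bounds hn (by positivity) ?_ (projRank_le hm hγ hS hW hn)
    exact_mod_cast two_pow_le_projRank (e := e) hm hγ hS hW n
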